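/- **Proposition (Estimates for medium frequency cubic normal form coefficients).** Write $\widehat v(\xi)=\int_{\mathbb R}e^{-i\xi y}v(y)\,dy$, $D_y=\frac{1}{i\rho}\partial_y$ and $\Box_{\mathcal H}=\partial_\rho^2-\rho^{-2}\partial_y^2$. For $\rho,s>0$ and $\xi\in\mathbb R$ put $$\psi(\rho,s;\xi)=\int_s^\rho\Big(\frac{\xi^2}{\zeta^2}+1\Big)^{1/2}d\zeta,\qquad U(\rho,s;\xi)=\frac{\sin\psi(\rho,s;\xi)}{(\xi^2/s^2+1)^{1/2}},$$ and let $U(\rho,s;\partial_y)$ be the Fourier multiplier in $y$ with symbol $U(\rho,s;\cdot)$, that is $U(\rho,s;\partial_y)g(y)=\frac1{2\pi}\int U(\rho,s;\xi)e^{iy\xi}\widehat g(\xi)\,d\xi$. Let $\beta$ be a Schwartz function on $\mathbb R$ for which there are $0<c<C$ with $\widehat\beta(\xi)=0$ whenever $|\xi|<c$ or $|\xi|>C$. Let $\chi_1\in C_0^\infty(\mathbb R)$ satisfy $\chi_1(\zeta)=1$ for $\frac12<|\zeta|<2$ and $\chi_1=0$ in a neighborhood of $0$, and let $\chi\in C_0^\infty(\mathbb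 R)$. For $n\in\{1,3\}$ define $$K_n(\rho,y)=\int_1^\rho e^{ins}\,\big(U(\rho,s;\partial_y)\,\beta(s\,\cdot)\big)(y)\,\chi_1\big(\tfrac s\rho\big)\,ds,\qquad \mathcal E_{K_n}=(\Box_{\mathcal H}+1)K_n-e^{in\rho}\beta(\rho y).$$ Then $K_n$ is $C^\infty$ on $(0,\infty)\times\mathbb R$, and for all $k,l\ge0$ there is a constant $C_{k,l}$ (depending only on $k,l,n,\beta,\chi_1,\chi$) such that for all $\rho\ge1$ and $y\in\mathbb R$ $$\big|\partial_\rho^kD_y^l\big(\chi(y)K_n\big)\big|\le C_{k,l},\qquad \big|\partial_\rho^kD_y^l\big(\chi(y)\mathcal E_{K_n}\big)\big|\le\rho^{-1}C_{k,l}.$$ Moreover, uniformly in $\rho\ge 1$, $$\|\chi K_n(\rho)\|_{B^\infty_\rho}+\|D_y(\chi K_n)(\rho)\|_{B^\infty_\rho}+\|\partial_\rho(\chi K_n)(\rho)\|_{B^\infty_\rho}\lesssim1 .$$ Here, for $\lambda=2^j$, $j=0,1,2,\dots$, $P_\lambda$ is the Fourier multiplier in $y$ with symbol $p_\lambda$,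 where $(p_\lambda)$ is any smooth dyadic partition of unity, $\sum_\lambda p_\lambda\equiv1$, such that $p_1\in C_0^\infty(\mathbb R)$ equals $1$ near $0$ and $p_\lambda(\xi)=p_0(\lambda^{-1}\xi)$ for $\lambda\ge2$ with some $p_0\in C_0^\infty(\mathbb R\setminus\{0\})$; $P_{\le\rho}=\sum_{\lambda\le\rho}P_\lambda$; and $$\|v\|_{B^\infty_\rho}=\|P_{\le\rho}v\|_{L^\infty}+\sum_{\lambda\ge\rho}\ln(\lambda/\rho)\,\|P_\lambda v\|_{L^\infty}.$$ The implicit constant depends only on $n,\beta,\chi_1,\chi$ and the choice of the partition $(p_\lambda)$. -/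

import Mathlib

open Set Filter Topology MeasureTheory
open scoped ContDiff NNReal ENNReal SchwartzMap

noncomputable section

namespace HypKG

/-- The Fourier transform with the normalization `v̂(ξ) = ∫ e^{-iξy} v(y) dy`. -/
def fourierHat (v : ℝ → ℂ) (ξ : ℝ) : ℂ :=
  ∫ y : ℝ, Complex.exp (-(Complex.I * ξ * y)) * v y

/-- The Fourier multiplier `m(∂_y)`: `(2π)⁻¹ ∫ m(ξ) e^{iyξ} v̂(ξ) dξ`. -/
def fourierMul (m : ℝ → ℝ) (v : ℝ → ℂ) (y : ℝ) : ℂ :=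
  (1 / (2 * (Real.pi : ℂ))) *
    ∫ ξ : ℝ, (m ξ : ℂ) * Complex.exp (Complex.I * y * ξ) * fourierHat v ξ

/-- The approximate phase `ψ(ρ,s;ξ) = ∫_s^ρ (ξ²/ζ² + 1)^{1/2} dζ`. -/
def phase (ρ s ξ : ℝ) : ℝ :=
  ∫ ζ in s..ρ, Real.sqrt (ξ ^ 2 / ζ ^ 2 + 1)

/-- The symbol `U(ρ,s;ξ) = sin ψ(ρ,s;ξ) / (ξ²/s² + 1)^{1/2}` of the approximate propagator. -/
def propagator (ρ s ξ : ℝ) : ℝ :=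
  Real.sin (phase ρ s ξ) / Real.sqrt (ξ ^ 2 / s ^ 2 + 1)

/-- The approximate Duhamel parametrix
`K_n(ρ,y) = ∫_1^ρ e^{ins} (U(ρ,s;∂_y) β(s·))(y) χ₁(s/ρ) ds`. -/
def duhamelK (n : ℕ) (β : ℝ → ℂ) (χ₁ : ℝ → ℝ) (ρ y : ℝ) : ℂ :=
  ∫ s in (1 : ℝ)..ρ,
    Complex.exp (Complex.I * n * s) *
      fourierMul (propagator ρ s) (fun z => β (s * z)) y * (χ₁ (s / ρ) : ℂ)

/-- The derivative `∂_ρ` of a function of `(ρ, y)`. -/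
def dRho (F : ℝ → ℝ → ℂ) (ρ y : ℝ) : ℂ := deriv (fun r => F r y) ρ

/-- The derivative `D_y = (iρ)⁻¹ ∂_y` of a function of `(ρ, y)`. -/
def dY (F : ℝ → ℝ → ℂ) (ρ y : ℝ) : ℂ :=
  (1 / (Complex.I * ρ)) * deriv (fun z => F ρ z) y

/-- The operator `□_H + 1 = ∂_ρ² - ρ⁻² ∂_y² + 1`. -/
def boxPlusOne (F : ℝ → ℝ → ℂ) (ρ y : ℝ) : ℂ :=
  deriv (deriv (fun r => F r y)) ρ - (1 / (ρ : ℂ) ^ 2) * deriv (deriv (fun z => F ρ z)) y + F ρ y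

/-- The error `(□_H + 1) K_n - e^{inρ} β(ρy)`. -/
def errorK (n : ℕ) (β : ℝ → ℂ) (χ₁ : ℝ → ℝ) (ρ y : ℝ) : ℂ :=
  boxPlusOne (duhamelK n β χ₁) ρ y - Complex.exp (Complex.I * n * ρ) * β (ρ * y)

/-- Multiplication by a cutoff in the variable `y`. -/
def cutoff (χ : ℝ → ℝ) (F : ℝ → ℝ → ℂ) (ρ y : ℝ) : ℂ := (χ y : ℂ) * F ρ y

/-- The symbol of the `j`-th Littlewood-Paley block, of frequency `λ = 2^j`: it is `pLow` when
`λ = 1` and `p₀(λ⁻¹ ξ)` when `λ = 2, 4, 8, …`. -/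
def lpSymbol (pLow p₀ : ℝ → ℝ) (j : ℕ) (ξ : ℝ) : ℝ :=
  if j = 0 then pLow ξ else p₀ (ξ / 2 ^ j)

/-- A smooth inhomogeneous dyadic partition of unity in the frequency variable. -/
structure LittlewoodPaley where
  pLow : ℝ → ℝ
  p₀ : ℝ → ℝ
  pLow_smooth : ContDiff ℝ ∞ pLow
  pLow_compact : HasCompactSupport pLow
  pLow_one : ∀ᶠ ξ in 𝓝 (0 : ℝ), pLow ξ = 1
  p₀_smooth : ContDiff ℝ ∞ p₀
  p₀_compact : HasCompactSupport p₀
  p₀_annular : ∀ᶠ ξ in 𝓝 (0 : ℝ), p₀ ξ = 0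
  partition : ∀ ξ : ℝ, HasSum (fun j : ℕ => lpSymbol pLow p₀ j ξ) 1

/-- The projection `P_λ` with `λ = 2^j`. -/
def LittlewoodPaley.proj (p : LittlewoodPaley) (j : ℕ) (v : ℝ → ℂ) : ℝ → ℂ :=
  fourierMul (lpSymbol p.pLow p.p₀ j) v

/-- The projection `P_{≤ ρ}`, the sum of all `P_λ` with `λ = 2^j ≤ ρ`
(the bound on `j` in the range is implied by `2^j ≤ ρ`). -/
def LittlewoodPaley.projLe (p : LittlewoodPaley) (ρ : ℝ) (v : ℝ → ℂ) (y : ℝ) : ℂ :=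
  ∑ j ∈ (Finset.range (⌊ρ⌋₊ + 1)).filter (fun j : ℕ => (2 : ℝ) ^ j ≤ ρ), p.proj j v y

/-- The norm `‖P_{≤ρ} v‖_{L^∞} + ∑_{λ ≥ ρ} ln(λ/ρ) ‖P_λ v‖_{L^∞}` of `B^∞_ρ`,
the sum being over the dyadic numbers `λ = 2^j ≥ ρ`. -/
def LittlewoodPaley.bNorm (p : LittlewoodPaley) (ρ : ℝ) (v : ℝ → ℂ) : ℝ≥0∞ :=
  eLpNorm (p.projLe ρ v) ∞ volume +
    ∑' j : {j : ℕ // ρ ≤ (2 : ℝ) ^ j},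
      ENNReal.ofReal (Real.log ((2 : ℝ) ^ (j : ℕ) / ρ)) * eLpNorm (p.proj j v) ∞ volume

end HypKG

end

/-! Put s = ρσ and ξ = sη. The phase scales, ψ(ρ,s;sη) = ρ·`unitPhase`(σ,η), and once ρ is so large
that χ₁(s/ρ) vanishes for s ≤ 1, K_n is the difference over ε = ±1 of ρ∬ e^{iρΦ}A dη dσ over 0 ≤ σ ≤
1, |η| ≤ b+1. Here Φ = nσ + σηy + ε·`unitPhase`, and A is smooth and vanishes near σ = 0, near η = 0
and for large |η| (`duhamelK_eq_oscDiff`). The heart of the matter is that the double integral is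
O(1/ρ), uniformly for |y| ≤ Y (`norm_integral_osc_le`, `norm_oscInt_le`).

Write ⟨η⟩ = √(1+η²), f = n − ε⟨η⟩ and g = y + ε(arsinh η − arsinh ση). The phase is stationary where
f = g = 0. This can happen for n = 3, ε = 1, and as y → 0 the stationary point reaches the edge σ =
1, on which Φ = n + ηy becomes constant; standard stationary phase is therefore not uniform in y.
Instead one integrates by parts along a vector field X adapted to the geometry. With M = 1−σ+|y|, X
is tangent to σ = 0 and σ = 1, and XΦ = D = σ((1−σ)f² + g²/M) ≥ 0. Since e^{iρΦ} = w(1 − iX)e^{iρΦ}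
with w = (1+ρD)⁻¹, each integration by parts gains a factor w without boundary terms
(`integral_osc_parts`).

The coefficients of X are not uniformly smooth as y → 0, but they are uniformly bounded under
repeated differentiation along X: e = g/M, (1−σ)/M and smooth functions form a closed system
(`symb_basic`), and so do ρw times the quadratic forms that make up D (`symb_resolvent`). After two
integrations by parts it remains to see that ∬w² = O(1/ρ). Either D ≳ 1−σ, or 1−σ ∼ |y| and D
dominates both |y|(η−η₀)² and g²/|y| (`energyD_dichotomy`). In the second case, with g as the
variable in place of σ, the widths (ρ|y|)^{-1/2} and (|y|/ρ)^{1/2} multiply to 1/ρ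
(`integral_majorant_le`).

Derivatives cost nothing: ∂_ρ and D_y only multiply A by smooth functions or produce further powers
of ρ⁻¹, so the class `OscClass` is stable. For the equation, Φ = ε⟨ση⟩ + σ∂_σΦ lets an integration
by parts in σ turn ∂_ρ into multiplication by iε⟨ση⟩, up to O(1/ρ) and a term at σ = 1. The identity
⟨ση⟩² = 1 + (ση)² then cancels the leading part of (□+1)K_n, and the edge term is the source by
Fourier inversion (`boxPlusOne_eq`, `bdryInt_ampK`). The compact range of small ρ is covered by
smoothness of K_n.

Finally, boundedness of F and D_yF gives ‖P_λF‖ ≲ ρ/λ, and Σ ln(λ/ρ)·ρ/λ over dyadic λ ≥ ρ is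
bounded (`LittlewoodPaley.exists_bNorm_le`). -/

noncomputable section

namespace HypKG

/-! ### Calculus of directional derivatives. -/

/-- `F` is differentiable at `p` and its derivative along the vector `v` is `d`. -/
def DirD {E : Type*} [NormedAddCommGroup E] [NormedSpace ℝ E] (v : ℝ × ℝ) (F : ℝ × ℝ → E)
    (p : ℝ × ℝ) (d : E) : Prop :=
  ∃ F' : ℝ × ℝ →L[ℝ] E, HasFDerivAt F F' p ∧ F' v = d

namespace DirD

variable {v p : ℝ × ℝ}

theorem fst : DirD v (fun q => q.1) p v.1 := ⟨_, hasFDerivAt_fst, rfl⟩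

theorem snd : DirD v (fun q => q.2) p v.2 := ⟨_, hasFDerivAt_snd, rfl⟩

theorem const {E : Type*} [NormedAddCommGroup E] [NormedSpace ℝ E] (c : E) :
    DirD v (fun _ => c) p 0 := ⟨_, hasFDerivAt_const c p, rfl⟩

theorem congr_val {E : Type*} [NormedAddCommGroup E] [NormedSpace ℝ E] {F : ℝ × ℝ → E} {d d' : E}
    (h : DirD v F p d) (e : d = d') : DirD v F p d' := e ▸ h

theorem add {E : Type*} [NormedAddCommGroup E] [NormedSpace ℝ E] {F G : ℝ × ℝ → E} {d d' : E}
    (h : DirD v F p d) (h' : DirD v G p d') : DirD v (fun q => F q + G q) p (d + d') := by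
  obtain ⟨A, hA, rfl⟩ := h
  obtain ⟨B, hB, rfl⟩ := h'
  exact ⟨_, hA.add hB, rfl⟩

theorem sub {E : Type*} [NormedAddCommGroup E] [NormedSpace ℝ E] {F G : ℝ × ℝ → E} {d d' : E}
    (h : DirD v F p d) (h' : DirD v G p d') : DirD v (fun q => F q - G q) p (d - d') := by
  obtain ⟨A, hA, rfl⟩ := h
  obtain ⟨B, hB, rfl⟩ := h'
  exact ⟨_, hA.sub hB, rfl⟩

theorem mul {E : Type*} [NormedCommRing E] [NormedAlgebra ℝ E] {F G : ℝ × ℝ → E} {d d' : E}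
    (h : DirD v F p d) (h' : DirD v G p d') :
    DirD v (fun q => F q * G q) p (d * G p + F p * d') := by
  obtain ⟨A, hA, rfl⟩ := h
  obtain ⟨B, hB, rfl⟩ := h'
  refine ⟨_, hA.mul hB, ?_⟩
  simp only [add_apply, smul_apply, smul_eq_mul]
  ring

theorem comp {F : ℝ × ℝ → ℝ} {d d' : ℝ} {φ : ℝ → ℝ} (h : DirD v F p d)
    (h' : HasDerivAt φ d' (F p)) : DirD v (fun q => φ (F q)) p (d' * d) := by
  obtain ⟨A, hA, rfl⟩ := h
  exact ⟨_, h'.comp_hasFDerivAt p hA, rfl⟩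

theorem ofReal {F : ℝ × ℝ → ℝ} {d : ℝ} (h : DirD v F p d) :
    DirD v (fun q => (F q : ℂ)) p (d : ℂ) := by
  obtain ⟨A, hA, rfl⟩ := h
  exact ⟨_, (Complex.ofRealCLM.hasFDerivAt).comp p hA, rfl⟩

theorem inv {F : ℝ × ℝ → ℝ} {d : ℝ} (h : DirD v F p d) (h0 : F p ≠ 0) :
    DirD v (fun q => (F q)⁻¹) p (-(F p ^ 2)⁻¹ * d) := h.comp (hasDerivAt_inv h0)

theorem cexp {F : ℝ × ℝ → ℂ} {d : ℂ} (h : DirD v F p d) :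
    DirD v (fun q => Complex.exp (F q)) p (Complex.exp (F p) * d) := by
  obtain ⟨A, hA, rfl⟩ := h
  exact ⟨_, hA.cexp, rfl⟩

theorem eq_zero {E : Type*} [NormedAddCommGroup E] [NormedSpace ℝ E] {F : ℝ × ℝ → E} {d : E}
    (h : DirD v F p d) (h0 : F =ᶠ[𝓝 p] fun _ => 0) : d = 0 := by
  obtain ⟨A, hA, rfl⟩ := h
  rw [hA.unique ((hasFDerivAt_const (0 : E) p).congr_of_eventuallyEq h0)]
  rfl

theorem continuousAt {E : Type*} [NormedAddCommGroup E] [NormedSpace ℝ E] {F : ℝ × ℝ → E} {d : E}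
    (h : DirD v F p d) : ContinuousAt F p := by
  obtain ⟨A, hA, -⟩ := h
  exact hA.continuousAt

theorem of_differentiableAt {E : Type*} [NormedAddCommGroup E] [NormedSpace ℝ E] {F : ℝ × ℝ → E}
    (h : DifferentiableAt ℝ F p) : DirD v F p (fderiv ℝ F p v) := ⟨_, h.hasFDerivAt, rfl⟩

end DirD

/-! ### The rescaled phase. -/

/-- The Japanese bracket. -/
def jap (x : ℝ) : ℝ := √(1 + x ^ 2)

theorem jap_pos (x : ℝ) : 0 < jap x := Real.sqrt_pos.2 (by positivity)

theorem jap_sq (x : ℝ) : jap x ^ 2 = 1 + x ^ 2 := Real.sq_sqrt (by positivity)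

theorem one_le_jap (x : ℝ) : 1 ≤ jap x := Real.one_le_sqrt.2 (by nlinarith [sq_nonneg x])

theorem contDiff_jap : ContDiff ℝ ∞ jap := by
  unfold jap
  exact ContDiff.sqrt (by fun_prop) (fun x => by positivity)

theorem hasDerivAt_jap (x : ℝ) : HasDerivAt jap (x / jap x) x := by
  have h : HasDerivAt (fun x : ℝ => 1 + x ^ 2) (2 * x) x := by
    simpa using (hasDerivAt_pow 2 x).const_add 1
  refine (h.sqrt (by positivity)).congr_deriv ?_
  change _ = x / √(1 + x ^ 2)
  field_simp

/-- The difference of the rapidities of `η` and `ση`. -/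
def rapGap (p : ℝ × ℝ) : ℝ := Real.arsinh p.2 - Real.arsinh (p.1 * p.2)

/-- The rescaled phase of the approximate propagator. -/
def unitPhase (p : ℝ × ℝ) : ℝ :=
  jap (p.1 * p.2) - p.1 * p.2 * Real.arsinh (p.1 * p.2) - p.1 * jap p.2 +
    p.1 * p.2 * Real.arsinh p.2

/-- The total phase, in the variables `σ = s/ρ` and `η = ξ/s`. -/
def totPhase (n ε y : ℝ) (p : ℝ × ℝ) : ℝ := n * p.1 + p.1 * p.2 * y + ε * unitPhase p

theorem contDiff_rapGap : ContDiff ℝ ∞ rapGap := by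
  unfold rapGap
  exact (Real.contDiff_arsinh.comp contDiff_snd).sub
    (Real.contDiff_arsinh.comp (contDiff_fst.mul contDiff_snd))

theorem contDiff_unitPhase : ContDiff ℝ ∞ unitPhase := by
  have h1 : ContDiff ℝ ∞ (fun p : ℝ × ℝ => p.1 * p.2) := by fun_prop
  have h2 := contDiff_jap.comp h1
  have h3 := Real.contDiff_arsinh.comp h1
  have h4 := contDiff_jap.comp (contDiff_snd (𝕜 := ℝ) (E := ℝ) (F := ℝ))
  have h5 : ContDiff ℝ ∞ (fun p : ℝ × ℝ => Real.arsinh p.2) :=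
    Real.contDiff_arsinh.comp contDiff_snd
  exact ((h2.sub (h1.mul h3)).sub (contDiff_fst.mul h4)).add (h1.mul h5)

theorem contDiff_totPhase (n ε : ℝ) :
    ContDiff ℝ ∞ (fun q : ℝ × ℝ × ℝ => totPhase n ε q.1 q.2) := by
  have h : ContDiff ℝ ∞ (fun q : ℝ × ℝ × ℝ => unitPhase q.2) := contDiff_unitPhase.comp contDiff_snd
  unfold totPhase
  fun_prop

/-! ### The vector field and its action on the phase and on its own coefficients. -/

section VectorField

/-- The derivative of the phase at fixed `ση`, divided by `σ`. -/
def radF (n ε : ℝ) (p : ℝ × ℝ) : ℝ := n - ε * jap p.2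

/-- The `η`-derivative of the phase, divided by `σ`. -/
def tanG (ε y : ℝ) (p : ℝ × ℝ) : ℝ := y + ε * rapGap p

/-- The natural size of `tanG`: both |y| and `rapGap` are O of this on bounded η. It is positive on
the closed rectangle exactly because y ≠ 0. -/
def scaleM (y : ℝ) (p : ℝ × ℝ) : ℝ := 1 - p.1 + |y|

def ratE (ε y : ℝ) (p : ℝ × ℝ) : ℝ := tanG ε y p * (scaleM y p)⁻¹

def ratT (y : ℝ) (p : ℝ × ℝ) : ℝ := (1 - p.1) * (scaleM y p)⁻¹

/-- The quotient of `∂_η rapGap` by `1 - σ`. -/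
def coefR (p : ℝ × ℝ) : ℝ :=
  (1 + p.1) * (jap p.2 * jap (p.1 * p.2) * (jap (p.1 * p.2) + p.1 * jap p.2))⁻¹

/-- The vector field, tangent to `σ = 1`, along which one integrates by parts. -/
def fieldX (n ε y : ℝ) (p : ℝ × ℝ) : ℝ × ℝ :=
  (p.1 * (1 - p.1) * radF n ε p, -((1 - p.1) * radF n ε p * p.2) + ratE ε y p)

/-- The derivative of the phase along `fieldX`. -/
def energyD (n ε y : ℝ) (p : ℝ × ℝ) : ℝ :=
  p.1 * ((1 - p.1) * radF n ε p ^ 2 + scaleM y p * ratE ε y p ^ 2)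

/-- The strip reaches below σ = 0 so that the closed rectangle has an open neighbourhood on which
`coefR` is smooth. -/
theorem coefR_denom_pos {p : ℝ × ℝ} (h : -(1 / 2) < p.1) :
    0 < jap (p.1 * p.2) + p.1 * jap p.2 := by
  rcases le_or_gt 0 p.1 with h0 | h0
  · have := jap_pos (p.1 * p.2)
    have := jap_pos p.2
    positivity
  · have h1 : (-p.1 * jap p.2) ^ 2 < jap (p.1 * p.2) ^ 2 := by
      rw [mul_pow, jap_sq, jap_sq]; nlinarith [sq_nonneg (p.1 * p.2)]
    have := lt_of_pow_lt_pow_left₀ 2 (jap_pos _).le h1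
    linarith

theorem coefR_mul {p : ℝ × ℝ} (h : -(1 / 2) < p.1) :
    (1 - p.1) * coefR p = 1 / jap p.2 - p.1 / jap (p.1 * p.2) := by
  have h1 := coefR_denom_pos h
  have h2 := jap_pos p.2
  have h3 := jap_pos (p.1 * p.2)
  have e2 := jap_sq p.2
  have e3 := jap_sq (p.1 * p.2)
  rw [coefR]
  field_simp
  have : (1 - p.1) * (1 + p.1) = (jap (p.1 * p.2) - p.1 * jap p.2) * (jap (p.1 * p.2) + p.1 * jap p.2) := by
    ring_nf
    rw [e2, e3]; ring
  linarith

theorem contDiffOn_coefR : ContDiffOn ℝ ∞ coefR {p | -(1 / 2) < p.1} := by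
  have h1 : ContDiff ℝ ∞ (fun p : ℝ × ℝ => p.1 * p.2) := by fun_prop
  have h2 := contDiff_jap.comp h1
  have h4 : ContDiff ℝ ∞ (fun p : ℝ × ℝ => jap p.2) := contDiff_jap.comp contDiff_snd
  refine ContDiffOn.mul (by fun_prop) (ContDiffOn.inv ?_ ?_)
  · exact ((h4.mul h2).mul (h2.add (contDiff_fst.mul h4))).contDiffOn
  · intro p hp
    have h1 := coefR_denom_pos hp
    have h2 := jap_pos p.2
    have h3 := jap_pos (p.1 * p.2)
    positivity

variable {v p : ℝ × ℝ} {n ε y : ℝ}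

theorem dirD_radF : DirD v (radF n ε) p (-(ε * (p.2 / jap p.2)) * v.2) := by
  have := (DirD.const (v := v) (p := p) n).sub
    ((DirD.const ε).mul (DirD.snd.comp (hasDerivAt_jap p.2)))
  exact this.congr_val (by simp; ring)

theorem dirD_rapGap : DirD v rapGap p
    (v.2 / jap p.2 - (v.1 * p.2 + p.1 * v.2) / jap (p.1 * p.2)) := by
  have := (DirD.snd (v := v) (p := p)).comp (Real.hasDerivAt_arsinh p.2) |>.sub
    ((DirD.fst.mul DirD.snd).comp (Real.hasDerivAt_arsinh (p.1 * p.2)))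
  exact this.congr_val (by simp only [jap]; ring)

theorem dirD_tanG : DirD v (tanG ε y) p
    (ε * (v.2 / jap p.2 - (v.1 * p.2 + p.1 * v.2) / jap (p.1 * p.2))) :=
  ((DirD.const y).add ((DirD.const ε).mul dirD_rapGap)).congr_val (by simp)

theorem dirD_unitPhase : DirD v unitPhase p
    ((p.2 * rapGap p - jap p.2) * v.1 + p.1 * rapGap p * v.2) := by
  have h1 := (DirD.fst (v := v) (p := p)).mul DirD.snd
  have h2 := h1.comp (hasDerivAt_jap (p.1 * p.2))
  have h3 := h1.comp (Real.hasDerivAt_arsinh (p.1 * p.2))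
  have h4 := (DirD.snd (v := v) (p := p)).comp (hasDerivAt_jap p.2)
  have h5 := (DirD.snd (v := v) (p := p)).comp (Real.hasDerivAt_arsinh p.2)
  have := ((h2.sub (h1.mul h3)).sub (DirD.fst.mul h4)).add (h1.mul h5)
  refine this.congr_val ?_
  have j2 := jap_pos p.2
  have j3 := jap_pos (p.1 * p.2)
  change _ * _ - (_ + _ * ((jap _)⁻¹ * _)) - _ + (_ + _ * ((jap _)⁻¹ * _)) = _
  rw [rapGap]
  field_simp
  ring

theorem dirD_totPhase : DirD v (totPhase n ε y) p
    ((radF n ε p + p.2 * tanG ε y p) * v.1 + p.1 * tanG ε y p * v.2) := by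
  have h1 := (DirD.fst (v := v) (p := p)).mul DirD.snd
  have := (((DirD.const n).mul DirD.fst).add (h1.mul (DirD.const y))).add
    ((DirD.const ε).mul (dirD_unitPhase (v := v) (p := p)))
  exact this.congr_val (by simp [radF, tanG]; ring)

theorem dirD_scaleM : DirD v (scaleM y) p (-v.1) :=
  (((DirD.const (1 : ℝ)).sub DirD.fst).add (DirD.const |y|)).congr_val (by simp)

theorem ratE_mul (h : scaleM y p ≠ 0) : ratE ε y p * scaleM y p = tanG ε y p := by
  rw [ratE, mul_assoc, inv_mul_cancel₀ h, mul_one]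

theorem ratT_mul (h : scaleM y p ≠ 0) : ratT y p * scaleM y p = 1 - p.1 := by
  rw [ratT, mul_assoc, inv_mul_cancel₀ h, mul_one]

/-- The cross terms in f·g cancel, because the f-part of the field leaves ση fixed, and two squares
remain. -/
theorem dirD_totPhase_fieldX (h : scaleM y p ≠ 0) :
    DirD (fieldX n ε y p) (totPhase n ε y) p (energyD n ε y p) := by
  refine dirD_totPhase.congr_val ?_
  rw [← ratE_mul h, fieldX, energyD]
  ring

/-- The f-part of the field fixes ση, and the η-derivative of `rapGap` is (1−σ)·`coefR`. Hence Xg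
carries a factor 1−σ, which the division by M turns into `ratT`; no uncontrolled power of 1/M
survives. -/
theorem dirD_ratE (h : scaleM y p ≠ 0) (hp : -(1 / 2) < p.1) :
    DirD (fieldX n ε y p) (ratE ε y) p
      (ε * ratT y p * (-(radF n ε p * (p.2 / jap p.2)) + ratE ε y p * coefR p) +
        ratE ε y p * p.1 * ratT y p * radF n ε p) := by
  refine (dirD_tanG.mul (dirD_scaleM.inv h)).congr_val ?_
  have e1 : ratE ε y p * coefR p * ratT y p =
      ratE ε y p * (1 / jap p.2 - p.1 / jap (p.1 * p.2)) * (scaleM y p)⁻¹ := by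
    rw [← coefR_mul hp, ratT]; ring
  have e2 : ε * ratT y p * (-(radF n ε p * (p.2 / jap p.2)) + ratE ε y p * coefR p) =
    ε * (- ratT y p * (radF n ε p * (p.2 / jap p.2)) + ratE ε y p * coefR p * ratT y p) := by ring
  rw [e2, e1, fieldX, ratT]
  rw [show ratE ε y p * p.1 * ((1 - p.1) * (scaleM y p)⁻¹) * radF n ε p =
    tanG ε y p * (scaleM y p)⁻¹ * p.1 * ((1 - p.1) * (scaleM y p)⁻¹) * radF n ε p from rfl]
  simp only []
  ring

theorem dirD_ratT (h : scaleM y p ≠ 0) :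
    DirD (fieldX n ε y p) (ratT y) p
      (-(p.1 * ratT y p * radF n ε p) + p.1 * ratT y p ^ 2 * radF n ε p) := by
  refine (((DirD.const (1 : ℝ)).sub DirD.fst).mul (dirD_scaleM.inv h)).congr_val ?_
  rw [ratT, fieldX]
  simp only []
  ring

end VectorField

/-! ### Symbols: uniform bounds under repeated differentiation along the field. -/

section Symbols

variable {E E' : Type*} [NormedAddCommGroup E] [NormedSpace ℝ E] [NormedAddCommGroup E']
  [NormedSpace ℝ E']

theorem DirD.smul {v p : ℝ × ℝ} {F : ℝ × ℝ → ℝ} {G : ℝ × ℝ → E} {d : ℝ} {d' : E}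
    (h : DirD v F p d) (h' : DirD v G p d') :
    DirD v (fun q => F q • G q) p (d • G p + F p • d') := by
  obtain ⟨A, hA, rfl⟩ := h
  obtain ⟨B, hB, rfl⟩ := h'
  refine ⟨_, hA.smul hB, ?_⟩
  simp [add_comm]

theorem DirD.map {v p : ℝ × ℝ} {F : ℝ × ℝ → E} {d : E} (L : E →L[ℝ] E') (h : DirD v F p d) :
    DirD v (fun q => L (F q)) p (L d) := by
  obtain ⟨A, hA, rfl⟩ := h
  exact ⟨_, L.hasFDerivAt.comp p hA, rfl⟩

/-- The admissible parameters `(y, ρ)`. -/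
def Adm (Y y ρ : ℝ) : Prop := y ≠ 0 ∧ |y| ≤ Y ∧ 1 ≤ ρ

/-- The rectangle of integration. -/
def rect (b : ℝ) : Set (ℝ × ℝ) := Icc 0 1 ×ˢ Icc 0 b

theorem isCompact_rect (b : ℝ) : IsCompact (rect b) := isCompact_Icc.prod isCompact_Icc

theorem scaleM_pos {y b : ℝ} {p : ℝ × ℝ} (hy : y ≠ 0) (hp : p ∈ rect b) : 0 < scaleM y p := by
  have := abs_pos.2 hy
  have := hp.1.2
  unfold scaleM
  linarith

theorem rect_subset (b : ℝ) : rect b ⊆ {p | -(1 / 2) < p.1} := fun p hp => by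
  have := hp.1.1
  simp only [mem_ofPred_eq]
  linarith

theorem isOpen_strip : IsOpen {p : ℝ × ℝ | -(1 / 2) < p.1} :=
  isOpen_lt continuous_const continuous_fst

/-- A family of continuous functions on `rect b`, bounded uniformly in the parameters. -/
def UnifBdd (Y b : ℝ) (F : ℝ → ℝ → ℝ × ℝ → E) : Prop :=
  (∃ C, ∀ y ρ, Adm Y y ρ → ∀ p ∈ rect b, ‖F y ρ p‖ ≤ C) ∧
    ∀ y ρ, Adm Y y ρ → ContinuousOn (F y ρ) (rect b)

/-- A family of functions with `k` uniformly bounded derivatives along `fieldX`. -/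
def Symb (n ε Y b : ℝ) : ℕ → (ℝ → ℝ → ℝ × ℝ → E) → Prop
  | 0, F => UnifBdd Y b F
  | k + 1, F => UnifBdd Y b F ∧ ∃ G, Symb n ε Y b k G ∧
      ∀ y ρ, Adm Y y ρ → ∀ p ∈ rect b, DirD (fieldX n ε y p) (F y ρ) p (G y ρ p)

variable {n ε Y b : ℝ} {k : ℕ}

theorem UnifBdd.add {F G : ℝ → ℝ → ℝ × ℝ → E} (hF : UnifBdd Y b F) (hG : UnifBdd Y b G) :
    UnifBdd Y b (fun y ρ p => F y ρ p + G y ρ p) := by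
  obtain ⟨⟨C, hC⟩, hF⟩ := hF
  obtain ⟨⟨D, hD⟩, hG⟩ := hG
  exact ⟨⟨C + D, fun y ρ h p hp => (norm_add_le _ _).trans (add_le_add (hC y ρ h p hp) (hD y ρ h p hp))⟩,
    fun y ρ h => (hF y ρ h).add (hG y ρ h)⟩

theorem UnifBdd.smul {F : ℝ → ℝ → ℝ × ℝ → ℝ} {G : ℝ → ℝ → ℝ × ℝ → E} (hF : UnifBdd Y b F)
    (hG : UnifBdd Y b G) : UnifBdd Y b (fun y ρ p => F y ρ p • G y ρ p) := by
  obtain ⟨⟨C, hC⟩, hF⟩ := hF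
  obtain ⟨⟨D, hD⟩, hG⟩ := hG
  refine ⟨⟨C * D, fun y ρ h p hp => ?_⟩, fun y ρ h => (hF y ρ h).smul (hG y ρ h)⟩
  rw [norm_smul]
  exact mul_le_mul (hC y ρ h p hp) (hD y ρ h p hp) (norm_nonneg _)
    ((norm_nonneg _).trans (hC y ρ h p hp))

theorem UnifBdd.map {F : ℝ → ℝ → ℝ × ℝ → E} (L : E →L[ℝ] E') (hF : UnifBdd Y b F) :
    UnifBdd Y b (fun y ρ p => L (F y ρ p)) := by
  obtain ⟨⟨C, hC⟩, hF⟩ := hF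
  exact ⟨⟨‖L‖ * C, fun y ρ h p hp => (L.le_opNorm _).trans
    (mul_le_mul_of_nonneg_left (hC y ρ h p hp) (norm_nonneg _))⟩,
    fun y ρ h => L.continuous.comp_continuousOn (hF y ρ h)⟩

theorem Symb.unifBdd {F : ℝ → ℝ → ℝ × ℝ → E} (hF : Symb n ε Y b k F) : UnifBdd Y b F := by
  cases k with
  | zero => exact hF
  | succ k => exact hF.1

theorem Symb.of_succ {F : ℝ → ℝ → ℝ × ℝ → E} (hF : Symb n ε Y b (k + 1) F) :
    Symb n ε Y b k F := by
  induction k generalizing F with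
  | zero => exact hF.1
  | succ k ih =>
    obtain ⟨h1, G, hG, h2⟩ := hF
    exact ⟨h1, G, ih hG, h2⟩

theorem Symb.congr {F G : ℝ → ℝ → ℝ × ℝ → E} (hF : Symb n ε Y b k F)
    (h : ∀ y ρ p, F y ρ p = G y ρ p) : Symb n ε Y b k G := by
  have : F = G := by funext y ρ p; exact h y ρ p
  exact this ▸ hF

theorem Symb.add {F G : ℝ → ℝ → ℝ × ℝ → E} (hF : Symb n ε Y b k F) (hG : Symb n ε Y b k G) :
    Symb n ε Y b k (fun y ρ p => F y ρ p + G y ρ p) := by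
  induction k generalizing F G with
  | zero => exact UnifBdd.add hF hG
  | succ k ih =>
    obtain ⟨h1, F', hF', h2⟩ := hF
    obtain ⟨h3, G', hG', h4⟩ := hG
    exact ⟨h1.add h3, _, ih hF' hG', fun y ρ h p hp => (h2 y ρ h p hp).add (h4 y ρ h p hp)⟩

theorem Symb.smul {F : ℝ → ℝ → ℝ × ℝ → ℝ} {G : ℝ → ℝ → ℝ × ℝ → E} (hF : Symb n ε Y b k F)
    (hG : Symb n ε Y b k G) : Symb n ε Y b k (fun y ρ p => F y ρ p • G y ρ p) := by
  induction k generalizing F G with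
  | zero => exact UnifBdd.smul hF hG
  | succ k ih =>
    obtain ⟨h1, F', hF', h2⟩ := id hF
    obtain ⟨h3, G', hG', h4⟩ := id hG
    exact ⟨h1.smul h3, _, (ih hF' hG.of_succ).add (ih hF.of_succ hG'),
      fun y ρ h p hp => (h2 y ρ h p hp).smul (h4 y ρ h p hp)⟩

theorem Symb.mul {F G : ℝ → ℝ → ℝ × ℝ → ℝ} (hF : Symb n ε Y b k F)
    (hG : Symb n ε Y b k G) : Symb n ε Y b k (fun y ρ p => F y ρ p * G y ρ p) := hF.smul hG

theorem Symb.map {F : ℝ → ℝ → ℝ × ℝ → E} (L : E →L[ℝ] E') (hF : Symb n ε Y b k F) :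
    Symb n ε Y b k (fun y ρ p => L (F y ρ p)) := by
  induction k generalizing F with
  | zero => exact UnifBdd.map L hF
  | succ k ih =>
    obtain ⟨h1, F', hF', h2⟩ := hF
    exact ⟨h1.map L, _, ih hF', fun y ρ h p hp => (h2 y ρ h p hp).map L⟩

theorem Symb.neg {F : ℝ → ℝ → ℝ × ℝ → E} (hF : Symb n ε Y b k F) :
    Symb n ε Y b k (fun y ρ p => -F y ρ p) :=
  (hF.map (-ContinuousLinearMap.id ℝ E)).congr (by simp)

theorem Symb.sub {F G : ℝ → ℝ → ℝ × ℝ → E} (hF : Symb n ε Y b k F) (hG : Symb n ε Y b k G) :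
    Symb n ε Y b k (fun y ρ p => F y ρ p - G y ρ p) :=
  (hF.add hG.neg).congr (by simp [sub_eq_add_neg])

theorem UnifBdd.of_contDiffOn {a : ℝ × ℝ → E} (ha : ContDiffOn ℝ ∞ a {p | -(1 / 2) < p.1}) :
    UnifBdd Y b (fun _ _ => a) := by
  have hc := ha.continuousOn.mono (rect_subset b)
  obtain ⟨C, hC⟩ := (isCompact_rect b).exists_bound_of_continuousOn hc
  exact ⟨⟨C, fun _ _ _ p hp => hC p hp⟩, fun _ _ _ => hc⟩

/-- Mean value inequality: on [ση, η] the derivative 1/⟨x⟩ of arsinh lies between 1/⟨η⟩ and 1. Hence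
the gap is comparable to 1−σ once η is bounded and bounded away from 0. -/
theorem rapGap_bounds {p : ℝ × ℝ} (hp : p ∈ rect b) :
    p.2 / jap p.2 * (1 - p.1) ≤ rapGap p ∧ rapGap p ≤ p.2 * (1 - p.1) := by
  obtain ⟨⟨h0, h1⟩, h2, -⟩ := hp
  have hq : p.1 * p.2 ≤ p.2 := by nlinarith
  have hq0 : 0 ≤ p.1 * p.2 := mul_nonneg h0 h2
  have hd : ∀ x ∈ interior (Icc (p.1 * p.2) p.2), deriv Real.arsinh x ≤ 1 ∧
      (jap p.2)⁻¹ ≤ deriv Real.arsinh x := by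
    intro x hx
    rw [interior_Icc] at hx
    rw [(Real.hasDerivAt_arsinh x).deriv]
    refine ⟨inv_le_one_of_one_le₀ (one_le_jap x), inv_anti₀ (jap_pos x) (Real.sqrt_le_sqrt ?_)⟩
    nlinarith [hx.1, hx.2]
  have hl : p.1 * p.2 ∈ Icc (p.1 * p.2) p.2 := ⟨le_rfl, hq⟩
  have hr : p.2 ∈ Icc (p.1 * p.2) p.2 := ⟨hq, le_rfl⟩
  have a1 := Convex.mul_sub_le_image_sub_of_le_deriv (convex_Icc _ _)
    Real.continuous_arsinh.continuousOn Real.differentiable_arsinh.differentiableOn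
    (fun x hx => (hd x hx).2) _ hl _ hr hq
  have a2 := Convex.image_sub_le_mul_sub_of_deriv_le (convex_Icc _ _)
    Real.continuous_arsinh.continuousOn Real.differentiable_arsinh.differentiableOn
    (fun x hx => (hd x hx).1) _ hl _ hr hq
  refine ⟨le_trans (le_of_eq ?_) a1, a2.trans (le_of_eq ?_)⟩
  · field_simp
  · ring

theorem contDiff_jap_snd : ContDiff ℝ ∞ (fun p : ℝ × ℝ => jap p.2) := contDiff_jap.comp contDiff_snd

theorem contDiff_radF : ContDiff ℝ ∞ (radF n ε) := by
  have := contDiff_jap_snd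
  unfold radF
  fun_prop

theorem continuous_scaleM (y : ℝ) : Continuous (scaleM y) := by
  unfold scaleM
  fun_prop

theorem unifBdd_ratE (hε : |ε| = 1) : UnifBdd Y b (fun y _ => ratE ε y) := by
  refine ⟨⟨1 + b, fun y ρ h p hp => ?_⟩, fun y ρ h => ContinuousOn.mul ?_
    ((continuous_scaleM y).continuousOn.inv₀ fun p hp => (scaleM_pos h.1 hp).ne')⟩
  · have hM := scaleM_pos h.1 hp
    have hg := rapGap_bounds hp
    obtain ⟨⟨h0, h1⟩, h2, h3⟩ := hp
    have hg0 : 0 ≤ rapGap p := le_trans (by have := jap_pos p.2; have : 0 ≤ 1 - p.1 := by linarith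
                                            positivity) hg.1
    change ‖tanG ε y p * (scaleM y p)⁻¹‖ ≤ _
    rw [← div_eq_mul_inv, norm_div, Real.norm_of_nonneg hM.le, div_le_iff₀ hM]
    calc ‖tanG ε y p‖ ≤ |y| + |ε * rapGap p| := abs_add_le _ _
      _ = |y| + rapGap p := by rw [abs_mul, hε, one_mul, abs_of_nonneg hg0]
      _ ≤ |y| + b * (1 - p.1) := by nlinarith
      _ ≤ (1 + b) * scaleM y p := by
        unfold scaleM
        nlinarith [abs_nonneg y]
  · have := contDiff_rapGap.continuous
    unfold tanG
    fun_prop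

theorem ratT_mem {y : ℝ} {p : ℝ × ℝ} (hy : y ≠ 0) (hp : p ∈ rect b) : 0 ≤ ratT y p ∧ ratT y p ≤ 1 := by
  have hM := scaleM_pos hy hp
  have := hp.1.2
  rw [ratT, ← div_eq_mul_inv]
  refine ⟨div_nonneg (by linarith) hM.le, (div_le_one hM).2 ?_⟩
  unfold scaleM
  linarith [abs_nonneg y]

theorem unifBdd_ratT : UnifBdd Y b (fun y _ => ratT y) := by
  refine ⟨⟨1, fun y ρ h p hp => ?_⟩, fun y ρ h => ContinuousOn.mul (by fun_prop)
    ((continuous_scaleM y).continuousOn.inv₀ fun p hp => (scaleM_pos h.1 hp).ne')⟩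
  have := ratT_mem h.1 hp
  rw [Real.norm_of_nonneg this.1]
  exact this.2

theorem _root_.ContDiffOn.fderiv_strip {a : ℝ × ℝ → E}
    (ha : ContDiffOn ℝ ∞ a {p | -(1 / 2) < p.1}) (v : ℝ × ℝ) :
    ContDiffOn ℝ ∞ (fun p => fderiv ℝ a p v) {p | -(1 / 2) < p.1} :=
  (ha.fderiv_of_isOpen isOpen_strip (by simp)).clm_apply contDiffOn_const

/-- By the chain rule the derivative of a fixed smooth function along the field is a combination of
its partial derivatives with the components of the field. Apart from `ratE` these are fixed smooth
functions, so one more order follows from order k. -/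
theorem symb_succ_of_contDiffOn
    (hr : ∀ a : ℝ × ℝ → ℝ, ContDiffOn ℝ ∞ a {p | -(1 / 2) < p.1} → Symb n ε Y b k (fun _ _ => a))
    (he : Symb n ε Y b k (fun y _ => ratE ε y))
    (ih : ∀ a : ℝ × ℝ → E, ContDiffOn ℝ ∞ a {p | -(1 / 2) < p.1} → Symb n ε Y b k (fun _ _ => a))
    {a : ℝ × ℝ → E} (ha : ContDiffOn ℝ ∞ a {p | -(1 / 2) < p.1}) :
    Symb n ε Y b (k + 1) (fun _ _ => a) := by
  have sf := hr _ (contDiff_radF (n := n) (ε := ε)).contDiffOn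
  have s1 := hr _ contDiff_fst.contDiffOn
  have s2 := hr _ contDiff_snd.contDiffOn
  have sc : ∀ c : ℝ, Symb n ε Y b k (fun _ _ _ => c) := fun c => hr _ contDiffOn_const
  refine ⟨.of_contDiffOn ha, _, (((s1.mul ((sc 1).sub s1)).mul sf).smul
    (ih _ (ha.fderiv_strip (1, 0)))).add
    ((((((sc 1).sub s1).mul sf).mul s2).neg.add he).smul (ih _ (ha.fderiv_strip (0, 1)))), ?_⟩
  intro y ρ h p hp
  refine (DirD.of_differentiableAt ((ha.differentiableOn (by simp)).differentiableAt
    (isOpen_strip.mem_nhds (rect_subset b hp)))).congr_val ?_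
  rw [← map_smul, ← map_smul, ← map_add]
  simp [fieldX]

theorem contDiffOn_div_jap :
    ContDiffOn ℝ ∞ (fun p : ℝ × ℝ => p.2 / jap p.2) {p | -(1 / 2) < p.1} :=
  (contDiff_snd.div contDiff_jap_snd fun p => (jap_pos p.2).ne').contDiffOn

/-- The induction must treat the three families together: differentiating a smooth function produces
`ratE`, differentiating `ratE` produces `ratT`, and both derivatives are polynomials in these with
smooth coefficients. -/
theorem symb_basic (hε : |ε| = 1) (k : ℕ) :
    (∀ a : ℝ × ℝ → ℝ, ContDiffOn ℝ ∞ a {p | -(1 / 2) < p.1} → Symb n ε Y b k (fun _ _ => a)) ∧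
    Symb n ε Y b k (fun y _ => ratE ε y) ∧ Symb n ε Y b k (fun y _ => ratT y) := by
  induction k with
  | zero => exact ⟨fun a => .of_contDiffOn, unifBdd_ratE hε, unifBdd_ratT⟩
  | succ k ih =>
    obtain ⟨ih1, ih3, ih4⟩ := ih
    have s1 := ih1 _ contDiff_fst.contDiffOn
    have sf := ih1 _ (contDiff_radF (n := n) (ε := ε)).contDiffOn
    have sj := ih1 _ contDiffOn_div_jap
    have sr := ih1 _ contDiffOn_coefR
    have sc : ∀ c : ℝ, Symb n ε Y b k (fun _ _ _ => c) := fun c => ih1 _ contDiffOn_const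
    refine ⟨fun a ha => symb_succ_of_contDiffOn ih1 ih3 ih1 ha, ⟨unifBdd_ratE hε, _, ?_,
      fun y ρ h p hp => dirD_ratE (scaleM_pos h.1 hp).ne' (rect_subset b hp)⟩,
      ⟨unifBdd_ratT, _, ?_, fun y ρ h p hp => dirD_ratT (scaleM_pos h.1 hp).ne'⟩⟩
    · exact (((sc ε).mul ih4).mul ((sf.mul sj).neg.add (ih3.mul sr))).add
        (((ih3.mul s1).mul ih4).mul sf)
    · exact (((s1.mul ih4).mul sf).neg.add ((s1.mul (ih4.mul ih4)).mul sf)).congr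
        fun y ρ p => by ring

theorem Symb.of_contDiffOn (hε : |ε| = 1) (k : ℕ) {a : ℝ × ℝ → E}
    (ha : ContDiffOn ℝ ∞ a {p | -(1 / 2) < p.1}) : Symb n ε Y b k (fun _ _ => a) := by
  induction k generalizing a with
  | zero => exact UnifBdd.of_contDiffOn ha
  | succ k ih =>
    exact symb_succ_of_contDiffOn (symb_basic hε k).1 (symb_basic hε k).2.1 (fun _ => ih) ha

end Symbols

/-! ### The weight gained in each integration by parts. -/

section Resolvent

variable {n ε y ρ b Y : ℝ} {p : ℝ × ℝ}

/-- The three quadratic forms entering `energyD` and its derivatives along `fieldX`. -/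
def quadA (n ε : ℝ) (p : ℝ × ℝ) : ℝ := p.1 * ((1 - p.1) * (radF n ε p * radF n ε p))

def quadB (n ε y : ℝ) (p : ℝ × ℝ) : ℝ := p.1 * ((1 - p.1) * (radF n ε p * ratE ε y p))

def quadC (ε y : ℝ) (p : ℝ × ℝ) : ℝ := p.1 * (scaleM y p * (ratE ε y p * ratE ε y p))

/-- The derivative of `quadA`, as a linear form in the quadratic forms. -/
def linA (n ε : ℝ) (p : ℝ × ℝ) (a c : ℝ) : ℝ :=
  ((1 - p.1) * radF n ε p - p.1 * radF n ε p + 2 * ε * (p.2 / jap p.2) * p.2 * (1 - p.1)) * a -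
    2 * ε * (p.2 / jap p.2) * c

def linB (n ε y : ℝ) (p : ℝ × ℝ) (a c d : ℝ) : ℝ :=
  ((1 - p.1) * radF n ε p - p.1 * radF n ε p + ε * (p.2 / jap p.2) * p.2 * (1 - p.1) +
    ε * ratT y p * coefR p + p.1 * ratT y p * radF n ε p) * c -
    ε * (p.2 / jap p.2) * ratT y p * d - ε * ratT y p * (p.2 / jap p.2) * a

def linC (n ε y : ℝ) (p : ℝ × ℝ) (c d : ℝ) : ℝ :=
  (p.1 * ratE ε y p - 2 * ε * (p.2 / jap p.2)) * c +
    ((1 - p.1) * radF n ε p + 2 * ε * ratT y p * coefR p) * d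

theorem energyD_eq : energyD n ε y p = quadA n ε p + quadC ε y p := by
  rw [energyD, quadA, quadC]; ring

theorem dirD_quadA : DirD (fieldX n ε y p) (quadA n ε) p
    (linA n ε p (quadA n ε p) (quadB n ε y p)) := by
  have := (DirD.fst (v := fieldX n ε y p) (p := p)).mul
    (((DirD.const (1 : ℝ)).sub DirD.fst).mul ((dirD_radF (n := n) (ε := ε)).mul (dirD_radF (n := n) (ε := ε))))
  refine this.congr_val ?_
  rw [linA, quadA, quadB, fieldX]
  simp only []
  ring

theorem dirD_quadB (h : scaleM y p ≠ 0) (hp : -(1 / 2) < p.1) :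
    DirD (fieldX n ε y p) (quadB n ε y) p
      (linB n ε y p (quadA n ε p) (quadB n ε y p) (quadC ε y p)) := by
  have := (DirD.fst (v := fieldX n ε y p) (p := p)).mul
    (((DirD.const (1 : ℝ)).sub DirD.fst).mul ((dirD_radF (n := n) (ε := ε)).mul (dirD_ratE h hp)))
  refine this.congr_val ?_
  have e1 := ratT_mul h
  rw [linB, quadA, quadB, quadC, fieldX]
  simp only []
  linear_combination (ε * (p.2 / jap p.2) * p.1 * ratE ε y p ^ 2) * e1

theorem dirD_quadC (h : scaleM y p ≠ 0) (hp : -(1 / 2) < p.1) :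
    DirD (fieldX n ε y p) (quadC ε y) p (linC n ε y p (quadB n ε y p) (quadC ε y p)) := by
  have := (DirD.fst (v := fieldX n ε y p) (p := p)).mul
    ((dirD_scaleM (y := y)).mul ((dirD_ratE h hp).mul (dirD_ratE (ε := ε) h hp)))
  refine this.congr_val ?_
  have e1 := ratT_mul h
  rw [linC, quadB, quadC, fieldX]
  simp only []
  linear_combination (p.1 * 2 * ratE ε y p * (-(ε * radF n ε p * (p.2 / jap p.2)) +
    ratE ε y p * p.1 * radF n ε p)) * e1

/-- The weight gained in each integration by parts. -/
def resW (n ε y ρ : ℝ) (p : ℝ × ℝ) : ℝ := (1 + ρ * energyD n ε y p)⁻¹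

/-- Minus the logarithmic derivative of `resW` along the field, written through the normalized forms
ρ·quad·w so that its boundedness is visible. -/
def logDer (n ε y ρ : ℝ) (p : ℝ × ℝ) : ℝ :=
  linA n ε p (ρ * quadA n ε p * resW n ε y ρ p) (ρ * quadB n ε y p * resW n ε y ρ p) +
    linC n ε y p (ρ * quadB n ε y p * resW n ε y ρ p) (ρ * quadC ε y p * resW n ε y ρ p)

theorem quadA_nonneg (hp : p ∈ rect b) : 0 ≤ quadA n ε p :=
  mul_nonneg hp.1.1 (mul_nonneg (by linarith [hp.1.2]) (mul_self_nonneg _))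

theorem quadC_nonneg (hy : y ≠ 0) (hp : p ∈ rect b) : 0 ≤ quadC ε y p :=
  mul_nonneg hp.1.1 (mul_nonneg (scaleM_pos hy hp).le (mul_self_nonneg _))

/-- Cauchy–Schwarz for the mixed form, together with 1−σ ≤ M. -/
theorem abs_quadB_le (hy : y ≠ 0) (hp : p ∈ rect b) :
    |quadB n ε y p| ≤ quadA n ε p + quadC ε y p := by
  have hM := scaleM_pos hy hp
  obtain ⟨⟨h0, h1⟩, -⟩ := hp
  have hu : 0 ≤ 1 - p.1 := by linarith
  have hle : 1 - p.1 ≤ scaleM y p := by unfold scaleM; linarith [abs_nonneg y]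
  rw [quadA, quadB, quadC, ← mul_add, abs_mul, abs_of_nonneg h0, abs_mul, abs_of_nonneg hu]
  refine mul_le_mul_of_nonneg_left ?_ h0
  have h2 : |radF n ε p * ratE ε y p| ≤ radF n ε p * radF n ε p + ratE ε y p * ratE ε y p := by
    rw [abs_le]
    constructor <;> nlinarith [sq_nonneg (radF n ε p + ratE ε y p), sq_nonneg (radF n ε p - ratE ε y p),
      sq_nonneg (radF n ε p), sq_nonneg (ratE ε y p)]
  calc _ ≤ (1 - p.1) * (radF n ε p * radF n ε p + ratE ε y p * ratE ε y p) :=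
        mul_le_mul_of_nonneg_left h2 hu
    _ ≤ _ := by
      rw [mul_add]
      exact add_le_add le_rfl (mul_le_mul_of_nonneg_right hle (mul_self_nonneg _))

theorem energyD_nonneg (hy : y ≠ 0) (hp : p ∈ rect b) : 0 ≤ energyD n ε y p := by
  rw [energyD_eq]
  exact add_nonneg (quadA_nonneg hp) (quadC_nonneg hy hp)

theorem resW_denom_pos (h : Adm Y y ρ) (hp : p ∈ rect b) : 0 < 1 + ρ * energyD n ε y p := by
  have := energyD_nonneg (n := n) (ε := ε) h.1 hp
  have := h.2.2
  positivity

theorem resW_pos (h : Adm Y y ρ) (hp : p ∈ rect b) : 0 < resW n ε y ρ p :=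
  inv_pos.2 (resW_denom_pos h hp)

theorem dirD_resW (h : Adm Y y ρ) (hp : p ∈ rect b) :
    DirD (fieldX n ε y p) (resW n ε y ρ) p (-(logDer n ε y ρ p * resW n ε y ρ p)) := by
  have hM := (scaleM_pos h.1 hp).ne'
  have h1 : DirD (fieldX n ε y p) (fun q => 1 + ρ * energyD n ε y q) p
      (ρ * (linA n ε p (quadA n ε p) (quadB n ε y p) + linC n ε y p (quadB n ε y p) (quadC ε y p))) := by
    have := (DirD.const (1 : ℝ)).add ((DirD.const ρ).mul ((dirD_quadA (n := n) (ε := ε) (y := y)).add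
      (dirD_quadC hM (rect_subset b hp))))
    simp only [energyD_eq]
    exact this.congr_val (by ring)
  refine (h1.inv (resW_denom_pos h hp).ne').congr_val ?_
  rw [logDer, linA, linC, linA, linC, resW, ← inv_pow]
  ring

theorem dirD_mul_resW {F : ℝ × ℝ → ℝ} {d : ℝ} (h : Adm Y y ρ) (hp : p ∈ rect b)
    (hF : DirD (fieldX n ε y p) F p d) :
    DirD (fieldX n ε y p) (fun q => ρ * F q * resW n ε y ρ q) p
      (ρ * d * resW n ε y ρ p - logDer n ε y ρ p * (ρ * F p * resW n ε y ρ p)) :=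
  (((DirD.const ρ).mul hF).mul (dirD_resW h hp)).congr_val (by ring)

theorem continuousOn_ratE (hy : y ≠ 0) : ContinuousOn (ratE ε y) (rect b) := by
  refine ContinuousOn.mul ?_
    ((continuous_scaleM y).continuousOn.inv₀ fun p hp => (scaleM_pos hy hp).ne')
  have := contDiff_rapGap.continuous
  unfold tanG
  fun_prop

theorem continuousOn_quadA : ContinuousOn (quadA n ε) (rect b) := by
  have := (contDiff_radF (n := n) (ε := ε)).continuous
  unfold quadA
  fun_prop

theorem continuousOn_quadB (hy : y ≠ 0) : ContinuousOn (quadB n ε y) (rect b) := by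
  have := (contDiff_radF (n := n) (ε := ε)).continuous
  have := continuousOn_ratE (ε := ε) (b := b) hy
  unfold quadB
  fun_prop

theorem continuousOn_quadC (hy : y ≠ 0) : ContinuousOn (quadC ε y) (rect b) := by
  have := continuous_scaleM y
  have := continuousOn_ratE (ε := ε) (b := b) hy
  unfold quadC
  fun_prop

theorem continuousOn_resW (h : Adm Y y ρ) : ContinuousOn (resW n ε y ρ) (rect b) := by
  refine ContinuousOn.inv₀ ?_ fun p hp => (resW_denom_pos h hp).ne'
  have := continuousOn_quadA (n := n) (ε := ε) (b := b)
  have := continuousOn_quadC (ε := ε) (b := b) h.1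
  simp only [energyD_eq]
  fun_prop

theorem unifBdd_mul_resW {F : ℝ → ℝ × ℝ → ℝ} (hc : ∀ y, y ≠ 0 → ContinuousOn (F y) (rect b))
    (hF : ∀ y, y ≠ 0 → ∀ p ∈ rect b, |F y p| ≤ energyD n ε y p) :
    UnifBdd Y b (fun y ρ p => ρ * F y p * resW n ε y ρ p) := by
  refine ⟨⟨1, fun y ρ h p hp => ?_⟩, fun y ρ h =>
    (continuousOn_const.mul (hc y h.1)).mul (continuousOn_resW h)⟩
  have hρ : 0 < ρ := by linarith [h.2.2]
  rw [norm_mul, norm_mul, Real.norm_of_nonneg (resW_pos h hp).le, Real.norm_of_nonneg hρ.le, resW,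
    ← div_eq_mul_inv, div_le_one (resW_denom_pos h hp), Real.norm_eq_abs]
  nlinarith [hF y h.1 p hp]

theorem unifBdd_resW : UnifBdd Y b (fun y ρ => resW n ε y ρ) := by
  refine ⟨⟨1, fun y ρ h p hp => ?_⟩, fun y ρ h => continuousOn_resW h⟩
  have hρ : 0 < ρ := by linarith [h.2.2]
  rw [Real.norm_of_nonneg (resW_pos h hp).le]
  refine inv_le_one_of_one_le₀ ?_
  have := energyD_nonneg (n := n) (ε := ε) h.1 hp
  nlinarith

theorem symb_linA {a c : ℝ → ℝ → ℝ × ℝ → ℝ} {k : ℕ} (hε : |ε| = 1) (ha : Symb n ε Y b k a)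
    (hc : Symb n ε Y b k c) : Symb n ε Y b k (fun y ρ p => linA n ε p (a y ρ p) (c y ρ p)) := by
  obtain ⟨h1, h2, h3⟩ := symb_basic (n := n) (Y := Y) (b := b) hε k
  have sf := h1 _ (contDiff_radF (n := n) (ε := ε)).contDiffOn
  have s1 := h1 _ contDiff_fst.contDiffOn
  have s2 := h1 _ contDiff_snd.contDiffOn
  have sj := h1 _ contDiffOn_div_jap
  have sc : ∀ c : ℝ, Symb n ε Y b k (fun _ _ _ => c) := fun c => h1 _ contDiffOn_const
  have su := (sc 1).sub s1
  exact ((((su.mul sf).sub (s1.mul sf)).add (((((sc 2).mul (sc ε)).mul sj).mul s2).mul su)).mul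
    ha).sub ((((sc 2).mul (sc ε)).mul sj).mul hc)

theorem symb_linB {a c d : ℝ → ℝ → ℝ × ℝ → ℝ} {k : ℕ} (hε : |ε| = 1) (ha : Symb n ε Y b k a)
    (hc : Symb n ε Y b k c) (hd : Symb n ε Y b k d) :
    Symb n ε Y b k (fun y ρ p => linB n ε y p (a y ρ p) (c y ρ p) (d y ρ p)) := by
  obtain ⟨h1, h2, h3⟩ := symb_basic (n := n) (Y := Y) (b := b) hε k
  have sf := h1 _ (contDiff_radF (n := n) (ε := ε)).contDiffOn
  have s1 := h1 _ contDiff_fst.contDiffOn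
  have s2 := h1 _ contDiff_snd.contDiffOn
  have sj := h1 _ contDiffOn_div_jap
  have sr := h1 _ contDiffOn_coefR
  have sc : ∀ c : ℝ, Symb n ε Y b k (fun _ _ _ => c) := fun c => h1 _ contDiffOn_const
  have su := (sc 1).sub s1
  exact ((((((su.mul sf).sub (s1.mul sf)).add ((((sc ε).mul sj).mul s2).mul su)).add
    (((sc ε).mul h3).mul sr)).add ((s1.mul h3).mul sf)).mul hc).sub
    ((((sc ε).mul sj).mul h3).mul hd) |>.sub ((((sc ε).mul h3).mul sj).mul ha)

theorem symb_linC {c d : ℝ → ℝ → ℝ × ℝ → ℝ} {k : ℕ} (hε : |ε| = 1)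
    (hc : Symb n ε Y b k c) (hd : Symb n ε Y b k d) :
    Symb n ε Y b k (fun y ρ p => linC n ε y p (c y ρ p) (d y ρ p)) := by
  obtain ⟨h1, h2, h3⟩ := symb_basic (n := n) (Y := Y) (b := b) hε k
  have sf := h1 _ (contDiff_radF (n := n) (ε := ε)).contDiffOn
  have s1 := h1 _ contDiff_fst.contDiffOn
  have sj := h1 _ contDiffOn_div_jap
  have sr := h1 _ contDiffOn_coefR
  have sc : ∀ c : ℝ, Symb n ε Y b k (fun _ _ _ => c) := fun c => h1 _ contDiffOn_const
  have su := (sc 1).sub s1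
  exact (((s1.mul h2).sub (((sc 2).mul (sc ε)).mul sj)).mul hc).add
    (((su.mul sf).add ((((sc 2).mul (sc ε)).mul h3).mul sr)).mul hd)

/-- Each normalized form is bounded by ρD/(1+ρD) ≤ 1. The field maps the span of the three quadratic
forms to itself with symbol coefficients, so its action on the normalized forms closes up, with one
extra term from differentiating the weight. -/
theorem symb_resolvent (hε : |ε| = 1) (k : ℕ) :
    Symb n ε Y b k (fun y ρ p => resW n ε y ρ p) ∧
    Symb n ε Y b k (fun y ρ p => ρ * quadA n ε p * resW n ε y ρ p) ∧
    Symb n ε Y b k (fun y ρ p => ρ * quadB n ε y p * resW n ε y ρ p) ∧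
    Symb n ε Y b k (fun y ρ p => ρ * quadC ε y p * resW n ε y ρ p) := by
  have bA : UnifBdd Y b (fun y ρ p => ρ * quadA n ε p * resW n ε y ρ p) :=
    unifBdd_mul_resW (F := fun _ => quadA n ε) (fun y _ => continuousOn_quadA) fun y hy p hp => by
      rw [abs_of_nonneg (quadA_nonneg hp), energyD_eq]
      linarith [quadC_nonneg (ε := ε) hy hp]
  have bB : UnifBdd Y b (fun y ρ p => ρ * quadB n ε y p * resW n ε y ρ p) :=
    unifBdd_mul_resW (fun y => continuousOn_quadB) fun y hy p hp => by
      rw [energyD_eq]; exact abs_quadB_le hy hp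
  have bC : UnifBdd Y b (fun y ρ p => ρ * quadC ε y p * resW n ε y ρ p) :=
    unifBdd_mul_resW (fun y => continuousOn_quadC) fun y hy p hp => by
      rw [abs_of_nonneg (quadC_nonneg hy hp), energyD_eq]
      linarith [quadA_nonneg (n := n) (ε := ε) hp]
  induction k with
  | zero => exact ⟨unifBdd_resW, bA, bB, bC⟩
  | succ k ih =>
    obtain ⟨iw, iA, iB, iC⟩ := ih
    have sQ : Symb n ε Y b k (logDer n ε) := (symb_linA hε iA iB).add (symb_linC hε iB iC)
    refine ⟨⟨unifBdd_resW, _, (sQ.mul iw).neg, fun y ρ h p hp => dirD_resW h hp⟩,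
      ⟨bA, _, (symb_linA hε iA iB).sub (sQ.mul iA), fun y ρ h p hp =>
        (dirD_mul_resW h hp dirD_quadA).congr_val ?_⟩,
      ⟨bB, _, (symb_linB hε iA iB iC).sub (sQ.mul iB), fun y ρ h p hp =>
        (dirD_mul_resW h hp
          (dirD_quadB (scaleM_pos h.1 hp).ne' (rect_subset b hp))).congr_val ?_⟩,
      ⟨bC, _, (symb_linC hε iB iC).sub (sQ.mul iC), fun y ρ h p hp =>
        (dirD_mul_resW h hp
          (dirD_quadC (scaleM_pos h.1 hp).ne' (rect_subset b hp))).congr_val ?_⟩⟩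
    · simp only [linA]; ring
    · simp only [linB]; ring
    · simp only [linC]; ring

theorem symb_logDer (hε : |ε| = 1) (k : ℕ) : Symb n ε Y b k (logDer n ε) := by
  obtain ⟨-, iA, iB, iC⟩ := symb_resolvent (n := n) (Y := Y) (b := b) hε k
  exact (symb_linA hε iA iB).add (symb_linC hε iB iC)

end Resolvent

/-! ### Integration by parts along the field. -/

section Parts

variable {n ε y ρ b Y : ℝ} {p : ℝ × ℝ}

/-- The divergence of `fieldX`. -/
def divX (n ε y : ℝ) (p : ℝ × ℝ) : ℝ :=
  (1 - 2 * p.1) * radF n ε p - (1 - p.1) * radF n ε p +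
    ε * (1 - p.1) * p.2 * (p.2 / jap p.2) + ε * ratT y p * coefR p

theorem symb_divX (hε : |ε| = 1) (k : ℕ) : Symb n ε Y b k (fun y _ => divX n ε y) := by
  obtain ⟨h1, h2, h3⟩ := symb_basic (n := n) (Y := Y) (b := b) hε k
  have sf := h1 _ (contDiff_radF (n := n) (ε := ε)).contDiffOn
  have s1 := h1 _ contDiff_fst.contDiffOn
  have s2 := h1 _ contDiff_snd.contDiffOn
  have sj := h1 _ contDiffOn_div_jap
  have sr := h1 _ contDiffOn_coefR
  have sc : ∀ c : ℝ, Symb n ε Y b k (fun _ _ _ => c) := fun c => h1 _ contDiffOn_const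
  have su := (sc 1).sub s1
  exact ((((((sc 1).sub ((sc 2).mul s1)).mul sf).sub (su.mul sf)).add
    ((((sc ε).mul su).mul s2).mul sj)).add (((sc ε).mul h3).mul sr))

theorem rect_eq (b : ℝ) : rect b = Icc ((0 : ℝ), (0 : ℝ)) ((1 : ℝ), b) := Icc_prod_Icc _ _ _ _

theorem dirD_fieldX_fst :
    DirD (1, 0) (fun q => (fieldX n ε y q).1) p ((1 - 2 * p.1) * radF n ε p) := by
  have := (DirD.fst.mul ((DirD.const (1 : ℝ)).sub DirD.fst)).mul
    (dirD_radF (v := (1, 0)) (p := p) (n := n) (ε := ε))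
  exact this.congr_val (by simp only []; ring)

theorem dirD_fieldX_snd (hp : -(1 / 2) < p.1) (h : scaleM y p ≠ 0) :
    DirD (0, 1) (fun q => (fieldX n ε y q).2) p
      (-((1 - p.1) * radF n ε p) + ε * (1 - p.1) * p.2 * (p.2 / jap p.2) +
        ε * ratT y p * coefR p) := by
  have h1 := (((DirD.const (1 : ℝ)).sub DirD.fst).mul
    (dirD_radF (v := (0, 1)) (p := p) (n := n) (ε := ε))).mul DirD.snd
  have h2 := (dirD_tanG (v := (0, 1)) (ε := ε) (y := y)).mul (dirD_scaleM.inv h)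
  have := ((DirD.const (0 : ℝ)).sub h1).add h2
  simp only [zero_sub] at this
  refine this.congr_val ?_
  have e1 : ratT y p * coefR p = (1 / jap p.2 - p.1 / jap (p.1 * p.2)) * (scaleM y p)⁻¹ := by
    rw [← coefR_mul hp, ratT]; ring
  rw [mul_assoc ε (ratT y p), e1]
  ring

/-- The integrand is the divergence of B·X. Flux through σ = 0 and σ = 1 vanishes because the first
component of X contains σ(1−σ); flux through the other two edges vanishes because B does. -/
theorem integral_fieldX_divergence (hy : y ≠ 0) (hb : 0 ≤ b) {B G : ℝ × ℝ → ℂ}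
    (hB : ∀ p ∈ rect b, DirD (fieldX n ε y p) B p (G p)) (hG : ContinuousOn G (rect b))
    (h0 : ∀ σ, B (σ, 0) = 0) (h1 : ∀ σ, B (σ, b) = 0) :
    ∫ p in rect b, (G p + divX n ε y p * B p) = 0 := by
  have hBc : ContinuousOn B (rect b) := fun p hp => (hB p hp).continuousAt.continuousWithinAt
  have hXc : ContinuousOn (fieldX n ε y) (rect b) := by
    have := (contDiff_radF (n := n) (ε := ε)).continuous
    have := continuousOn_ratE (ε := ε) (b := b) hy
    unfold fieldX
    fun_prop
  have hf : ∀ p ∈ rect b, DirD (1, 0) (fun q => (fieldX n ε y q).1 • B q) p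
      ((((1 - 2 * p.1) * radF n ε p) • B p) + (fieldX n ε y p).1 • fderiv ℝ B p (1, 0)) :=
    fun p hp => dirD_fieldX_fst.smul (.of_differentiableAt (by
      obtain ⟨B', hB', -⟩ := hB p hp; exact hB'.differentiableAt))
  have hg : ∀ p ∈ rect b, DirD (0, 1) (fun q => (fieldX n ε y q).2 • B q) p _ :=
    fun p hp => (dirD_fieldX_snd (rect_subset b hp) (scaleM_pos hy hp).ne').smul
      (.of_differentiableAt (F := B) (by
      obtain ⟨B', hB', -⟩ := hB p hp; exact hB'.differentiableAt))
  have hsub : Ioo (0 : ℝ) 1 ×ˢ Ioo (0 : ℝ) b ⊆ rect b := prod_mono Ioo_subset_Icc_self Ioo_subset_Icc_self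
  have heq : EqOn (fun p => G p + divX n ε y p * B p)
      (fun p => fderiv ℝ (fun q => (fieldX n ε y q).1 • B q) p (1, 0) +
        fderiv ℝ (fun q => (fieldX n ε y q).2 • B q) p (0, 1)) (rect b) := by
    intro p hp
    obtain ⟨f', hf1, hf2⟩ := hf p hp
    obtain ⟨g', hg1, hg2⟩ := hg p hp
    obtain ⟨B', hB1, hB2⟩ := hB p hp
    simp only [hf1.fderiv, hg1.fderiv, hf2, hg2, hB1.fderiv]
    have e : G p = (fieldX n ε y p).1 • B' (1, 0) + (fieldX n ε y p).2 • B' (0, 1) := by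
      rw [← hB2, ← map_smul, ← map_smul, ← map_add]
      simp
    rw [e, divX]
    simp only [Complex.real_smul]
    push_cast
    ring
  rw [setIntegral_congr_fun (isCompact_rect b).measurableSet heq, rect_eq]
  rw [integral_divergence_prod_Icc_of_hasFDerivAt_of_le (fun q => (fieldX n ε y q).1 • B q)
    (fun q => (fieldX n ε y q).2 • B q) _ _ (0, 0) (1, b) ⟨zero_le_one, hb⟩]
  · simp [h0, h1, fieldX]
  · rw [← rect_eq]; exact (continuous_fst.comp_continuousOn hXc).smul hBc
  · rw [← rect_eq]; exact (continuous_snd.comp_continuousOn hXc).smul hBc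
  · intro p hp
    obtain ⟨f', hf1, -⟩ := hf p (hsub hp)
    exact hf1.differentiableAt.hasFDerivAt
  · intro p hp
    obtain ⟨f', hf1, -⟩ := hg p (hsub hp)
    exact hf1.differentiableAt.hasFDerivAt
  · rw [← rect_eq]
    refine IntegrableOn.congr_fun (ContinuousOn.integrableOn_compact (isCompact_rect b) ?_) heq
      (isCompact_rect b).measurableSet
    refine hG.add (ContinuousOn.mul ?_ hBc)
    refine Complex.continuous_ofReal.comp_continuousOn ?_
    have := (contDiff_radF (n := n) (ε := ε)).continuous
    have h2 := (contDiffOn_coefR.continuousOn).mono (rect_subset b)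
    have h3 := (contDiffOn_div_jap.continuousOn).mono (rect_subset b)
    have h4 : ContinuousOn (ratT y) (rect b) := ContinuousOn.mul (by fun_prop)
      ((continuous_scaleM y).continuousOn.inv₀ fun p hp => (scaleM_pos hy hp).ne')
    unfold divX
    fun_prop

/-- The oscillating factor. -/
def osc (n ε y ρ : ℝ) (p : ℝ × ℝ) : ℂ := Complex.exp (Complex.I * (ρ * totPhase n ε y p : ℝ))

theorem norm_osc : ‖osc n ε y ρ p‖ = 1 := by
  rw [osc, mul_comm, Complex.norm_exp_ofReal_mul_I]

theorem continuous_osc : Continuous (osc n ε y ρ) := by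
  have : Continuous (totPhase n ε y) :=
    (contDiff_totPhase n ε).continuous.comp (f := fun p : ℝ × ℝ => (y, p)) (by fun_prop)
  unfold osc
  fun_prop

/-- Since X e^{iρΦ} = iρD e^{iρΦ}, one has e^{iρΦ} = w(1 − iX)e^{iρΦ}. Moving X onto wA by the
divergence theorem produces div X and, from Xw = −Qw with Q = `logDer`, the term −Q. Using 1+ρD
instead of ρD makes the identity valid at zeros of D as well. -/
theorem integral_osc_parts (h : Adm Y y ρ) (hb : 0 ≤ b) {A A' : ℝ × ℝ → ℂ}
    (hA : ∀ p ∈ rect b, DirD (fieldX n ε y p) A p (A' p)) (hA' : ContinuousOn A' (rect b))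
    (hε : |ε| = 1) (h0 : ∀ σ, A (σ, 0) = 0) (h1 : ∀ σ, A (σ, b) = 0) :
    ∫ p in rect b, osc n ε y ρ p * A p = ∫ p in rect b, osc n ε y ρ p *
      (resW n ε y ρ p • (A p + Complex.I *
        (A' p + (divX n ε y p - logDer n ε y ρ p) • A p))) := by
  have hAc : ContinuousOn A (rect b) := fun p hp => (hA p hp).continuousAt.continuousWithinAt
  have hQ : ContinuousOn (logDer n ε y ρ) (rect b) :=
    (symb_logDer (n := n) (Y := Y) (b := b) hε 0).unifBdd.2 y ρ h
  have hd : ContinuousOn (divX n ε y) (rect b) :=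
    (symb_divX (n := n) (Y := Y) (b := b) hε 0).unifBdd.2 y ρ h
  have hw := continuousOn_resW (n := n) (ε := ε) (b := b) h
  have ho := (continuous_osc (n := n) (ε := ε) (y := y) (ρ := ρ)).continuousOn (s := rect b)
  have hD : ContinuousOn (energyD n ε y) (rect b) :=
    ((continuousOn_quadA (n := n) (ε := ε) (b := b)).add
      (continuousOn_quadC (ε := ε) (b := b) h.1)).congr fun p _ => energyD_eq
  have hB : ∀ p ∈ rect b, DirD (fieldX n ε y p)
      (fun q => osc n ε y ρ q * (resW n ε y ρ q • A q)) p
      (osc n ε y ρ p * (Complex.I * (ρ * energyD n ε y p : ℝ)) * (resW n ε y ρ p • A p) +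
        osc n ε y ρ p * ((-(logDer n ε y ρ p * resW n ε y ρ p)) • A p + resW n ε y ρ p • A' p)) := by
    intro p hp
    have e1 := (((DirD.const ρ).mul
      (dirD_totPhase_fieldX (n := n) (ε := ε) (scaleM_pos h.1 hp).ne')).ofReal.map
      (ContinuousLinearMap.mul ℝ ℂ Complex.I)).cexp
    refine (e1.mul ((dirD_resW h hp).smul (hA p hp))).congr_val ?_
    simp only [osc, ContinuousLinearMap.mul_apply', zero_mul, zero_add]
  have key := integral_fieldX_divergence (n := n) (ε := ε) (y := y) h.1 hb hB
    (by
      refine ContinuousOn.add ?_ ?_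
      · refine ((ho.mul ?_).mul (hw.smul hAc))
        exact continuousOn_const.mul (Complex.continuous_ofReal.comp_continuousOn (continuousOn_const.mul hD))
      · exact ho.mul (((hQ.mul hw).neg.smul hAc).add (hw.smul hA')))
    (by simp [h0]) (by simp [h1])
  have i1 : IntegrableOn (fun p => osc n ε y ρ p * A p) (rect b) :=
    (ho.mul hAc).integrableOn_compact (isCompact_rect b)
  have i2 : IntegrableOn (fun p => osc n ε y ρ p *
      (resW n ε y ρ p • (A p + Complex.I *
        (A' p + (divX n ε y p - logDer n ε y ρ p) • A p)))) (rect b) :=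
    (ho.mul (hw.smul (hAc.add (continuousOn_const.mul (hA'.add ((hd.sub hQ).smul hAc)))))).integrableOn_compact
      (isCompact_rect b)
  rw [← sub_eq_zero, ← integral_sub i1 i2]
  -- The two integrands differ by −i times the divergence of e^{iρΦ}wA·X, so the pointwise identity
  -- left to check uses only w(1+ρD) = 1 and i² = −1.
  rw [← mul_zero (-Complex.I), ← key, ← integral_const_mul]
  refine setIntegral_congr_fun (isCompact_rect b).measurableSet fun p hp => ?_
  have hw0 := (resW_denom_pos (n := n) (ε := ε) h hp)
  have e : (resW n ε y ρ p : ℂ) * (1 + ρ * energyD n ε y p) = 1 := by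
    rw [resW]
    exact_mod_cast inv_mul_cancel₀ hw0.ne'
  simp only [Complex.real_smul]
  push_cast
  linear_combination (-osc n ε y ρ p * A p) * e +
    osc n ε y ρ p * A p * resW n ε y ρ p * ρ * energyD n ε y p * Complex.I_sq

end Parts

/-! ### Lower bounds for D and the majorant of the squared weight. -/

section Area

variable {n ε y ρ b Y : ℝ} {p : ℝ × ℝ}

/-- On the support f has at most one zero, and it is simple. For ε = 1, n = 3 it is η₀ = √8. For n =
1 the double zero at η = 0 is excluded by c ≤ η, and for ε = −1 there is none; in these cases η₀ = 0
serves as a harmless centre. -/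
theorem radF_lower_bound (hn : n = 1 ∨ n = 3) (hε : ε = 1 ∨ ε = -1) {c : ℝ} (hc : 0 < c)
    (b : ℝ) : ∃ cf > 0, ∃ η₀, ∀ p ∈ rect b, c ≤ p.2 → cf * |p.2 - η₀| ≤ |radF n ε p| := by
  rcases hε with rfl | rfl
  · rcases hn with rfl | rfl
    · rcases le_or_gt 0 b with hb | hb
      · refine ⟨c / (2 + b), by positivity, 0, fun p hp h => ?_⟩
        have h1 := one_le_jap p.2
        have h2 := jap_sq p.2
        have h0 : 0 ≤ p.2 := hp.2.1
        have h3 : p.2 ≤ b := hp.2.2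
        have h4 : jap p.2 ≤ 1 + p.2 := by
          refine le_of_sq_le_sq ?_ (by linarith)
          rw [h2]; nlinarith
        rw [sub_zero, abs_of_nonneg h0, radF, one_mul, abs_sub_comm, abs_of_nonneg (by linarith),
          div_mul_eq_mul_div, div_le_iff₀ (by positivity)]
        have h5 : (jap p.2 - 1) * (jap p.2 + 1) = p.2 ^ 2 := by linarith
        have h6 : (jap p.2 - 1) * (jap p.2 + 1) ≤ (jap p.2 - 1) * (2 + b) :=
          mul_le_mul_of_nonneg_left (by linarith) (by linarith)
        nlinarith
      · exact ⟨1, one_pos, 0, fun p hp => absurd (hp.2.1.trans hp.2.2) (not_le.2 hb)⟩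
    · refine ⟨1 / 2, by norm_num, √8, fun p hp h => ?_⟩
      have h1 := one_le_jap p.2
      have h2 := jap_sq p.2
      have h0 : 0 ≤ p.2 := hp.2.1
      have h4 : jap p.2 ≤ 1 + p.2 := by
        refine le_of_sq_le_sq ?_ (by linarith)
        rw [h2]; nlinarith
      have h8 : √8 ^ 2 = (8 : ℝ) := Real.sq_sqrt (by norm_num)
      have h9 : 2 ≤ √8 := Real.le_sqrt_of_sq_le (by norm_num)
      have h5 : |radF 3 1 p| * (3 + jap p.2) = |p.2 - √8| * (p.2 + √8) := by
        rw [← abs_of_nonneg (show 0 ≤ 3 + jap p.2 by linarith),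
          ← abs_of_nonneg (show 0 ≤ p.2 + √8 by linarith), ← abs_mul, ← abs_mul, radF,
          ← abs_neg]
        congr 1
        linarith
      -- From ⟨η⟩ ≤ 1+η and 2 ≤ √8 comes 3+⟨η⟩ ≤ 2(η+√8), which gives the constant 1/2.
      have h6 : |p.2 - √8| * (3 + jap p.2) ≤ |p.2 - √8| * (2 * (p.2 + √8)) :=
        mul_le_mul_of_nonneg_left (by linarith) (abs_nonneg _)
      have : |p.2 - √8| * (3 + jap p.2) ≤ (2 * |radF 3 1 p|) * (3 + jap p.2) := by linarith
      have := le_of_mul_le_mul_right this (by linarith)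
      linarith
  · refine ⟨1, one_pos, 0, fun p hp h => ?_⟩
    have h0 : 0 ≤ p.2 := hp.2.1
    have hn1 : 1 ≤ n := by rcases hn with rfl | rfl <;> norm_num
    have h4 : p.2 ≤ jap p.2 := Real.le_sqrt_of_sq_le (by linarith)
    rw [sub_zero, one_mul, abs_of_nonneg h0]
    refine le_trans ?_ (le_abs_self _)
    unfold radF
    linarith

theorem sq_inv_le_of_le {x x' : ℝ} (hx' : 0 ≤ x') (h : x' ≤ x) :
    ((1 + x)⁻¹) ^ 2 ≤ ((1 + x') ^ 2)⁻¹ := by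
  rw [inv_pow]
  exact inv_anti₀ (by positivity) (by gcongr)

theorem sq_inv_le_of_le_of_le {x x' x'' : ℝ} (hx' : 0 ≤ x') (hx'' : 0 ≤ x'') (h : x' ≤ x)
    (h' : x'' ≤ x) : ((1 + x)⁻¹) ^ 2 ≤ (1 + x')⁻¹ * (1 + x'')⁻¹ := by
  rw [inv_pow, ← mul_inv]
  refine inv_anti₀ (by positivity) ?_
  rw [sq]
  exact mul_le_mul (by linarith) (by linarith) (by linarith) (by linarith)

/-- The majorant of the squared weight. -/
def majorant (ε η₀ κ y ρ : ℝ) (p : ℝ × ℝ) : ℝ :=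
  ((1 + κ * ρ * (1 - p.1)) ^ 2)⁻¹ +
    (1 + κ * ρ * |y| * (p.2 - η₀) ^ 2)⁻¹ *
      (p.2 / jap (p.1 * p.2) * (1 + κ * ρ / |y| * tanG ε y p ^ 2)⁻¹)

/-- Here u = 1−σ and r is the rapidity gap, comparable to u. If |y| ≤ 2|g| then u+|y| ≲ |g|, so
g²/(u+|y|) ≳ u. If |y| > 2|g| then r lies between |y|/2 and 3|y|/2, so u ∼ |y|, and each of the two
summands of D yields one of the bounds. -/
theorem energy_dichotomy {u y g r f v s₁ b cf k D : ℝ} (hs : 0 < s₁) (hb : 0 < b) (hcf : 0 < cf)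
    (hk : 0 < k) (hu : 0 ≤ u) (hy : 0 < |y|) (hlow : k * u ≤ r) (hup : r ≤ b * u)
    (hg1 : r ≤ |g| + |y|) (hg2 : |y| ≤ |g| + r) (hf : cf * |v| ≤ |f|)
    (hD : s₁ * (u * f ^ 2 + g ^ 2 / (u + |y|)) ≤ D) :
    s₁ / (3 / k + 2) ^ 2 * u ≤ D ∨
      (s₁ * cf ^ 2 / (2 * b) * (|y| * v ^ 2) ≤ D ∧ s₁ / (1 + 3 / (2 * k)) * (g ^ 2 / |y|) ≤ D) := by
  have hM : 0 < u + |y| := by linarith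
  have hE : 0 ≤ g ^ 2 / (u + |y|) := by positivity
  have hF : 0 ≤ u * f ^ 2 := by positivity
  rcases le_or_gt |y| (2 * |g|) with hcase | hcase
  · left
    refine le_trans ?_ hD
    have hMK : u + |y| ≤ (3 / k + 2) * |g| := by
      have : u ≤ 3 * |g| / k := by rw [le_div_iff₀ hk]; linarith
      rw [add_mul, div_mul_eq_mul_div]
      linarith
    have h4 : u / (3 / k + 2) ^ 2 ≤ g ^ 2 / (u + |y|) := by
      rw [div_le_div_iff₀ (by positivity) hM, ← sq_abs g]
      calc u * (u + |y|) ≤ (u + |y|) * (u + |y|) :=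
            mul_le_mul_of_nonneg_right (by linarith) hM.le
        _ ≤ ((3 / k + 2) * |g|) * ((3 / k + 2) * |g|) := mul_self_le_mul_self hM.le hMK
        _ = _ := by ring
    rw [div_mul_eq_mul_div, mul_div_assoc]
    exact mul_le_mul_of_nonneg_left (by linarith) hs.le
  · right
    have h4 : |y| / (2 * b) ≤ u := by
      rw [div_le_iff₀ (by positivity)]; linarith
    have h5 : u + |y| ≤ (1 + 3 / (2 * k)) * |y| := by
      have : u ≤ 3 * |y| / (2 * k) := by rw [le_div_iff₀ (by positivity)]; linarith
      rw [add_mul, div_mul_eq_mul_div]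
      linarith
    have h6 : cf ^ 2 * v ^ 2 ≤ f ^ 2 := by
      rw [← sq_abs v, ← mul_pow, ← sq_abs f]
      exact pow_le_pow_left₀ (by positivity) hf 2
    constructor
    · refine le_trans ?_ hD
      calc s₁ * cf ^ 2 / (2 * b) * (|y| * v ^ 2) = s₁ * (|y| / (2 * b) * (cf ^ 2 * v ^ 2)) := by
            field_simp
        _ ≤ s₁ * (u * f ^ 2) :=
          mul_le_mul_of_nonneg_left (mul_le_mul h4 h6 (by positivity) hu) hs.le
        _ ≤ _ := mul_le_mul_of_nonneg_left (by linarith) hs.le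
    · refine le_trans ?_ hD
      calc s₁ / (1 + 3 / (2 * k)) * (g ^ 2 / |y|) = s₁ * (g ^ 2 / ((1 + 3 / (2 * k)) * |y|)) := by
            field_simp
        _ ≤ s₁ * (g ^ 2 / (u + |y|)) :=
          mul_le_mul_of_nonneg_left (div_le_div_of_nonneg_left (sq_nonneg g) hM h5) hs.le
        _ ≤ _ := mul_le_mul_of_nonneg_left (by linarith) hs.le

theorem jap_le_jap {x z : ℝ} (hx : 0 ≤ x) (h : x ≤ z) : jap x ≤ jap z :=
  Real.sqrt_le_sqrt (by nlinarith)

theorem energyD_dichotomy (hε : |ε| = 1) {s₁ c cf η₀ : ℝ} (hs : 0 < s₁) (hc : 0 < c)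
    (hb : 0 < b) (hcf : 0 < cf)
    (hf : ∀ p ∈ rect b, c ≤ p.2 → cf * |p.2 - η₀| ≤ |radF n ε p|) :
    ∃ κ > 0, ∀ y, y ≠ 0 → ∀ p ∈ rect b, s₁ ≤ p.1 → c ≤ p.2 →
      κ * (1 - p.1) ≤ energyD n ε y p ∨ (κ * (|y| * (p.2 - η₀) ^ 2) ≤ energyD n ε y p ∧
        κ * (tanG ε y p ^ 2 / |y|) ≤ energyD n ε y p) := by
  have hjb := jap_pos b
  have hk : 0 < c / jap b := by positivity
  refine ⟨min (s₁ / (3 / (c / jap b) + 2) ^ 2) (min (s₁ * cf ^ 2 / (2 * b))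
    (s₁ / (1 + 3 / (2 * (c / jap b))))), by positivity, fun y hy0 p hp hp1 hp2 => ?_⟩
  have hM := scaleM_pos hy0 hp
  have hy : 0 < |y| := abs_pos.2 hy0
  have hr := rapGap_bounds hp
  obtain ⟨⟨h0, h1⟩, h2, h3⟩ := id hp
  have hu : 0 ≤ 1 - p.1 := by linarith
  have hlow : c / jap b * (1 - p.1) ≤ rapGap p :=
    le_trans (mul_le_mul_of_nonneg_right (div_le_div₀ h2 hp2 (jap_pos _) (jap_le_jap h2 h3)) hu) hr.1
  have hup : rapGap p ≤ b * (1 - p.1) := hr.2.trans (mul_le_mul_of_nonneg_right h3 hu)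
  have hr0 : 0 ≤ rapGap p := le_trans (by positivity) hlow
  have hg : rapGap p = |tanG ε y p - y| := by
    rw [tanG, add_sub_cancel_left, abs_mul, hε, one_mul, abs_of_nonneg hr0]
  have hg1 : rapGap p ≤ |tanG ε y p| + |y| := hg ▸ abs_sub _ _
  have hg2 : |y| ≤ |tanG ε y p| + rapGap p := by
    rw [hg]
    calc |y| = |tanG ε y p - (tanG ε y p - y)| := by rw [sub_sub_cancel]
      _ ≤ _ := abs_sub _ _
  have hE : scaleM y p * ratE ε y p ^ 2 = tanG ε y p ^ 2 / (1 - p.1 + |y|) := by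
    rw [ratE, scaleM] at *
    field_simp
  have hD : s₁ * ((1 - p.1) * radF n ε p ^ 2 + tanG ε y p ^ 2 / (1 - p.1 + |y|)) ≤
      energyD n ε y p := by
    rw [energyD, hE]
    exact mul_le_mul_of_nonneg_right hp1 (by positivity)
  rcases energy_dichotomy hs hb hcf hk hu hy hlow hup hg1 hg2 (hf p hp hp2) hD with h | ⟨h, h'⟩
  · exact Or.inl ((mul_le_mul_of_nonneg_right (min_le_left _ _) hu).trans h)
  · refine Or.inr ⟨(mul_le_mul_of_nonneg_right ?_ (by positivity)).trans h,
      (mul_le_mul_of_nonneg_right ?_ (by positivity)).trans h'⟩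
    · exact (min_le_right _ _).trans (min_le_left _ _)
    · exact (min_le_right _ _).trans (min_le_right _ _)

/-- In the first regime both factors w are spent on 1−σ; in the second, one is spent on η−η₀ and the
other on g. -/
theorem resW_sq_le_majorant (hε : |ε| = 1) {s₁ c cf η₀ : ℝ} (hs : 0 < s₁) (hc : 0 < c)
    (hb : 0 < b) (hcf : 0 < cf)
    (hf : ∀ p ∈ rect b, c ≤ p.2 → cf * |p.2 - η₀| ≤ |radF n ε p|) (Y : ℝ) :
    ∃ κ > 0, ∃ C₀ > 0, ∀ y ρ, Adm Y y ρ → ∀ p ∈ rect b, s₁ ≤ p.1 → c ≤ p.2 →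
      resW n ε y ρ p ^ 2 ≤ C₀ * majorant ε η₀ κ y ρ p := by
  obtain ⟨κ, hκ, H⟩ := energyD_dichotomy hε hs hc hb hcf hf
  have hjb := jap_pos b
  have hk : 0 < c / jap b := by positivity
  refine ⟨κ, hκ, 1 + 1 / (c / jap b), by positivity, fun y ρ h p hp hp1 hp2 => ?_⟩
  have hρ : 0 < ρ := by linarith [h.2.2]
  have hy : 0 < |y| := abs_pos.2 h.1
  obtain ⟨⟨h0, h1⟩, h2, h3⟩ := id hp
  have hu : 0 ≤ 1 - p.1 := by linarith
  -- The factor η/⟨ση⟩ is bounded below on the support, so it can be inserted at the cost of a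
  -- constant. It is the Jacobian |∂_σ g| needed to integrate the majorant exactly.
  have hq : c / jap b ≤ p.2 / jap (p.1 * p.2) :=
    div_le_div₀ h2 hp2 (jap_pos _) (jap_le_jap (mul_nonneg h0 h2) (by nlinarith))
  have hS : resW n ε y ρ p ^ 2 ≤ ((1 + κ * ρ * (1 - p.1)) ^ 2)⁻¹ +
      (1 + κ * ρ * |y| * (p.2 - η₀) ^ 2)⁻¹ * (1 + κ * ρ / |y| * tanG ε y p ^ 2)⁻¹ := by
    rcases H y h.1 p hp hp1 hp2 with h4 | ⟨h4, h5⟩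
    · have : κ * ρ * (1 - p.1) ≤ ρ * energyD n ε y p := by
        have := mul_le_mul_of_nonneg_left h4 hρ.le
        linarith
      refine (sq_inv_le_of_le (by positivity) this).trans (le_add_of_nonneg_right (by positivity))
    · have h6 : κ * ρ * |y| * (p.2 - η₀) ^ 2 ≤ ρ * energyD n ε y p := by
        have := mul_le_mul_of_nonneg_left h4 hρ.le
        linarith
      have h7 : κ * ρ / |y| * tanG ε y p ^ 2 ≤ ρ * energyD n ε y p := by
        have := mul_le_mul_of_nonneg_left h5 hρ.le
        calc _ = ρ * (κ * (tanG ε y p ^ 2 / |y|)) := by ring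
          _ ≤ _ := this
      exact (sq_inv_le_of_le_of_le (by positivity) (by positivity) h6 h7).trans
        (le_add_of_nonneg_left (by positivity))
  have hA : 0 ≤ ((1 + κ * ρ * (1 - p.1)) ^ 2)⁻¹ := by positivity
  have hB : 0 ≤ (1 + κ * ρ * |y| * (p.2 - η₀) ^ 2)⁻¹ := by positivity
  have hC : 0 ≤ (1 + κ * ρ / |y| * tanG ε y p ^ 2)⁻¹ := by positivity
  rw [majorant]
  generalize ((1 + κ * ρ * (1 - p.1)) ^ 2)⁻¹ = m1 at *
  generalize (1 + κ * ρ * |y| * (p.2 - η₀) ^ 2)⁻¹ = m2 at *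
  generalize (1 + κ * ρ / |y| * tanG ε y p ^ 2)⁻¹ = m3 at *
  generalize p.2 / jap (p.1 * p.2) = q at *
  generalize c / jap b = k at *
  have h8 : k * (m2 * m3) ≤ m2 * (q * m3) := by
    have := mul_le_mul_of_nonneg_right hq (mul_nonneg hB hC)
    linarith
  have h9 : m2 * m3 ≤ 1 / k * (m2 * (q * m3)) := by
    rw [one_div, inv_mul_eq_div, le_div_iff₀ hk]
    linarith
  have h10 : 0 ≤ 1 / k * m1 := by positivity
  have h11 : 0 ≤ m2 * (q * m3) := le_trans (by positivity) h8
  linarith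

end Area

/-! ### The O(1/ρ) bound for the oscillatory integral on the rectangle. -/

section MainEstimate

variable {n ε y ρ b Y : ℝ} {p : ℝ × ℝ}

/-- The integrand is the derivative of arctan(√μ·g)/√μ, so the bound does not depend on the interval
or on the size of g. -/
theorem integral_deriv_div_le {g g' : ℝ → ℝ} {a a' μ : ℝ} (hμ : 0 < μ)
    (hg : ∀ x, HasDerivAt g (g' x) x) (hg' : Continuous g') :
    |∫ x in a..a', g' x * (1 + μ * g x ^ 2)⁻¹| ≤ Real.pi / √μ := by
  have hs : 0 < √μ := Real.sqrt_pos.2 hμ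
  have hsq : √μ ^ 2 = μ := Real.sq_sqrt hμ.le
  have hd : ∀ x ∈ uIcc a a', HasDerivAt (fun x => Real.arctan (√μ * g x) / √μ)
      (g' x * (1 + μ * g x ^ 2)⁻¹) x := fun x _ => by
    refine (((hg x).const_mul √μ).arctan.div_const √μ).congr_deriv ?_
    rw [mul_pow, hsq]
    field_simp
  have hgc : Continuous g := continuous_iff_continuousAt.2 fun x => (hg x).continuousAt
  have hc : Continuous fun x => g' x * (1 + μ * g x ^ 2)⁻¹ :=
    hg'.mul (Continuous.inv₀ (by fun_prop) fun x => by positivity)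
  rw [intervalIntegral.integral_eq_sub_of_hasDerivAt hd (hc.intervalIntegrable _ _), ← sub_div,
    abs_div, abs_of_pos hs]
  gcongr
  have b1 := Real.arctan_lt_pi_div_two (√μ * g a)
  have b2 := Real.neg_pi_div_two_lt_arctan (√μ * g a)
  have b3 := Real.arctan_lt_pi_div_two (√μ * g a')
  have b4 := Real.neg_pi_div_two_lt_arctan (√μ * g a')
  rw [abs_le]
  constructor <;> linarith

theorem continuous_tanG : Continuous (tanG ε y) := by
  have := contDiff_rapGap.continuous
  unfold tanG
  fun_prop

/-- The factor −ε makes the derivative equal to the Jacobian in the majorant, since ε² = 1; the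
square of g is unaffected. -/
theorem hasDerivAt_tanG_fst (η σ : ℝ) :
    HasDerivAt (fun s => -ε * tanG ε y (s, η)) (ε ^ 2 * (η / jap (σ * η))) σ := by
  have h1 : HasDerivAt (fun s : ℝ => s * η) η σ := by simpa using (hasDerivAt_id σ).mul_const η
  have h2 := (((h1.arsinh).const_sub (Real.arsinh η)).const_mul ε).const_add y |>.const_mul (-ε)
  refine h2.congr_deriv ?_
  change -ε * (ε * -((jap (σ * η))⁻¹ * η)) = _
  ring

theorem continuousOn_majorant {η₀ κ : ℝ} (hκ : 0 < κ) (hρ : 0 < ρ) (hy : y ≠ 0) :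
    ContinuousOn (fun p : ℝ × ℝ => ((1 + κ * ρ * (1 - p.1)) ^ 2)⁻¹) (rect b) ∧
      Continuous (fun p : ℝ × ℝ => (1 + κ * ρ * |y| * (p.2 - η₀) ^ 2)⁻¹ *
      (p.2 / jap (p.1 * p.2) * (1 + κ * ρ / |y| * tanG ε y p ^ 2)⁻¹)) := by
  have hy : 0 < |y| := abs_pos.2 hy
  refine ⟨ContinuousOn.inv₀ (by fun_prop) fun p hp => ?_, ?_⟩
  · have : 0 ≤ 1 - p.1 := by linarith [hp.1.2]
    positivity
  · have h1 := continuous_tanG (ε := ε) (y := y)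
    have h2 := contDiff_jap.continuous
    refine (Continuous.inv₀ (by fun_prop) fun p => by positivity).mul
      ((Continuous.div (by fun_prop) (by fun_prop) fun p => (jap_pos _).ne').mul
        (Continuous.inv₀ (by fun_prop) fun p => by positivity))

theorem integral_inv_sq_le {a : ℝ} (ha : 0 < a) :
    ∫ σ in (0 : ℝ)..1, ((1 + a * (1 - σ)) ^ 2)⁻¹ ≤ 1 / a := by
  have hpos : ∀ σ ∈ uIcc (0 : ℝ) 1, 0 < 1 + a * (1 - σ) := fun σ hσ => by
    rw [uIcc_of_le zero_le_one] at hσ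
    have : 0 ≤ 1 - σ := by linarith [hσ.2]
    positivity
  have hd : ∀ σ ∈ uIcc (0 : ℝ) 1, HasDerivAt (fun σ => (1 + a * (1 - σ))⁻¹ / a)
      (((1 + a * (1 - σ)) ^ 2)⁻¹) σ := fun σ hσ => by
    have h1 : HasDerivAt (fun σ => 1 + a * (1 - σ)) (a * -1) σ :=
      (((hasDerivAt_id σ).const_sub 1).const_mul a).const_add 1
    refine ((h1.inv (hpos σ hσ).ne').div_const a).congr_deriv ?_
    have := (hpos σ hσ).ne'
    field_simp
  rw [intervalIntegral.integral_eq_sub_of_hasDerivAt hd]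
  · have : 0 ≤ (1 + a * (1 - 0))⁻¹ / a := by positivity
    simp only [sub_self, mul_zero, add_zero, inv_one]
    linarith
  · refine ContinuousOn.intervalIntegrable (ContinuousOn.inv₀ (by fun_prop) fun σ hσ => ?_)
    exact (pow_pos (hpos σ hσ) 2).ne'

/-- The powers of |y| cancel: integrating in σ gives π(|y|/κρ)^{1/2}, then integrating in η gives
π(κρ|y|)^{-1/2}. This is what makes the bound uniform as y → 0. -/
theorem integral_majorant_le (hε : |ε| = 1) {η₀ κ : ℝ} (hκ : 0 < κ) (hρ : 0 < ρ) (hy0 : y ≠ 0)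
    (hb : 0 < b) : IntegrableOn (majorant ε η₀ κ y ρ) (rect b) ∧
      ∫ p in rect b, majorant ε η₀ κ y ρ p ≤ (b + Real.pi ^ 2) / κ / ρ := by
  have hy : 0 < |y| := abs_pos.2 hy0
  obtain ⟨c1, c2⟩ := continuousOn_majorant (b := b) (ε := ε) (η₀ := η₀) hκ hρ hy0
  have i1 := c1.integrableOn_compact (μ := volume) (isCompact_rect b)
  have i2 := c2.continuousOn.integrableOn_compact (μ := volume) (isCompact_rect b)
  refine ⟨i1.add i2, ?_⟩
  change ∫ p in rect b, (_ + _) ≤ _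
  rw [integral_add i1 i2]
  have e1 : ∫ p in rect b, ((1 + κ * ρ * (1 - p.1)) ^ 2)⁻¹ ≤ b / κ / ρ := by
    have := setIntegral_prod_mul (μ := volume) (ν := volume)
      (fun σ : ℝ => ((1 + κ * ρ * (1 - σ)) ^ 2)⁻¹) (fun _ : ℝ => (1 : ℝ)) (Icc 0 1) (Icc 0 b)
    simp only [mul_one] at this
    rw [rect, Measure.volume_eq_prod, this, integral_Icc_eq_integral_Ioc,
      ← intervalIntegral.integral_of_le zero_le_one]
    have h1 := integral_inv_sq_le (mul_pos hκ hρ)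
    have h2 : ∫ _ in Icc 0 b, (1 : ℝ) = b := by simp [hb.le]
    rw [h2]
    calc _ ≤ 1 / (κ * ρ) * b := mul_le_mul_of_nonneg_right h1 hb.le
      _ = _ := by field_simp
  have e2 : ∫ p in rect b, (1 + κ * ρ * |y| * (p.2 - η₀) ^ 2)⁻¹ *
      (p.2 / jap (p.1 * p.2) * (1 + κ * ρ / |y| * tanG ε y p ^ 2)⁻¹) ≤ Real.pi ^ 2 / κ / ρ := by
    rw [rect, Measure.volume_eq_prod, ← setIntegral_prod_swap, setIntegral_prod]
    swap
    · rw [← Measure.volume_eq_prod]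
      exact (c2.comp continuous_swap).continuousOn.integrableOn_compact (μ := volume)
        (isCompact_Icc.prod isCompact_Icc)
    have hμ : 0 < κ * ρ / |y| := by positivity
    have hl : 0 < κ * ρ * |y| := by positivity
    have hcm : Continuous fun η : ℝ => (1 + κ * ρ * |y| * (η - η₀) ^ 2)⁻¹ :=
      Continuous.inv₀ (by fun_prop) fun η => by positivity
    have inner : ∀ η, ∫ σ in Icc (0 : ℝ) 1, (1 + κ * ρ * |y| * (η - η₀) ^ 2)⁻¹ *
        (η / jap (σ * η) * (1 + κ * ρ / |y| * tanG ε y (σ, η) ^ 2)⁻¹) ≤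
        (1 + κ * ρ * |y| * (η - η₀) ^ 2)⁻¹ * (Real.pi / √(κ * ρ / |y|)) := by
      intro η
      rw [integral_const_mul, integral_Icc_eq_integral_Ioc,
        ← intervalIntegral.integral_of_le zero_le_one]
      refine mul_le_mul_of_nonneg_left ?_ (by positivity)
      have hε2 : ε ^ 2 = 1 := by rw [← sq_abs, hε, one_pow]
      have := integral_deriv_div_le (a := 0) (a' := 1) hμ (fun σ => hasDerivAt_tanG_fst (ε := ε) (y := y) η σ)
        (continuous_const.mul (continuous_const.div
          (contDiff_jap.continuous.comp (by fun_prop)) fun σ => (jap_pos _).ne'))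
      simp only [mul_pow, neg_sq, hε2, one_mul] at this
      exact (le_abs_self _).trans this
    refine (setIntegral_mono_on ?_ ?_ measurableSet_Icc fun η _ => inner η).trans ?_
    · refine (ContinuousOn.integrableOn_compact isCompact_Icc ?_)
      refine Continuous.continuousOn ?_
      have : Continuous fun q : ℝ × ℝ => (1 + κ * ρ * |y| * (q.1 - η₀) ^ 2)⁻¹ *
        (q.1 / jap (q.2 * q.1) * (1 + κ * ρ / |y| * tanG ε y (q.2, q.1) ^ 2)⁻¹) :=
        c2.comp continuous_swap
      exact continuous_parametric_integral_of_continuous this isCompact_Icc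
    · exact ((hcm.mul continuous_const).continuousOn).integrableOn_compact isCompact_Icc
    · rw [integral_mul_const, integral_Icc_eq_integral_Ioc,
        ← intervalIntegral.integral_of_le hb.le]
      have := integral_deriv_div_le (a := 0) (a' := b) hl (g := fun η => η - η₀) (g' := fun _ => 1)
        (fun η => (hasDerivAt_id η).sub_const η₀) continuous_const
      simp only [one_mul] at this
      calc _ ≤ Real.pi / √(κ * ρ * |y|) * (Real.pi / √(κ * ρ / |y|)) :=
            mul_le_mul_of_nonneg_right ((le_abs_self _).trans this) (by positivity)
        _ = Real.pi ^ 2 / (√(κ * ρ * |y|) * √(κ * ρ / |y|)) := by field_simp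
        _ = Real.pi ^ 2 / κ / ρ := by
          rw [← Real.sqrt_mul hl.le,
            show κ * ρ * |y| * (κ * ρ / |y|) = (κ * ρ) ^ 2 by field_simp,
            Real.sqrt_sq (by positivity), div_div]
  calc _ ≤ b / κ / ρ + Real.pi ^ 2 / κ / ρ := add_le_add e1 e2
    _ = _ := by ring

/-- A smooth amplitude supported away from `σ = 0`, `η = 0` and `η = ∞`. -/
structure Amp (s₁ c b : ℝ) (A : ℝ × ℝ → ℂ) : Prop where
  smooth : ContDiff ℝ ∞ A
  zero : ∀ p : ℝ × ℝ, |p.1| < s₁ ∨ |p.2| < c ∨ b < |p.2| → A p = 0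

theorem isOpen_ampSet (s₁ c b : ℝ) : IsOpen {p : ℝ × ℝ | |p.1| < s₁ ∨ |p.2| < c ∨ b < |p.2|} := by
  have h1 : IsOpen {p : ℝ × ℝ | |p.1| < s₁} := isOpen_lt (by fun_prop) (by fun_prop)
  have h2 : IsOpen {p : ℝ × ℝ | |p.2| < c} := isOpen_lt (by fun_prop) (by fun_prop)
  have h3 : IsOpen {p : ℝ × ℝ | b < |p.2|} := isOpen_lt (by fun_prop) (by fun_prop)
  exact h1.union (h2.union h3)

theorem symb_fderiv_fieldX {E : Type*} [NormedAddCommGroup E] [NormedSpace ℝ E] (hε : |ε| = 1)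
    (k : ℕ) {a : ℝ × ℝ → E} (ha : ContDiff ℝ ∞ a) :
    Symb n ε Y b k (fun y _ p => fderiv ℝ a p (fieldX n ε y p)) := by
  obtain ⟨h1, h2, -⟩ := symb_basic (n := n) (Y := Y) (b := b) hε k
  have sf := h1 _ (contDiff_radF (n := n) (ε := ε)).contDiffOn
  have s1 := h1 _ contDiff_fst.contDiffOn
  have s2 := h1 _ contDiff_snd.contDiffOn
  have su := (h1 (fun _ => 1) contDiffOn_const).sub s1
  have sd : ∀ v : ℝ × ℝ, Symb n ε Y b k (fun _ _ p => fderiv ℝ a p v) := fun v =>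
    Symb.of_contDiffOn hε k (ha.contDiffOn.fderiv_strip v)
  refine ((((s1.mul su).mul sf).smul (sd (1, 0))).add
    ((((su.mul sf).mul s2).neg.add h2).smul (sd (0, 1)))).congr fun y ρ p => ?_
  rw [← map_smul, ← map_smul, ← map_add]
  simp [fieldX]

/-- One integration by parts would leave ∬w, for which the majorant is of no use; two leave ∬w²,
which is O(1/ρ). The amplitude produced by the first must still be differentiable along the field,
hence symbols of order one. -/
theorem norm_integral_osc_le (hn : n = 1 ∨ n = 3) (hε : ε = 1 ∨ ε = -1) {s₁ c : ℝ} (hs : 0 < s₁)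
    (hc : 0 < c) (hb : 0 < b) {A : ℝ × ℝ → ℂ} (hA : Amp s₁ c b A) (Y : ℝ) :
    ∃ C, ∀ y ρ, Adm Y y ρ → ‖∫ p in rect (b + 1), osc n ε y ρ p * A p‖ ≤ C / ρ := by
  have hε1 : |ε| = 1 := by rcases hε with rfl | rfl <;> simp
  have hb1 : 0 < b + 1 := by linarith
  set U := {p : ℝ × ℝ | |p.1| < s₁ ∨ |p.2| < c ∨ b < |p.2|} with hU
  have hUo : IsOpen U := isOpen_ampSet s₁ c b
  set A' : ℝ → ℝ × ℝ → ℂ := fun y p => fderiv ℝ A p (fieldX n ε y p) with hA'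
  have sA' : Symb n ε Y (b + 1) 1 (fun y _ => A' y) := symb_fderiv_fieldX hε1 1 hA.smooth
  have dA : ∀ y p, DirD (fieldX n ε y p) A p (A' y p) := fun y p =>
    .of_differentiableAt (hA.smooth.differentiable (by simp) p)
  have sd := symb_divX (n := n) (Y := Y) (b := b + 1) hε1 1
  have sQ := symb_logDer (n := n) (Y := Y) (b := b + 1) hε1 1
  have sA : Symb n ε Y (b + 1) 1 (fun _ _ => A) := Symb.of_contDiffOn hε1 1 hA.smooth.contDiffOn
  set I' : ℂ →L[ℝ] ℂ := ContinuousLinearMap.mul ℝ ℂ Complex.I with hI'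
  set B : ℝ → ℝ → ℝ × ℝ → ℂ := fun y ρ p =>
    A p + I' (A' y p + (divX n ε y p - logDer n ε y ρ p) • A p) with hB
  have sB : Symb n ε Y (b + 1) 1 B := sA.add ((sA'.add ((sd.sub sQ).smul sA)).map I')
  obtain ⟨sB0, B', sB', hB'⟩ := id sB
  -- The second integration by parts acts on wB, and X(wB) = w(XB − QB); together with the −Q from
  -- the weight itself this gives the coefficient 2.
  set D : ℝ → ℝ → ℝ × ℝ → ℂ := fun y ρ p =>
    B y ρ p + I' (B' y ρ p + (divX n ε y p - 2 * logDer n ε y ρ p) • B y ρ p) with hD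
  have sc : Symb n ε Y (b + 1) 0 (fun _ _ _ => (2 : ℝ)) := Symb.of_contDiffOn hε1 0 contDiffOn_const
  have sD : Symb n ε Y (b + 1) 0 D := sB.of_succ.add ((sB'.add ((sd.of_succ.sub
    (sc.mul sQ.of_succ)).smul sB.of_succ)).map I')
  obtain ⟨⟨CD, hCD⟩, -⟩ := sD
  obtain ⟨cf, hcf, η₀, hf⟩ := radF_lower_bound hn hε hc (b + 1)
  obtain ⟨κ, hκ, C₀, hC₀, hmaj⟩ := resW_sq_le_majorant hε1 hs hc hb1 hcf hf Y
  refine ⟨|CD| * C₀ * ((b + 1 + Real.pi ^ 2) / κ), fun y ρ h => ?_⟩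
  have hρ : 0 < ρ := by linarith [h.2.2]
  have zA : ∀ p ∈ U, A p = 0 := hA.zero
  have zA' : ∀ p ∈ U, A' y p = 0 := fun p hpU =>
    (dA y p).eq_zero (Filter.mem_of_superset (hUo.mem_nhds hpU) zA)
  have zB : ∀ p ∈ U, B y ρ p = 0 := fun p hpU => by simp [hB, zA p hpU, zA' p hpU]
  have zB' : ∀ p ∈ rect (b + 1), p ∈ U → B' y ρ p = 0 := fun p hp hpU =>
    (hB' y ρ h p hp).eq_zero (Filter.mem_of_superset (hUo.mem_nhds hpU) zB)
  -- The rectangle is taken up to b+1 so that its upper edge lies inside the open set where the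
  -- amplitude vanishes; the lower edge does because c > 0.
  have m0 : ∀ σ : ℝ, ((σ, 0) : ℝ × ℝ) ∈ U := fun σ => Or.inr (Or.inl (by simpa using hc))
  have m1 : ∀ σ : ℝ, ((σ, b + 1) : ℝ × ℝ) ∈ U := fun σ => Or.inr (Or.inr (by
    simp only []; rw [abs_of_pos hb1]; linarith))
  have cw := continuousOn_resW (n := n) (ε := ε) (b := b + 1) h
  have cQ := sQ.unifBdd.2 y ρ h
  rw [integral_osc_parts h hb1.le (fun p _ => dA y p) (sA'.unifBdd.2 y ρ h) hε1
    (fun σ => zA _ (m0 σ)) (fun σ => zA _ (m1 σ))]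
  change ‖∫ p in rect (b + 1), osc n ε y ρ p * (resW n ε y ρ p • B y ρ p)‖ ≤ _
  rw [integral_osc_parts h hb1.le (fun p hp => (dirD_resW h hp).smul (hB' y ρ h p hp))
    (((cQ.mul cw).neg.smul (sB.unifBdd.2 y ρ h)).add (cw.smul (sB'.unifBdd.2 y ρ h))) hε1
    (fun σ => by rw [zB _ (m0 σ), smul_zero]) (fun σ => by rw [zB _ (m1 σ), smul_zero])]
  obtain ⟨iM, hM⟩ := integral_majorant_le hε1 (η₀ := η₀) hκ hρ h.1 hb1
  calc _ ≤ ∫ p in rect (b + 1), |CD| * C₀ * majorant ε η₀ κ y ρ p := by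
        refine norm_integral_le_of_norm_le (iM.const_mul _) ?_
        filter_upwards [ae_restrict_mem (isCompact_rect (b + 1)).measurableSet] with p hp
        have e : osc n ε y ρ p * resW n ε y ρ p • (resW n ε y ρ p • B y ρ p +
            Complex.I * (-(logDer n ε y ρ p * resW n ε y ρ p) • B y ρ p +
              resW n ε y ρ p • B' y ρ p + (divX n ε y p - logDer n ε y ρ p) •
                resW n ε y ρ p • B y ρ p)) = osc n ε y ρ p * (resW n ε y ρ p ^ 2 • D y ρ p) := by
          simp only [hD, hI', Complex.real_smul, ContinuousLinearMap.mul_apply']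
          push_cast
          ring
        rw [e, norm_mul, norm_osc, one_mul, norm_smul, Real.norm_of_nonneg (sq_nonneg _)]
        have hm0 : 0 ≤ majorant ε η₀ κ y ρ p := by
          have : 0 ≤ 1 - p.1 := by linarith [hp.1.2]
          have := hp.2.1
          have := jap_pos (p.1 * p.2)
          unfold majorant
          positivity
        -- The majorant controls w² only for σ ≥ s₁ and η ≥ c; elsewhere the final amplitude is
        -- zero.
        by_cases hpU : p ∈ U
        · have : D y ρ p = 0 := by simp [hD, zB p hpU, zB' p hp hpU]
          rw [this, norm_zero, mul_zero]
          positivity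
        · simp only [hU, mem_ofPred_eq, not_or, not_lt] at hpU
          rw [abs_of_nonneg hp.1.1, abs_of_nonneg hp.2.1] at hpU
          calc _ ≤ (C₀ * majorant ε η₀ κ y ρ p) * |CD| :=
                mul_le_mul (hmaj y ρ h p hp hpU.1 hpU.2.1) ((hCD y ρ h p hp).trans (le_abs_self _))
                  (norm_nonneg _) (by positivity)
            _ = _ := by ring
    _ ≤ |CD| * C₀ * ((b + 1 + Real.pi ^ 2) / κ / ρ) := by
        rw [integral_const_mul]
        exact mul_le_mul_of_nonneg_left hM (by positivity)
    _ = _ := by ring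

end MainEstimate

/-! ### Oscillatory integrals over both signs of η and their derivatives. -/

section DoubleIntegral

theorem hasDerivAt_intervalIntegral_param {E : Type*} [NormedAddCommGroup E] [NormedSpace ℝ E]
    {F F' : ℝ → ℝ → E} (hF : ∀ x, Continuous (F x)) (hF' : Continuous fun q : ℝ × ℝ => F' q.1 q.2)
    (h : ∀ x t, HasDerivAt (fun z => F z t) (F' x t) x) (a b x₀ : ℝ) :
    HasDerivAt (fun x => ∫ t in a..b, F x t) (∫ t in a..b, F' x₀ t) x₀ := by
  obtain ⟨C, hC⟩ := ((isCompact_closedBall x₀ 1).prod (isCompact_uIcc (a := a) (b := b))).exists_bound_of_continuousOn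
    hF'.continuousOn
  refine (intervalIntegral.hasDerivAt_integral_of_dominated_loc_of_deriv_le
    (bound := fun _ => C) (F' := F') (Metric.ball_mem_nhds x₀ one_pos) ?_ ?_ ?_ ?_ ?_ ?_).2
  · exact Eventually.of_forall fun x => (hF x).aestronglyMeasurable
  · exact (hF x₀).intervalIntegrable _ _
  · exact (hF'.comp (f := fun t : ℝ => (x₀, t)) (by fun_prop)).aestronglyMeasurable
  · refine Eventually.of_forall fun t ht x hx => hC (x, t) ⟨Metric.ball_subset_closedBall hx,
      uIoc_subset_uIcc ht⟩
  · exact intervalIntegrable_const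
  · exact Eventually.of_forall fun t _ x _ => h x t

/-- Integration over `0 ≤ σ ≤ 1`, `|η| ≤ b + 1`. -/
def dInt (b : ℝ) (F : ℝ × ℝ → ℂ) : ℂ :=
  ∫ σ in (0 : ℝ)..1, ∫ η in (-(b + 1))..(b + 1), F (σ, η)

variable {b : ℝ}

theorem continuous_inner_integral {X : Type*} [TopologicalSpace X] [FirstCountableTopology X]
    {F : X → ℝ → ℂ} (hF : Continuous fun q : X × ℝ => F q.1 q.2) (a a' : ℝ) :
    Continuous fun x => ∫ t in a..a', F x t :=
  intervalIntegral.continuous_parametric_intervalIntegral_of_continuous' hF a a'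

theorem continuous_dInt {X : Type*} [TopologicalSpace X] [FirstCountableTopology X]
    {F : X → ℝ × ℝ → ℂ} (hF : Continuous fun q : X × ℝ × ℝ => F q.1 q.2) :
    Continuous fun x => dInt b (F x) := by
  refine continuous_inner_integral (F := fun x σ => ∫ η in (-(b + 1))..(b + 1), F x (σ, η)) ?_ _ _
  refine continuous_inner_integral (F := fun (q : X × ℝ) η => F q.1 (q.2, η)) ?_ _ _
  exact hF.comp (f := fun q : (X × ℝ) × ℝ => (q.1.1, (q.1.2, q.2))) (by fun_prop)

theorem hasDerivAt_dInt {F F' : ℝ → ℝ × ℝ → ℂ} (hF : Continuous fun q : ℝ × ℝ × ℝ => F q.1 q.2)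
    (hF' : Continuous fun q : ℝ × ℝ × ℝ => F' q.1 q.2)
    (h : ∀ x p, HasDerivAt (fun z => F z p) (F' x p) x) (x : ℝ) :
    HasDerivAt (fun x => dInt b (F x)) (dInt b (F' x)) x := by
  refine hasDerivAt_intervalIntegral_param
    (F := fun x σ => ∫ η in (-(b + 1))..(b + 1), F x (σ, η))
    (F' := fun x σ => ∫ η in (-(b + 1))..(b + 1), F' x (σ, η)) ?_ ?_ ?_ _ _ _
  · intro x
    exact continuous_inner_integral (F := fun σ η => F x (σ, η))
      (hF.comp (f := fun q : ℝ × ℝ => (x, q)) (by fun_prop)) _ _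
  · exact continuous_inner_integral (F := fun (q : ℝ × ℝ) η => F' q.1 (q.2, η))
      (hF'.comp (f := fun q : (ℝ × ℝ) × ℝ => (q.1.1, (q.1.2, q.2))) (by fun_prop)) _ _
  · intro x σ
    exact hasDerivAt_intervalIntegral_param (F := fun x η => F x (σ, η))
      (F' := fun x η => F' x (σ, η))
      (fun x => hF.comp (f := fun t : ℝ => (x, (σ, t))) (by fun_prop))
      (hF'.comp (f := fun q : ℝ × ℝ => (q.1, (σ, q.2))) (by fun_prop)) (fun x t => h x _) _ _ _

theorem dInt_add {F G : ℝ × ℝ → ℂ} (hF : Continuous F) (hG : Continuous G) :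
    dInt b (fun p => F p + G p) = dInt b F + dInt b G := by
  have inner : ∀ {F : ℝ × ℝ → ℂ}, Continuous F →
      Continuous fun σ => ∫ η in (-(b + 1))..(b + 1), F (σ, η) := fun {F} hF =>
    continuous_inner_integral (F := fun σ η => F (σ, η)) hF _ _
  rw [dInt, dInt, dInt, ← intervalIntegral.integral_add ((inner hF).intervalIntegrable _ _)
    ((inner hG).intervalIntegrable _ _)]
  congr 1
  funext σ
  exact intervalIntegral.integral_add
    ((hF.comp (f := fun t : ℝ => (σ, t)) (by fun_prop)).intervalIntegrable _ _)
    ((hG.comp (f := fun t : ℝ => (σ, t)) (by fun_prop)).intervalIntegrable _ _)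

theorem dInt_const_mul (c : ℂ) (F : ℝ × ℝ → ℂ) : dInt b (fun p => c * F p) = c * dInt b F := by
  simp only [dInt, intervalIntegral.integral_const_mul]

theorem continuous_osc_param (n ε : ℝ) :
    Continuous fun q : (ℝ × ℝ) × ℝ × ℝ => osc n ε q.1.1 q.1.2 q.2 := by
  have : Continuous fun q : (ℝ × ℝ) × ℝ × ℝ => totPhase n ε q.1.1 q.2 :=
    (contDiff_totPhase n ε).continuous.comp
      (f := fun q : (ℝ × ℝ) × ℝ × ℝ => (q.1.1, q.2)) (by fun_prop)
  unfold osc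
  fun_prop

/-- The oscillatory integral with amplitude `A`. -/
def oscInt (n ε b : ℝ) (A : ℝ × ℝ → ℂ) (ρ y : ℝ) : ℂ :=
  ρ * dInt b (fun p => osc n ε y ρ p * A p)

variable {n ε y ρ s₁ c : ℝ} {A : ℝ × ℝ → ℂ}

theorem osc_neg_snd (σ η : ℝ) : osc n ε y ρ (σ, -η) = osc n ε (-y) ρ (σ, η) := by
  simp [osc, totPhase, unitPhase, jap]

theorem Amp.reflect (hA : Amp s₁ c b A) : Amp s₁ c b (fun p => A (p.1, -p.2)) :=
  ⟨hA.smooth.comp (by fun_prop), fun p hp => hA.zero _ (by simpa using hp)⟩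

theorem setIntegral_rect_eq (hb : 0 ≤ b) {F : ℝ × ℝ → ℂ} (hF : Continuous F) :
    ∫ p in rect b, F p = ∫ σ in (0 : ℝ)..1, ∫ η in (0 : ℝ)..b, F (σ, η) := by
  rw [rect, Measure.volume_eq_prod, setIntegral_prod, integral_Icc_eq_integral_Ioc,
    ← intervalIntegral.integral_of_le zero_le_one]
  · congr 1
    funext σ
    rw [integral_Icc_eq_integral_Ioc, ← intervalIntegral.integral_of_le hb]
  · rw [← Measure.volume_eq_prod]
    exact hF.continuousOn.integrableOn_compact (isCompact_Icc.prod isCompact_Icc)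

theorem dInt_eq_rect (hb : 0 ≤ b) {F : ℝ × ℝ → ℂ} (hF : Continuous F) :
    dInt b F = (∫ p in rect (b + 1), F p) + ∫ p in rect (b + 1), F (p.1, -p.2) := by
  have hb1 : 0 ≤ b + 1 := by linarith
  have hF' : Continuous fun p : ℝ × ℝ => F (p.1, -p.2) := hF.comp (by fun_prop)
  rw [setIntegral_rect_eq hb1 hF, setIntegral_rect_eq hb1 hF', dInt,
    ← intervalIntegral.integral_add]
  · congr 1
    funext σ
    have hc : Continuous fun η => F (σ, η) := hF.comp (by fun_prop)
    have e := intervalIntegral.integral_comp_neg (a := 0) (b := b + 1) (fun η => F (σ, η))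
    simp only [neg_zero] at e
    rw [e, ← intervalIntegral.integral_add_adjacent_intervals (b := 0) (hc.intervalIntegrable _ _)
      (hc.intervalIntegrable _ _)]
    ring
  · exact (continuous_inner_integral (F := fun σ η => F (σ, η)) hF _ _).intervalIntegrable _ _
  · exact (continuous_inner_integral (F := fun σ η => F (σ, -η)) hF' _ _).intervalIntegrable _ _

/-- The half η < 0 is the half η > 0 with y replaced by −y and the amplitude reflected. The value y
= 0, excluded so far because M may vanish there, follows by continuity in y since the constant is
uniform. -/
theorem norm_oscInt_le (hn : n = 1 ∨ n = 3) (hε : ε = 1 ∨ ε = -1) (hs : 0 < s₁)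
    (hc : 0 < c) (hb : 0 < b) (hA : Amp s₁ c b A) (Y : ℝ) (hY : 0 < Y) :
    ∃ C, ∀ ρ y, 1 ≤ ρ → |y| ≤ Y → ‖oscInt n ε b A ρ y‖ ≤ C := by
  obtain ⟨C₁, h₁⟩ := norm_integral_osc_le hn hε hs hc hb hA Y
  obtain ⟨C₂, h₂⟩ := norm_integral_osc_le hn hε hs hc hb hA.reflect Y
  have hAc := hA.smooth.continuous
  have main : ∀ ρ y, 1 ≤ ρ → y ≠ 0 → |y| ≤ Y → ‖oscInt n ε b A ρ y‖ ≤ C₁ + C₂ := by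
    intro ρ y hρ hy hyY
    have hρ0 : 0 < ρ := by linarith
    rw [oscInt, dInt_eq_rect hb.le (F := fun p => osc n ε y ρ p * A p) (continuous_osc.mul hAc), norm_mul, Complex.norm_real,
      Real.norm_of_nonneg hρ0.le]
    simp only [osc_neg_snd]
    calc _ ≤ ρ * (C₁ / ρ + C₂ / ρ) := by
          refine mul_le_mul_of_nonneg_left ((norm_add_le _ _).trans (add_le_add ?_ ?_)) hρ0.le
          · exact h₁ y ρ ⟨hy, hyY, hρ⟩
          · exact h₂ (-y) ρ ⟨by simpa using hy, by simpa using hyY, hρ⟩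
      _ = _ := by field_simp
  refine ⟨C₁ + C₂, fun ρ y hρ hyY => ?_⟩
  rcases eq_or_ne y 0 with rfl | hy
  · have hcont : Continuous fun y => ‖oscInt n ε b A ρ y‖ := by
      refine (continuous_const.mul (continuous_dInt (b := b)
        (F := fun y p => osc n ε y ρ p * A p) ?_)).norm
      exact ((continuous_osc_param n ε).comp
        (f := fun q : ℝ × ℝ × ℝ => ((q.1, ρ), q.2)) (by fun_prop)).mul (hAc.comp continuous_snd)
    refine le_of_tendsto (x := 𝓝[≠] (0 : ℝ)) (hcont.tendsto 0 |>.mono_left nhdsWithin_le_nhds) ?_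
    have : ∀ᶠ z : ℝ in 𝓝[≠] 0, |z| ≤ Y := by
      refine nhdsWithin_le_nhds ?_
      have := (continuous_abs (G := ℝ)).tendsto 0
      simp only [abs_zero] at this
      exact this.eventually (ge_mem_nhds hY)
    filter_upwards [self_mem_nhdsWithin, this] with z hz hz'
    exact main ρ z hρ hz hz'
  · exact main ρ y hρ hy hyY

theorem Amp.smooth_mul (hA : Amp s₁ c b A) {g : ℝ × ℝ → ℂ} (hg : ContDiff ℝ ∞ g) :
    Amp s₁ c b (fun p => g p * A p) :=
  ⟨hg.mul hA.smooth, fun p hp => by rw [hA.zero p hp, mul_zero]⟩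

theorem hasDerivAt_oscInt_snd (hA : Continuous A) (ρ y : ℝ) :
    HasDerivAt (fun z => oscInt n ε b A ρ z)
      (Complex.I * ρ * oscInt n ε b (fun p => (p.1 * p.2 : ℝ) * A p) ρ y) y := by
  have hc : Continuous fun q : ℝ × ℝ × ℝ => osc n ε q.1 ρ q.2 * A q.2 :=
    ((continuous_osc_param n ε).comp
      (f := fun q : ℝ × ℝ × ℝ => ((q.1, ρ), q.2)) (by fun_prop)).mul (hA.comp continuous_snd)
  have h1 := hasDerivAt_dInt (b := b) (F := fun z p => osc n ε z ρ p * A p)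
    (F' := fun z p => (Complex.I * ρ) * (osc n ε z ρ p * A p * (p.1 * p.2 : ℝ))) hc (by
      exact continuous_const.mul (hc.mul (by fun_prop))) (fun z p => by
      have h2 : HasDerivAt (fun z => ρ * totPhase n ε z p) (ρ * (p.1 * p.2)) z := by
        have := ((((hasDerivAt_id z).const_mul (p.1 * p.2)).const_add (n * p.1)).add_const
          (ε * unitPhase p)).const_mul ρ
        exact this.congr_deriv (by ring)
      have h3 := ((h2.ofReal_comp).const_mul Complex.I).cexp.mul_const (A p)
      refine h3.congr_deriv ?_
      rw [osc]
      push_cast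
      ring) y
  refine (h1.const_mul (ρ : ℂ)).congr_deriv ?_
  rw [dInt_const_mul, oscInt]
  rw [show (fun p : ℝ × ℝ => osc n ε y ρ p * (((p.1 * p.2 : ℝ) : ℂ) * A p)) =
    fun p => osc n ε y ρ p * A p * (p.1 * p.2 : ℝ) by funext p; ring]
  ring

theorem hasDerivAt_oscInt_fst (hA : Continuous A) (ρ y : ℝ) (hρ : ρ ≠ 0) :
    HasDerivAt (fun r => oscInt n ε b A r y)
      ((ρ : ℂ)⁻¹ * oscInt n ε b A ρ y +
        oscInt n ε b (fun p => (Complex.I * totPhase n ε y p) * A p) ρ y) ρ := by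
  have hP : Continuous (totPhase n ε y) :=
    (contDiff_totPhase n ε).continuous.comp (f := fun p : ℝ × ℝ => (y, p)) (by fun_prop)
  have hc : Continuous fun q : ℝ × ℝ × ℝ => osc n ε y q.1 q.2 * A q.2 :=
    ((continuous_osc_param n ε).comp
      (f := fun q : ℝ × ℝ × ℝ => ((y, q.1), q.2)) (by fun_prop)).mul (hA.comp continuous_snd)
  have h1 := hasDerivAt_dInt (b := b) (F := fun r p => osc n ε y r p * A p)
    (F' := fun r p => osc n ε y r p * (Complex.I * totPhase n ε y p * A p)) hc (by
      have : Continuous fun q : ℝ × ℝ × ℝ => (osc n ε y q.1 q.2 * A q.2) *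
          (Complex.I * totPhase n ε y q.2) := hc.mul (by fun_prop)
      refine this.congr fun q => by ring) (fun r p => by
      have h2 : HasDerivAt (fun r => r * totPhase n ε y p) (totPhase n ε y p) r := by
        simpa using (hasDerivAt_id r).mul_const (totPhase n ε y p)
      have h3 := ((h2.ofReal_comp).const_mul Complex.I).cexp.mul_const (A p)
      refine h3.congr_deriv ?_
      rw [osc]
      ring) ρ
  have h4 : HasDerivAt (fun r : ℝ => (r : ℂ)) 1 ρ := Complex.ofRealCLM.hasDerivAt
  refine (h4.mul h1).congr_deriv ?_
  rw [oscInt, oscInt, ← mul_assoc, inv_mul_cancel₀ (by exact_mod_cast hρ)]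

theorem oscInt_add {A₁ A₂ : ℝ × ℝ → ℂ} (h₁ : Continuous A₁) (h₂ : Continuous A₂) :
    oscInt n ε b (fun p => A₁ p + A₂ p) ρ y = oscInt n ε b A₁ ρ y + oscInt n ε b A₂ ρ y := by
  rw [oscInt, oscInt, oscInt, ← mul_add, ← dInt_add (F := fun p => osc n ε y ρ p * A₁ p)
    (G := fun p => osc n ε y ρ p * A₂ p) (continuous_osc.mul h₁) (continuous_osc.mul h₂)]
  simp only [mul_add]

theorem oscInt_const_mul (a : ℂ) (A : ℝ × ℝ → ℂ) :
    oscInt n ε b (fun p => a * A p) ρ y = a * oscInt n ε b A ρ y := by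
  simp only [oscInt, mul_left_comm _ a, dInt_const_mul]

theorem contDiff_ofReal_comp {E : Type*} [NormedAddCommGroup E] [NormedSpace ℝ E] {f : E → ℝ}
    (hf : ContDiff ℝ ∞ f) : ContDiff ℝ ∞ (fun x => (f x : ℂ)) :=
  Complex.ofRealCLM.contDiff.comp hf

end DoubleIntegral

/-! ### The class of oscillatory integrals, closed under ∂_ρ, D_y and cutoffs in y. -/

section OscClass

variable {n b s₁ c R : ℝ}

/-- Functions which for `ρ > R` are sums of oscillatory integrals with coefficients
`ρ⁻ʲ g(y)`, `j ≥ m`. -/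
inductive OscClass (n b s₁ c R : ℝ) (m : ℕ) : (ℝ → ℝ → ℂ) → Prop
  | term (ε : ℝ) (hε : ε = 1 ∨ ε = -1) (A : ℝ × ℝ → ℂ) (hA : Amp s₁ c b A) (g : ℝ → ℂ)
      (hg : ContDiff ℝ ∞ g) (j : ℕ) (hj : m ≤ j) :
      OscClass n b s₁ c R m (fun ρ y => ((ρ : ℂ)⁻¹) ^ j * (g y * oscInt n ε b A ρ y))
  | add (F G : ℝ → ℝ → ℂ) (hF : OscClass n b s₁ c R m F) (hG : OscClass n b s₁ c R m G) :
      OscClass n b s₁ c R m (fun ρ y => F ρ y + G ρ y)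
  | congr (F G : ℝ → ℝ → ℂ) (hF : OscClass n b s₁ c R m F)
      (h : ∀ ρ, R < ρ → ∀ y, F ρ y = G ρ y) : OscClass n b s₁ c R m G

namespace OscClass

variable {m : ℕ} {F : ℝ → ℝ → ℂ}

theorem norm_le (hn : n = 1 ∨ n = 3) (hs : 0 < s₁) (hc : 0 < c) (hb : 0 < b) (hR : 1 ≤ R)
    (hF : OscClass n b s₁ c R m F) {Y : ℝ} (hY : 0 < Y) :
    ∃ C, 0 ≤ C ∧ ∀ ρ y, R < ρ → |y| ≤ Y → ‖F ρ y‖ ≤ (ρ⁻¹) ^ m * C := by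
  induction hF with
  | term ε hε A hA g hg j hj =>
    obtain ⟨C, hC⟩ := norm_oscInt_le hn hε hs hc hb hA Y hY
    obtain ⟨D, hD⟩ := (isCompact_Icc (a := -Y) (b := Y)).exists_bound_of_continuousOn
      hg.continuous.continuousOn
    refine ⟨|D| * |C|, by positivity, fun ρ y hρ hy => ?_⟩
    have hρ1 : 1 ≤ ρ := by linarith
    have hρ0 : 0 < ρ := by linarith
    rw [norm_mul, norm_mul, norm_pow, norm_inv, Complex.norm_real, Real.norm_of_nonneg hρ0.le]
    refine mul_le_mul (pow_le_pow_of_le_one (by positivity) (inv_le_one_of_one_le₀ hρ1) hj)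
      (mul_le_mul ((hD y (abs_le.1 hy)).trans (le_abs_self _))
        ((hC ρ y hρ1 hy).trans (le_abs_self _)) (norm_nonneg _) (abs_nonneg _))
      (by positivity) (by positivity)
  | add F G _ _ ihF ihG =>
    obtain ⟨C, hC0, hC⟩ := ihF
    obtain ⟨D, hD0, hD⟩ := ihG
    refine ⟨C + D, by positivity, fun ρ y hρ hy => (norm_add_le _ _).trans ?_⟩
    rw [mul_add]
    exact add_le_add (hC ρ y hρ hy) (hD ρ y hρ hy)
  | congr F G _ h ih =>
    obtain ⟨C, hC0, hC⟩ := ih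
    exact ⟨C, hC0, fun ρ y hρ hy => h ρ hρ y ▸ hC ρ y hρ hy⟩

theorem mul_coef (hF : OscClass n b s₁ c R m F) {g : ℝ → ℂ} (hg : ContDiff ℝ ∞ g) :
    OscClass n b s₁ c R m (fun ρ y => g y * F ρ y) := by
  induction hF with
  | term ε hε A hA g' hg' j hj =>
    exact congr _ _ (term ε hε A hA _ (hg.mul hg') j hj) fun ρ _ y => by ring
  | add F G _ _ ihF ihG => exact congr _ _ (add _ _ ihF ihG) fun ρ _ y => by ring
  | congr F G _ h ih => exact congr _ _ ih fun ρ hρ y => by rw [h ρ hρ y]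

/-- Differentiating the exponential gives iρση, whose iρ is absorbed by D_y and whose ση goes into
the amplitude; differentiating the coefficient g gains a power of ρ⁻¹. -/
theorem exists_hasDerivAt_snd (hR : 1 ≤ R) (hF : OscClass n b s₁ c R m F) :
    ∃ F', OscClass n b s₁ c R m F' ∧
      ∀ ρ, R < ρ → ∀ y, HasDerivAt (fun z => F ρ z) (Complex.I * ρ * F' ρ y) y := by
  induction hF with
  | term ε hε A hA g hg j hj =>
    have hg' : ContDiff ℝ ∞ (deriv g) := (contDiff_infty_iff_deriv.1 hg).2
    refine ⟨_, add _ _ (term ε hε _ (hA.smooth_mul (g := fun p => ((p.1 * p.2 : ℝ) : ℂ))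
      (contDiff_ofReal_comp (by fun_prop))) g hg j hj)
      (term ε hε A hA _ (contDiff_const (c := -Complex.I) |>.mul hg') (j + 1) (by omega)),
      fun ρ hρ y => ?_⟩
    have hρ0 : (ρ : ℂ) ≠ 0 := by exact_mod_cast (by linarith : ρ ≠ 0)
    have h1 := (((hg.differentiable (by simp) y).hasDerivAt).mul
      (hasDerivAt_oscInt_snd (n := n) (ε := ε) (b := b) hA.smooth.continuous ρ y)).const_mul
      (((ρ : ℂ)⁻¹) ^ j)
    refine h1.congr_deriv ?_
    rw [pow_succ]
    field_simp
    linear_combination (deriv g y * oscInt n ε b A ρ y) * Complex.I_sq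
  | add F G _ _ ihF ihG =>
    obtain ⟨F', hF', h1⟩ := ihF
    obtain ⟨G', hG', h2⟩ := ihG
    exact ⟨_, add _ _ hF' hG', fun ρ hρ y => ((h1 ρ hρ y).add (h2 ρ hρ y)).congr_deriv (by ring)⟩
  | congr F G _ h ih =>
    obtain ⟨F', hF', h1⟩ := ih
    exact ⟨F', hF', fun ρ hρ y => by simpa only [h ρ hρ] using h1 ρ hρ y⟩

/-- ∂_ρ brings down iΦ, which depends on y while amplitudes may not. Φ is affine in y, so its linear
part is moved to the coefficient g(y). -/
theorem exists_hasDerivAt_fst (hR : 1 ≤ R) (hF : OscClass n b s₁ c R m F) :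
    ∃ F', OscClass n b s₁ c R m F' ∧
      ∀ ρ, R < ρ → ∀ y, HasDerivAt (fun r => F r y) (F' ρ y) ρ := by
  induction hF with
  | term ε hε A hA g hg j hj =>
    have hP : ContDiff ℝ ∞ (fun p : ℝ × ℝ => Complex.I * ((n * p.1 + ε * unitPhase p : ℝ) : ℂ)) := by
      have := contDiff_unitPhase
      exact contDiff_const.mul (contDiff_ofReal_comp (by fun_prop))
    have hQ : ContDiff ℝ ∞ (fun p : ℝ × ℝ => Complex.I * ((p.1 * p.2 : ℝ) : ℂ)) :=
      contDiff_const.mul (contDiff_ofReal_comp (by fun_prop))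
    have hid : ContDiff ℝ ∞ (fun y : ℝ => (y : ℂ)) := Complex.ofRealCLM.contDiff
    refine ⟨_, add _ _ (add _ _ (term ε hε A hA _ (contDiff_const (c := 1 - (j : ℂ)) |>.mul hg)
      (j + 1) (by omega)) (term ε hε _ (hA.smooth_mul hP) g hg j hj))
      (term ε hε _ (hA.smooth_mul hQ) _ (hid.mul hg) j hj), fun ρ hρ y => ?_⟩
    have hρr : ρ ≠ 0 := by linarith
    have hρ0 : (ρ : ℂ) ≠ 0 := by exact_mod_cast hρr
    have h0 : HasDerivAt (fun r : ℝ => ((r : ℂ)⁻¹) ^ j) (-j * ((ρ : ℂ)⁻¹) ^ (j + 1)) ρ := by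
      have e1 : HasDerivAt (fun r : ℝ => (r : ℂ)) 1 ρ := Complex.ofRealCLM.hasDerivAt
      refine ((e1.inv hρ0).pow j).congr_deriv ?_
      rcases j with _ | j
      · simp
      · simp only [Nat.add_sub_cancel, Pi.inv_apply]
        push_cast
        rw [show -1 / (ρ : ℂ) ^ 2 = -((ρ : ℂ)⁻¹) ^ 2 by field_simp]
        ring
    have h1 := h0.mul ((hasDerivAt_oscInt_fst (n := n) (ε := ε) (b := b) hA.smooth.continuous
      ρ y hρr).const_mul (g y))
    refine h1.congr_deriv ?_
    have e : oscInt n ε b (fun p => Complex.I * totPhase n ε y p * A p) ρ y =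
        oscInt n ε b (fun p => Complex.I * ((n * p.1 + ε * unitPhase p : ℝ) : ℂ) * A p) ρ y +
        y * oscInt n ε b (fun p => Complex.I * ((p.1 * p.2 : ℝ) : ℂ) * A p) ρ y := by
      have c2 := hA.smooth.continuous
      rw [← oscInt_const_mul, ← oscInt_add
        (A₁ := fun p => Complex.I * ((n * p.1 + ε * unitPhase p : ℝ) : ℂ) * A p)
        (A₂ := fun p => y * (Complex.I * ((p.1 * p.2 : ℝ) : ℂ) * A p)) (hP.continuous.mul c2)
        (continuous_const.mul (hQ.continuous.mul c2))]
      congr 1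
      funext p
      rw [totPhase]
      push_cast
      ring
    rw [e, pow_succ]
    ring
  | add F G _ _ ihF ihG =>
    obtain ⟨F', hF', h1⟩ := ihF
    obtain ⟨G', hG', h2⟩ := ihG
    exact ⟨_, add _ _ hF' hG', fun ρ hρ y => (h1 ρ hρ y).add (h2 ρ hρ y)⟩
  | congr F G _ h ih =>
    obtain ⟨F', hF', h1⟩ := ih
    exact ⟨F', hF', fun ρ hρ y => (h1 ρ hρ y).congr_of_eventuallyEq
      ((eventually_gt_nhds hρ).mono fun r hr => (h r hr y).symm)⟩

theorem dRho (hR : 1 ≤ R) (hF : OscClass n b s₁ c R m F) : OscClass n b s₁ c R m (dRho F) := by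
  obtain ⟨F', hF', h⟩ := hF.exists_hasDerivAt_fst hR
  exact congr _ _ hF' fun ρ hρ y => (h ρ hρ y).deriv.symm

theorem dY (hR : 1 ≤ R) (hF : OscClass n b s₁ c R m F) : OscClass n b s₁ c R m (dY F) := by
  obtain ⟨F', hF', h⟩ := hF.exists_hasDerivAt_snd hR
  refine congr _ _ hF' fun ρ hρ y => ?_
  have hρ0 : (ρ : ℂ) ≠ 0 := by exact_mod_cast (by linarith : ρ ≠ 0)
  rw [HypKG.dY, (h ρ hρ y).deriv]
  field_simp

theorem cutoff (hF : OscClass n b s₁ c R m F) {χ : ℝ → ℝ} (hχ : ContDiff ℝ ∞ χ) :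
    OscClass n b s₁ c R m (cutoff χ F) :=
  hF.mul_coef (g := fun y => (χ y : ℂ)) (Complex.ofRealCLM.contDiff.comp hχ)

theorem iterate (hR : 1 ≤ R) (hF : OscClass n b s₁ c R m F) (k l : ℕ) :
    OscClass n b s₁ c R m (HypKG.dRho^[k] (HypKG.dY^[l] F)) := by
  induction k with
  | zero =>
    induction l with
    | zero => exact hF
    | succ l ih => rw [Function.iterate_succ_apply']; exact ih.dY hR
  | succ k ih => rw [Function.iterate_succ_apply']; exact ih.dRho hR

end OscClass

end OscClass

/-! ### The approximate wave equation. -/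

section Equation

variable {n ε b s₁ c R : ℝ} {A : ℝ × ℝ → ℂ}

/-- The Euler operator `σ ∂_σ`. -/
def eulerD (A : ℝ × ℝ → ℂ) (p : ℝ × ℝ) : ℂ := (p.1 : ℂ) * fderiv ℝ A p (1, 0)

/-- The boundary term at `σ = 1`. -/
def bdryInt (n b : ℝ) (A : ℝ × ℝ → ℂ) (ρ y : ℝ) : ℂ :=
  ∫ η in (-(b + 1))..(b + 1), Complex.exp (Complex.I * (ρ * (n + η * y) : ℝ)) * A (1, η)

theorem Amp.eulerD (hA : Amp s₁ c b A) : Amp s₁ c b (eulerD A) := by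
  refine ⟨(contDiff_ofReal_comp contDiff_fst).mul
    ((hA.smooth.fderiv_right (m := ∞) (by simp)).clm_apply contDiff_const), fun p hp => ?_⟩
  have h0 : A =ᶠ[𝓝 p] fun _ => 0 :=
    Filter.mem_of_superset ((isOpen_ampSet s₁ c b).mem_nhds hp) hA.zero
  have := (DirD.of_differentiableAt (v := (1, 0)) (hA.smooth.differentiable (by simp) p)).eq_zero h0
  rw [HypKG.eulerD, this, mul_zero]

theorem osc_one (y ρ η : ℝ) :
    osc n ε y ρ (1, η) = Complex.exp (Complex.I * (ρ * (n + η * y) : ℝ)) := by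
  simp [osc, totPhase, unitPhase]

theorem hasDerivAt_of_dirD {E : Type*} [NormedAddCommGroup E] [NormedSpace ℝ E]
    {F : ℝ × ℝ → E} {σ η : ℝ} {d : E} (h : DirD (1, 0) F (σ, η) d) :
    HasDerivAt (fun s => F (s, η)) d σ := by
  obtain ⟨F', hF, rfl⟩ := h
  have h1 : HasDerivAt (fun s : ℝ => (s, η)) ((1 : ℝ), (0 : ℝ)) σ :=
    (hasDerivAt_id σ).prodMk (hasDerivAt_const σ η)
  exact hF.comp_hasDerivAt σ h1

/-- The bracket multiplied by σ is ∂_σΦ, so Φ − σ∂_σΦ = ε⟨ση⟩: this is the ρ-derivative of ρΦ(s/ρ,η)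
with s = ρσ held fixed, up to the change of η, and it has the eikonal form. -/
theorem totPhase_eq (n ε y : ℝ) (p : ℝ × ℝ) : totPhase n ε y p =
    ε * jap (p.1 * p.2) + p.1 * (radF n ε p + p.2 * tanG ε y p) := by
  rw [totPhase, unitPhase, radF, tanG, rapGap]
  ring

theorem contDiff_jap_mul : ContDiff ℝ ∞ fun p : ℝ × ℝ => ((jap (p.1 * p.2) : ℝ) : ℂ) :=
  contDiff_ofReal_comp (contDiff_jap.comp (by fun_prop))

/-- The integrand is ∂_σ(σ e^{iρΦ}A); the factor σ kills the contribution of the lower edge. -/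
theorem dInt_parts (hA : ContDiff ℝ ∞ A) (ρ y : ℝ) :
    dInt b (fun p => osc n ε y ρ p * (A p + eulerD A p +
      Complex.I * (ρ * (p.1 * (radF n ε p + p.2 * tanG ε y p)) : ℝ) * A p)) = bdryInt n b A ρ y := by
  have ho := continuous_osc (n := n) (ε := ε) (y := y) (ρ := ρ)
  have hA' : Continuous fun p => fderiv ℝ A p (1, 0) :=
    ((hA.fderiv_right (m := ∞) (by simp)).clm_apply contDiff_const).continuous
  have hr := (contDiff_radF (n := n) (ε := ε)).continuous
  have ht := continuous_tanG (ε := ε) (y := y)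
  have hAc := hA.continuous
  have hG : Continuous fun p => osc n ε y ρ p * (A p + eulerD A p +
      Complex.I * (ρ * (p.1 * (radF n ε p + p.2 * tanG ε y p)) : ℝ) * A p) := by
    unfold eulerD
    fun_prop
  have hF : Continuous fun p : ℝ × ℝ => (p.1 : ℂ) * (osc n ε y ρ p * A p) := by fun_prop
  have hd : ∀ σ η : ℝ, HasDerivAt (fun s : ℝ => (s : ℂ) * (osc n ε y ρ (s, η) * A (s, η)))
      (osc n ε y ρ (σ, η) * (A (σ, η) + eulerD A (σ, η) +
      Complex.I * (ρ * (σ * (radF n ε (σ, η) + η * tanG ε y (σ, η))) : ℝ) * A (σ, η))) σ := by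
    intro σ η
    have e1 : DirD (1, 0) (osc n ε y ρ) (σ, η) _ := (((DirD.const ρ).mul
      (dirD_totPhase (v := (1, 0)) (p := (σ, η)) (n := n) (ε := ε) (y := y))).ofReal.map
      (ContinuousLinearMap.mul ℝ ℂ Complex.I)).cexp
    have e2 := DirD.of_differentiableAt (v := (1, 0)) (hA.differentiable (by simp) (σ, η))
    refine (hasDerivAt_of_dirD (DirD.fst.ofReal.mul (e1.mul e2))).congr_deriv ?_
    simp only [osc, eulerD, ContinuousLinearMap.mul_apply']
    push_cast
    ring
  have hW := fun σ => hasDerivAt_intervalIntegral_param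
    (F := fun s η => (s : ℂ) * (osc n ε y ρ (s, η) * A (s, η)))
    (fun s => hF.comp (f := fun η : ℝ => (s, η)) (by fun_prop)) hG hd (-(b + 1)) (b + 1) σ
  rw [dInt, intervalIntegral.integral_eq_sub_of_hasDerivAt (fun σ _ => hW σ)
    ((continuous_inner_integral hG _ _).intervalIntegrable _ _)]
  simp [bdryInt, osc_one]

theorem hasDerivAt_oscInt_fst' (hA : ContDiff ℝ ∞ A) {ρ : ℝ} (hρ : ρ ≠ 0) (y : ℝ) :
    HasDerivAt (fun r => oscInt n ε b A r y)
      (ε * oscInt n ε b (fun p => Complex.I * jap (p.1 * p.2) * A p) ρ y + bdryInt n b A ρ y -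
        (ρ : ℂ)⁻¹ * oscInt n ε b (eulerD A) ρ y) ρ := by
  refine (hasDerivAt_oscInt_fst hA.continuous ρ y hρ).congr_deriv ?_
  have hρ0 : (ρ : ℂ) ≠ 0 := by exact_mod_cast hρ
  have ho := continuous_osc (n := n) (ε := ε) (y := y) (ρ := ρ)
  have hA' : Continuous fun p => fderiv ℝ A p (1, 0) :=
    ((hA.fderiv_right (m := ∞) (by simp)).clm_apply contDiff_const).continuous
  have hE : Continuous (eulerD A) := by
    unfold eulerD
    fun_prop
  have hAc := hA.continuous
  have hP : Continuous (totPhase n ε y) :=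
    (contDiff_totPhase n ε).continuous.comp (f := fun p : ℝ × ℝ => (y, p)) (by fun_prop)
  have hj := contDiff_jap_mul.continuous
  rw [← dInt_parts (ε := ε) hA]
  have e : dInt b (fun p => osc n ε y ρ p * (A p + eulerD A p +
      Complex.I * (ρ * (p.1 * (radF n ε p + p.2 * tanG ε y p)) : ℝ) * A p)) =
      (ρ : ℂ)⁻¹ * oscInt n ε b (fun p => (A p + eulerD A p) + ρ * (Complex.I * totPhase n ε y p * A p +
        (-1) * (ε * (Complex.I * jap (p.1 * p.2) * A p)))) ρ y := by
    rw [oscInt, ← mul_assoc, inv_mul_cancel₀ hρ0, one_mul]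
    congr 1
    funext p
    rw [totPhase_eq]
    push_cast
    ring
  rw [e, oscInt_add (by fun_prop) (by fun_prop), oscInt_add (by fun_prop) (by fun_prop),
    oscInt_const_mul (ρ : ℂ), oscInt_add (by fun_prop) (by fun_prop), oscInt_const_mul (-1),
    oscInt_const_mul (ε : ℂ)]
  field_simp
  ring

theorem OscClass.single {m : ℕ} {ε : ℝ} (hε : ε = 1 ∨ ε = -1) (hA : Amp s₁ c b A) (a : ℂ) (j : ℕ)
    (hj : m ≤ j) : OscClass n b s₁ c R m (fun ρ y => a * ((ρ : ℂ)⁻¹) ^ j * oscInt n ε b A ρ y) :=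
  OscClass.congr _ _ (OscClass.term ε hε A hA (fun _ => a) contDiff_const j hj)
    fun ρ _ y => by ring

/-- The difference of the oscillatory integrals with the two signs of the phase. -/
def oscDiff (n b : ℝ) (A : ℝ × ℝ → ℂ) (ρ y : ℝ) : ℂ := oscInt n 1 b A ρ y - oscInt n (-1) b A ρ y

def oscSum (n b : ℝ) (A : ℝ × ℝ → ℂ) (ρ y : ℝ) : ℂ := oscInt n 1 b A ρ y + oscInt n (-1) b A ρ y

/-- At σ = 1 the two signs of the phase agree, so the edge terms cancel in the difference; in the
sum they double. Thus the source appears only at the second ρ-derivative. -/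
theorem hasDerivAt_oscDiff (hA : ContDiff ℝ ∞ A) {ρ : ℝ} (hρ : ρ ≠ 0) (y : ℝ) :
    HasDerivAt (fun r => oscDiff n b A r y)
      (oscSum n b (fun p => Complex.I * jap (p.1 * p.2) * A p) ρ y -
        (ρ : ℂ)⁻¹ * oscDiff n b (eulerD A) ρ y) ρ := by
  refine ((hasDerivAt_oscInt_fst' hA hρ y).sub (hasDerivAt_oscInt_fst' hA hρ y)).congr_deriv ?_
  rw [oscSum, oscDiff]
  push_cast
  ring

theorem hasDerivAt_oscSum (hA : ContDiff ℝ ∞ A) {ρ : ℝ} (hρ : ρ ≠ 0) (y : ℝ) :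
    HasDerivAt (fun r => oscSum n b A r y)
      (oscDiff n b (fun p => Complex.I * jap (p.1 * p.2) * A p) ρ y + 2 * bdryInt n b A ρ y -
        (ρ : ℂ)⁻¹ * oscSum n b (eulerD A) ρ y) ρ := by
  refine ((hasDerivAt_oscInt_fst' hA hρ y).add (hasDerivAt_oscInt_fst' hA hρ y)).congr_deriv ?_
  rw [oscSum, oscDiff]
  push_cast
  ring

theorem deriv_deriv_oscDiff_snd (hA : ContDiff ℝ ∞ A) (ρ y : ℝ) :
    deriv (deriv fun z => oscDiff n b A ρ z) y =
      -(ρ : ℂ) ^ 2 * oscDiff n b (fun p => ((p.1 * p.2 : ℝ) : ℂ) * (((p.1 * p.2 : ℝ) : ℂ) * A p)) ρ y := by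
  have hm : Continuous fun p : ℝ × ℝ => ((p.1 * p.2 : ℝ) : ℂ) * A p :=
    Continuous.mul (by fun_prop) hA.continuous
  have h1 : ∀ {A : ℝ × ℝ → ℂ}, Continuous A → ∀ z, HasDerivAt (fun z => oscDiff n b A ρ z)
      (Complex.I * ρ * oscDiff n b (fun p => ((p.1 * p.2 : ℝ) : ℂ) * A p) ρ z) z := fun hA z =>
    ((hasDerivAt_oscInt_snd hA ρ z).sub (hasDerivAt_oscInt_snd hA ρ z)).congr_deriv (by
      rw [oscDiff]; ring)
  have h2 : (deriv fun z => oscDiff n b A ρ z) = fun z =>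
      Complex.I * ρ * oscDiff n b (fun p => ((p.1 * p.2 : ℝ) : ℂ) * A p) ρ z :=
    funext fun z => (h1 hA.continuous z).deriv
  rw [h2, ((h1 hm y).const_mul (Complex.I * (ρ : ℂ))).deriv]
  linear_combination ((ρ : ℂ) ^ 2 * oscDiff n b (fun p =>
    ((p.1 * p.2 : ℝ) : ℂ) * (((p.1 * p.2 : ℝ) : ℂ) * A p)) ρ y) * Complex.I_sq

theorem boxPlusOne_eq (hR : 0 ≤ R) (hA : ContDiff ℝ ∞ A) {F : ℝ → ℝ → ℂ}
    (hF : ∀ ρ, R < ρ → ∀ y, F ρ y = oscDiff n b A ρ y) {ρ : ℝ} (hρ : R < ρ) (y : ℝ) :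
    boxPlusOne F ρ y = 2 * bdryInt n b (fun p => Complex.I * jap (p.1 * p.2) * A p) ρ y -
      (ρ : ℂ)⁻¹ * (oscSum n b (eulerD fun p => Complex.I * jap (p.1 * p.2) * A p) ρ y +
        oscSum n b (fun p => Complex.I * jap (p.1 * p.2) * eulerD A p) ρ y) +
      ((ρ : ℂ)⁻¹) ^ 2 * (oscDiff n b (eulerD A) ρ y + oscDiff n b (eulerD (eulerD A)) ρ y) := by
  have hρr : ρ ≠ 0 := by linarith
  have hρ0 : (ρ : ℂ) ≠ 0 := by exact_mod_cast hρr
  have hE : ContDiff ℝ ∞ (eulerD A) := (contDiff_ofReal_comp contDiff_fst).mul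
    ((hA.fderiv_right (m := ∞) (by simp)).clm_apply contDiff_const)
  have hJ : ContDiff ℝ ∞ fun p : ℝ × ℝ => Complex.I * jap (p.1 * p.2) * A p :=
    (contDiff_const.mul contDiff_jap_mul).mul hA
  have hev : ∀ᶠ r in 𝓝 ρ, R < r := eventually_gt_nhds hρ
  have d1 : deriv (fun r => F r y) =ᶠ[𝓝 ρ] fun r =>
      oscSum n b (fun p => Complex.I * jap (p.1 * p.2) * A p) r y -
        (r : ℂ)⁻¹ * oscDiff n b (eulerD A) r y := by
    filter_upwards [hev] with r hr
    have : (fun r => F r y) =ᶠ[𝓝 r] fun r => oscDiff n b A r y :=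
      (eventually_gt_nhds hr).mono fun z hz => hF z hz y
    rw [this.deriv_eq]
    exact (hasDerivAt_oscDiff hA (by linarith) y).deriv
  have e1 : HasDerivAt (fun r : ℝ => (r : ℂ)) 1 ρ := Complex.ofRealCLM.hasDerivAt
  have d2 := ((hasDerivAt_oscSum (n := n) (b := b) hJ hρr y).sub
    ((e1.inv hρ0).mul (hasDerivAt_oscDiff (n := n) (b := b) hE hρr y))).deriv
  have d3 : (fun z => F ρ z) = fun z => oscDiff n b A ρ z := funext (hF ρ hρ)
  rw [boxPlusOne, d1.deriv_eq, d3, deriv_deriv_oscDiff_snd hA, hF ρ hρ]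
  refine (congrArg₂ _ (congrArg₂ _ d2 rfl) rfl).trans ?_
  -- The eikonal identity (i⟨ση⟩)² + (ση)² + 1 = 0 at the level of amplitudes removes all terms
  -- without a factor ρ⁻¹, apart from the edge term.
  have key : oscDiff n b (fun p => Complex.I * jap (p.1 * p.2) *
      (Complex.I * jap (p.1 * p.2) * A p)) ρ y +
      oscDiff n b (fun p => ((p.1 * p.2 : ℝ) : ℂ) * (((p.1 * p.2 : ℝ) : ℂ) * A p)) ρ y +
      oscDiff n b A ρ y = 0 := by
    have hAc := hA.continuous
    have hj := contDiff_jap_mul.continuous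
    have add : ∀ {A B : ℝ × ℝ → ℂ}, Continuous A → Continuous B → oscDiff n b A ρ y +
        oscDiff n b B ρ y = oscDiff n b (fun p => A p + B p) ρ y := fun hA hB => by
      rw [oscDiff, oscDiff, oscDiff, oscInt_add hA hB, oscInt_add hA hB]; ring
    rw [add (by fun_prop) (by fun_prop), add (by fun_prop) (by fun_prop)]
    have : (fun p : ℝ × ℝ => Complex.I * jap (p.1 * p.2) * (Complex.I * jap (p.1 * p.2) * A p) +
        ((p.1 * p.2 : ℝ) : ℂ) * (((p.1 * p.2 : ℝ) : ℂ) * A p) + A p) = fun p => 0 * A p := by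
      funext p
      have : (jap (p.1 * p.2) : ℂ) ^ 2 = 1 + ((p.1 * p.2 : ℝ) : ℂ) ^ 2 := by
        exact_mod_cast jap_sq (p.1 * p.2)
      linear_combination ((jap (p.1 * p.2) : ℂ) ^ 2 * A p) * Complex.I_sq - A p * this
    rw [this, oscDiff, oscInt_const_mul, oscInt_const_mul]
    ring
  simp only [Pi.inv_apply]
  generalize oscDiff n b (fun p => Complex.I * jap (p.1 * p.2) *
      (Complex.I * jap (p.1 * p.2) * A p)) ρ y = X₁ at key ⊢
  generalize oscDiff n b (fun p => ((p.1 * p.2 : ℝ) : ℂ) * (((p.1 * p.2 : ℝ) : ℂ) * A p)) ρ y = X₂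
    at key ⊢
  field_simp
  linear_combination (ρ : ℂ) ^ 2 * key

theorem OscClass.oscDiff {m : ℕ} (hA : Amp s₁ c b A) (a : ℂ) (j : ℕ) (hj : m ≤ j) :
    OscClass n b s₁ c R m (fun ρ y => a * ((ρ : ℂ)⁻¹) ^ j * oscDiff n b A ρ y) :=
  .congr _ _ (.add _ _ (.single (Or.inl rfl) hA a j hj) (.single (Or.inr rfl) hA (-a) j hj))
    fun ρ _ y => by rw [HypKG.oscDiff]; ring

theorem OscClass.oscSum {m : ℕ} (hA : Amp s₁ c b A) (a : ℂ) (j : ℕ) (hj : m ≤ j) :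
    OscClass n b s₁ c R m (fun ρ y => a * ((ρ : ℂ)⁻¹) ^ j * oscSum n b A ρ y) :=
  .congr _ _ (.add _ _ (.single (Or.inl rfl) hA a j hj) (.single (Or.inr rfl) hA a j hj))
    fun ρ _ y => by rw [HypKG.oscSum]; ring

theorem oscClass_boxPlusOne_sub (hR : 0 ≤ R) (hA : Amp s₁ c b A) {F S : ℝ → ℝ → ℂ}
    (hF : ∀ ρ, R < ρ → ∀ y, F ρ y = oscDiff n b A ρ y)
    (hS : ∀ ρ, R < ρ → ∀ y,
      2 * bdryInt n b (fun p => Complex.I * jap (p.1 * p.2) * A p) ρ y = S ρ y) :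
    OscClass n b s₁ c R 1 (fun ρ y => boxPlusOne F ρ y - S ρ y) := by
  have hJ : Amp s₁ c b fun p : ℝ × ℝ => Complex.I * jap (p.1 * p.2) * A p :=
    hA.smooth_mul (contDiff_const.mul contDiff_jap_mul)
  have hJ' : Amp s₁ c b fun p : ℝ × ℝ => Complex.I * jap (p.1 * p.2) * eulerD A p :=
    hA.eulerD.smooth_mul (contDiff_const.mul contDiff_jap_mul)
  refine .congr _ _ (.add _ _ (.add _ _ (.oscSum hJ.eulerD (-1) 1 le_rfl)
    (.oscSum hJ' (-1) 1 le_rfl)) (.add _ _ (.oscDiff hA.eulerD 1 2 (by norm_num))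
    (.oscDiff hA.eulerD.eulerD 1 2 (by norm_num)))) fun ρ hρ y => ?_
  rw [boxPlusOne_eq hR hA.smooth hF hρ, hS ρ hρ]
  ring

end Equation

/-! ### Smooth dependence of an interval integral on parameters. -/

section Smoothness

/-- The integral is the value at 0 of the convolution of the indicator of [−b, −a] with a compactly
supported smooth function. Smoothness of parametric convolutions then applies. -/
theorem contDiffOn_intervalIntegral_param {P : Type*} [NormedAddCommGroup P] [NormedSpace ℝ P]
    {s : Set P} (hs : IsOpen s) {g : P × ℝ → ℂ} (hg : ContDiffOn ℝ ∞ g (s ×ˢ univ)) {a b : ℝ}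
    (hab : a < b) : ContDiffOn ℝ ∞ (fun p => ∫ t in a..b, g (p, t)) s := by
  -- The inner radius (b−a)/2 makes the bump equal to 1 on all of [a, b], so inserting it leaves the
  -- integral unchanged.
  let φ : ContDiffBump ((a + b) / 2) := ⟨(b - a) / 2, b - a, by linarith, by linarith⟩
  have hφ : ∀ t ∈ Icc a b, φ t = 1 := fun t ht => φ.one_of_mem_closedBall (by
    rw [Metric.mem_closedBall, Real.dist_eq, abs_le]
    constructor
    · change -((b - a) / 2) ≤ _
      linarith [ht.1]
    · change _ ≤ (b - a) / 2
      linarith [ht.2])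
  have hG : ContDiffOn ℝ ∞ (↿fun (p : P) (x : ℝ) => φ x • g (p, x)) (s ×ˢ univ) :=
    ((φ.contDiff (n := ⊤)).comp contDiff_snd).contDiffOn.smul hg
  have hf : LocallyIntegrable (indicator (Icc (-b) (-a)) (fun _ => (1 : ℝ))) volume :=
    ((integrable_indicator_iff measurableSet_Icc).2
      (continuousOn_const.integrableOn_compact isCompact_Icc)).locallyIntegrable
  have key := contDiffOn_convolution_right_with_param_comp (n := ⊤) (μ := volume)
    (ContinuousLinearMap.lsmul ℝ ℝ) (v := fun _ : P => (0 : ℝ)) contDiffOn_const hs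
    (isCompact_closedBall ((a + b) / 2) (b - a))
    (fun p x _ hx => by
      rw [φ.zero_of_le_dist (le_of_lt (by simpa using hx)), zero_smul]) hf hG
  refine key.congr fun p hp => ?_
  have e := intervalIntegral.integral_comp_neg (a := -b) (b := -a) (fun t => g (p, t))
  simp only [neg_neg] at e
  rw [← e, intervalIntegral.integral_of_le (by linarith), ← integral_Icc_eq_integral_Ioc,
    ← integral_indicator measurableSet_Icc]
  rw [convolution]
  congr 1
  funext t
  by_cases ht : t ∈ Icc (-b) (-a)
  · have : φ (-t) = 1 := hφ _ ⟨by linarith [ht.2], by linarith [ht.1]⟩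
    simp [indicator_of_mem ht, this]
  · simp [indicator_of_notMem ht]

end Smoothness

/-! ### Fourier normalization and the phase in rescaled variables. -/

section Representation

theorem fourierHat_eq_fourier (v : ℝ → ℂ) (ξ : ℝ) :
    fourierHat v ξ = FourierTransform.fourier v (ξ / (2 * Real.pi)) := by
  rw [Real.fourier_eq', fourierHat]
  congr 1
  funext y
  simp only [smul_eq_mul, RCLike.inner_apply, conj_trivial]
  congr 2
  push_cast
  have : (Real.pi : ℂ) ≠ 0 := by exact_mod_cast Real.pi_ne_zero
  field_simp

theorem contDiff_fourierHat (β : 𝓢(ℝ, ℂ)) : ContDiff ℝ ∞ (fourierHat β) := by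
  have h : fourierHat β = fun ξ => FourierTransform.fourier β (ξ / (2 * Real.pi)) := by
    funext ξ
    rw [fourierHat_eq_fourier, SchwartzMap.fourier_coe]
  rw [h]
  exact (FourierTransform.fourier β).smooth'.comp (by fun_prop)

theorem fourierHat_comp_mul (v : ℝ → ℂ) {s : ℝ} (hs : 0 < s) (ξ : ℝ) :
    fourierHat (fun z => v (s * z)) ξ = (s : ℂ)⁻¹ * fourierHat v (ξ / s) := by
  have := Measure.integral_comp_mul_left
    (fun y : ℝ => Complex.exp (-(Complex.I * (ξ / s : ℝ) * y)) * v y) s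
  rw [abs_of_pos (inv_pos.2 hs)] at this
  rw [fourierHat, fourierHat, ← Complex.ofReal_inv, ← Complex.real_smul, ← this]
  congr 1
  funext y
  congr 3
  have : (s : ℂ) ≠ 0 := by exact_mod_cast hs.ne'
  push_cast
  field_simp

theorem fourierMul_comp_mul (m : ℝ → ℝ) (v : ℝ → ℂ) {s : ℝ} (hs : 0 < s) (y : ℝ) :
    fourierMul m (fun z => v (s * z)) y = (1 / (2 * (Real.pi : ℂ))) *
      ∫ η : ℝ, (m (s * η) : ℂ) * Complex.exp (Complex.I * y * (s * η : ℝ)) * fourierHat v η := by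
  have hs0 : (s : ℂ) ≠ 0 := by exact_mod_cast hs.ne'
  have := Measure.integral_comp_mul_left
    (fun ξ : ℝ => (m ξ : ℂ) * Complex.exp (Complex.I * y * ξ) * fourierHat v (ξ / s)) s
  rw [abs_of_pos (inv_pos.2 hs)] at this
  simp only [mul_div_cancel_left₀ _ hs.ne'] at this
  rw [this, fourierMul]
  congr 1
  rw [Complex.real_smul, ← integral_const_mul]
  congr 1
  funext ξ
  rw [fourierHat_comp_mul v hs]
  push_cast
  ring

theorem schwartz_inversion (β : 𝓢(ℝ, ℂ)) (x : ℝ) :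
    β x = (1 / (2 * (Real.pi : ℂ))) * ∫ η : ℝ, Complex.exp (Complex.I * (x * η : ℝ)) * fourierHat β η := by
  have h1 : FourierTransformInv.fourierInv (FourierTransform.fourier β) x = β x := by simp
  have hpi : (0 : ℝ) < 2 * Real.pi := by positivity
  rw [← h1, SchwartzMap.fourierInv_coe, Real.fourierInv_eq']
  have := Measure.integral_comp_mul_left
    (fun η : ℝ => Complex.exp (Complex.I * (x * η : ℝ)) * fourierHat β η) (2 * Real.pi)
  rw [abs_of_pos (inv_pos.2 hpi)] at this
  have e : (1 / (2 * (Real.pi : ℂ))) = ((2 * Real.pi)⁻¹ : ℝ) := by push_cast; ring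
  rw [e, ← Complex.real_smul, ← this]
  congr 1
  funext v
  rw [fourierHat_eq_fourier, mul_div_cancel_left₀ _ hpi.ne', SchwartzMap.fourier_coe]
  simp only [smul_eq_mul, RCLike.inner_apply, conj_trivial]
  congr 2
  push_cast
  ring

theorem phase_eq {ρ s : ℝ} (hρ : 0 < ρ) (hs : 0 < s) (η : ℝ) :
    phase ρ s (s * η) = ρ * unitPhase (s / ρ, η) := by
  have hpos : ∀ ζ ∈ uIcc s ρ, 0 < ζ := fun ζ hζ => lt_of_lt_of_le (lt_min hs hρ) hζ.1
  -- Explicit antiderivative of √(x²+1) in ζ, where x = sη/ζ: it is ζ(⟨x⟩ − x·arsinh x).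
  have hd : ∀ ζ ∈ uIcc s ρ, HasDerivAt
      (fun ζ => ζ * (jap (s * η / ζ) - s * η / ζ * Real.arsinh (s * η / ζ)))
      (√((s * η) ^ 2 / ζ ^ 2 + 1)) ζ := by
    intro ζ hζ
    have hζ0 := (hpos ζ hζ).ne'
    have h1 : HasDerivAt (fun ζ : ℝ => s * η / ζ) (-(s * η) / ζ ^ 2) ζ := by
      refine ((hasDerivAt_const ζ (s * η)).div (hasDerivAt_id ζ) hζ0).congr_deriv (by simp)
    have h2 := (hasDerivAt_jap (s * η / ζ)).comp ζ h1
    have h3 := (Real.hasDerivAt_arsinh (s * η / ζ)).comp ζ h1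
    refine ((hasDerivAt_id ζ).mul (h2.sub (h1.mul h3))).congr_deriv ?_
    have e : √((s * η) ^ 2 / ζ ^ 2 + 1) = jap (s * η / ζ) := by
      rw [jap, div_pow, add_comm]
    have hj := jap_pos (s * η / ζ)
    rw [e]
    change 1 * (jap (s * η / ζ) - s * η / ζ * Real.arsinh (s * η / ζ)) + ζ *
      (s * η / ζ / jap (s * η / ζ) * (-(s * η) / ζ ^ 2) - (-(s * η) / ζ ^ 2 * Real.arsinh (s * η / ζ) +
        s * η / ζ * ((jap (s * η / ζ))⁻¹ * (-(s * η) / ζ ^ 2)))) = jap (s * η / ζ)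
    generalize jap (s * η / ζ) = J at *
    generalize Real.arsinh (s * η / ζ) = H at *
    field_simp
    ring
  rw [phase, intervalIntegral.integral_eq_sub_of_hasDerivAt hd]
  · rw [unitPhase, mul_div_cancel_left₀ _ hs.ne', show s / ρ * η = s * η / ρ by ring]
    field_simp
    ring
  · refine ContinuousOn.intervalIntegrable (ContinuousOn.sqrt ?_)
    exact (continuousOn_const.div (by fun_prop) fun ζ hζ => pow_ne_zero 2 (hpos ζ hζ).ne').add
      continuousOn_const

theorem propagator_eq {ρ s : ℝ} (hρ : 0 < ρ) (hs : 0 < s) (η : ℝ) :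
    propagator ρ s (s * η) = Real.sin (ρ * unitPhase (s / ρ, η)) / jap η := by
  rw [propagator, phase_eq hρ hs, jap]
  congr 2
  field_simp
  ring

theorem integral_eq_intervalIntegral {F : ℝ → ℂ} {b : ℝ} (hb : 0 < b) (h : ∀ η, b < |η| → F η = 0) :
    ∫ η, F η = ∫ η in (-(b + 1))..(b + 1), F η := by
  rw [intervalIntegral.integral_of_le (by linarith)]
  refine (setIntegral_eq_integral_of_forall_compl_eq_zero fun η hη => h η ?_).symm
  rw [lt_abs]
  by_contra hcon
  push Not at hcon
  exact hη ⟨by linarith [hcon.2], by linarith [hcon.1]⟩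

end Representation

/-! ### K_n as a difference of two oscillatory integrals, and its smoothness. -/

section Kernel

variable {n : ℕ} {β : 𝓢(ℝ, ℂ)} {χ₁ : ℝ → ℝ} {b c s₁ : ℝ}

/-- The integrand of the parametrix in the variables `s` and `η = ξ/s`. -/
def kerK (n : ℕ) (β : ℝ → ℂ) (χ₁ : ℝ → ℝ) (ρ s y η : ℝ) : ℂ :=
  Complex.exp (Complex.I * (n * s : ℝ)) * ((1 / (2 * (Real.pi : ℂ))) *
    (((Real.sin (ρ * unitPhase (s / ρ, η)) / jap η : ℝ) : ℂ) *
      Complex.exp (Complex.I * (y * (s * η) : ℝ)) * fourierHat β η)) * (χ₁ (s / ρ) : ℂ)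

/-- The amplitude of the parametrix. -/
def ampK (β : ℝ → ℂ) (χ₁ : ℝ → ℝ) (p : ℝ × ℝ) : ℂ :=
  (χ₁ p.1 : ℂ) * fourierHat β p.2 * ((jap p.2)⁻¹ : ℝ) * (1 / (4 * (Real.pi : ℂ) * Complex.I))

theorem contDiff_jap_inv : ContDiff ℝ ∞ fun x => (jap x)⁻¹ :=
  contDiff_jap.inv fun x => (jap_pos x).ne'

theorem contDiff_ampK (hχ₁ : ContDiff ℝ ∞ χ₁) : ContDiff ℝ ∞ (ampK β χ₁) :=
  (((contDiff_ofReal_comp (hχ₁.comp contDiff_fst)).mul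
    ((contDiff_fourierHat β).comp contDiff_snd)).mul
    (contDiff_ofReal_comp (contDiff_jap_inv.comp contDiff_snd))).mul contDiff_const

theorem amp_ampK (hχ₁ : ContDiff ℝ ∞ χ₁) (hs : ∀ ζ, |ζ| < s₁ → χ₁ ζ = 0)
    (hβ : ∀ ξ, |ξ| < c ∨ b < |ξ| → fourierHat β ξ = 0) : Amp s₁ c b (ampK β χ₁) := by
  refine ⟨contDiff_ampK hχ₁, fun p hp => ?_⟩
  rcases hp with hp | hp
  · simp [ampK, hs _ hp]
  · simp [ampK, hβ _ hp]

theorem duhamelK_eq (hb : 0 < b) (hβ : ∀ ξ, b < |ξ| → fourierHat β ξ = 0) {ρ : ℝ} (hρ : 0 < ρ)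
    (y : ℝ) : duhamelK n β χ₁ ρ y =
      ∫ s in (1 : ℝ)..ρ, ∫ η in (-(b + 1))..(b + 1), kerK n β χ₁ ρ s y η := by
  refine intervalIntegral.integral_congr fun s hs => ?_
  have hs0 : 0 < s := lt_of_lt_of_le (lt_min one_pos hρ) hs.1
  simp only [kerK]
  rw [show Complex.I * n * s = Complex.I * ((n * s : ℝ) : ℂ) by push_cast; ring,
    fourierMul_comp_mul _ _ hs0, integral_eq_intervalIntegral hb (fun η hη => by
    rw [hβ η hη, mul_zero]), intervalIntegral.integral_mul_const,
    intervalIntegral.integral_const_mul, intervalIntegral.integral_const_mul]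
  congr 3
  congr 1
  funext η
  rw [propagator_eq hρ hs0]
  congr 3
  push_cast; ring

/-- Euler's formula for the sine; its 1/(2i) and the 1/(2π) of Fourier inversion make up the
constant 1/(4πi) in the amplitude. -/
theorem kerK_eq {ρ : ℝ} (hρ : ρ ≠ 0) (σ y η : ℝ) : kerK n β χ₁ ρ (ρ * σ) y η =
    osc n 1 y ρ (σ, η) * ampK β χ₁ (σ, η) - osc n (-1) y ρ (σ, η) * ampK β χ₁ (σ, η) := by
  have e : ∀ ε : ℝ, osc n ε y ρ (σ, η) = Complex.exp (Complex.I * (n * (ρ * σ) : ℝ)) *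
      Complex.exp (Complex.I * (y * (ρ * σ * η) : ℝ)) *
      Complex.exp ((ε * (ρ * unitPhase (σ, η)) : ℝ) * Complex.I) := by
    intro ε
    rw [osc, totPhase, ← Complex.exp_add, ← Complex.exp_add]
    congr 1
    push_cast
    ring
  have hsin : ((Real.sin (ρ * unitPhase (σ, η)) : ℝ) : ℂ) = (Complex.exp
      ((1 * (ρ * unitPhase (σ, η)) : ℝ) * Complex.I) -
      Complex.exp (((-1) * (ρ * unitPhase (σ, η)) : ℝ) * Complex.I)) / (2 * Complex.I) := by
    rw [Complex.ofReal_sin, Complex.sin]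
    push_cast
    rw [one_mul, neg_one_mul]
    field_simp
    linear_combination (Complex.exp (-(ρ * unitPhase (σ, η) * Complex.I)) -
      Complex.exp (ρ * unitPhase (σ, η) * Complex.I)) * Complex.I_sq
  rw [e, e, kerK, ampK, mul_div_cancel_left₀ _ hρ, Complex.ofReal_div, hsin]
  have hpi : (Real.pi : ℂ) ≠ 0 := by exact_mod_cast Real.pi_ne_zero
  have hj : (jap η : ℂ) ≠ 0 := by exact_mod_cast (jap_pos η).ne'
  simp only []
  push_cast
  field_simp
  ring

theorem continuous_kerK (hχ₁ : Continuous χ₁) (ρ y : ℝ) :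
    Continuous fun q : ℝ × ℝ => kerK n β χ₁ ρ q.1 y q.2 := by
  have h1 : Continuous fun q : ℝ × ℝ => unitPhase (q.1 / ρ, q.2) :=
    contDiff_unitPhase.continuous.comp (f := fun q : ℝ × ℝ => (q.1 / ρ, q.2)) (by fun_prop)
  have h2 := (contDiff_fourierHat β).continuous
  have h3 : Continuous fun q : ℝ × ℝ => Real.sin (ρ * unitPhase (q.1 / ρ, q.2)) / jap q.2 :=
    Continuous.div (by fun_prop) (contDiff_jap.continuous.comp continuous_snd)
      fun q => (jap_pos _).ne'
  unfold kerK
  fun_prop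

theorem dInt_sub {F G : ℝ × ℝ → ℂ} (hF : Continuous F) (hG : Continuous G) :
    dInt b (fun p => F p - G p) = dInt b F - dInt b G := by
  have := dInt_add (b := b) (F := F) (G := fun p => (-1 : ℂ) * G p) hF (continuous_const.mul hG : Continuous fun p => (-1 : ℂ) * G p)
  rw [dInt_const_mul] at this
  simpa [sub_eq_add_neg] using this

/-- For ρ > 1/s₁ the cutoff vanishes for 0 ≤ s ≤ 1, so the integral may start at s = 0; scaling s =
ρσ then yields a domain independent of ρ. -/
theorem duhamelK_eq_oscDiff (hχ₁ : ContDiff ℝ ∞ χ₁) (hs0 : 0 < s₁)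
    (hs : ∀ ζ, |ζ| < s₁ → χ₁ ζ = 0) (hb : 0 < b) (hβ : ∀ ξ, b < |ξ| → fourierHat β ξ = 0)
    {ρ : ℝ} (hρ : max 1 s₁⁻¹ < ρ) (y : ℝ) :
    duhamelK n β χ₁ ρ y = oscDiff n b (ampK β χ₁) ρ y := by
  have hρ1 : 1 < ρ := (le_max_left _ _).trans_lt hρ
  have hρ2 : s₁⁻¹ < ρ := (le_max_right _ _).trans_lt hρ
  have hρ0 : 0 < ρ := by linarith
  have hA : Continuous (ampK β χ₁) := (contDiff_ampK hχ₁).continuous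
  have hcont : Continuous fun s => ∫ η in (-(b + 1))..(b + 1), kerK n β χ₁ ρ s y η :=
    continuous_inner_integral (continuous_kerK hχ₁.continuous ρ y) _ _
  have hzero : ∫ s in (0 : ℝ)..1, ∫ η in (-(b + 1))..(b + 1), kerK n β χ₁ ρ s y η = 0 := by
    refine (intervalIntegral.integral_congr (g := fun _ => 0) fun s hs' => ?_).trans
      intervalIntegral.integral_zero
    rw [uIcc_of_le zero_le_one] at hs'
    have : χ₁ (s / ρ) = 0 := hs _ (by
      rw [abs_of_nonneg (div_nonneg hs'.1 hρ0.le), div_lt_iff₀ hρ0]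
      have := mul_lt_mul_of_pos_left hρ2 hs0
      rw [mul_inv_cancel₀ hs0.ne'] at this
      linarith [hs'.2])
    simp [kerK, this]
  rw [duhamelK_eq hb hβ hρ0]
  have e1 := intervalIntegral.integral_add_adjacent_intervals
    (hcont.intervalIntegrable (μ := volume) 0 1) (hcont.intervalIntegrable 1 ρ)
  rw [hzero, zero_add] at e1
  have e2 := intervalIntegral.smul_integral_comp_mul_left (a := 0) (b := 1)
    (fun s => ∫ η in (-(b + 1))..(b + 1), kerK n β χ₁ ρ s y η) ρ
  rw [mul_zero, mul_one] at e2
  rw [e1, ← e2, Complex.real_smul, oscDiff, oscInt, oscInt, ← mul_sub, ← dInt_sub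
    (F := fun p => osc n 1 y ρ p * ampK β χ₁ p) (G := fun p => osc n (-1) y ρ p * ampK β χ₁ p)
    (continuous_osc.mul hA) (continuous_osc.mul hA)]
  simp only [kerK_eq hρ0.ne']
  rfl

/-- At σ = 1 the factor ⟨η⟩ cancels the one in the amplitude and 2i/(4πi) = 1/(2π), so the edge term
is Fourier inversion for β at ρy. -/
theorem bdryInt_ampK (hχ₁ : χ₁ 1 = 1) (hb : 0 < b) (hβ : ∀ ξ, b < |ξ| → fourierHat β ξ = 0)
    (ρ y : ℝ) : 2 * bdryInt n b (fun p => Complex.I * jap (p.1 * p.2) * ampK β χ₁ p) ρ y =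
      Complex.exp (Complex.I * n * ρ) * β (ρ * y) := by
  rw [schwartz_inversion, integral_eq_intervalIntegral hb (fun η hη => by rw [hβ η hη, mul_zero]),
    bdryInt, ← intervalIntegral.integral_const_mul, ← intervalIntegral.integral_const_mul,
    ← intervalIntegral.integral_const_mul]
  congr 1
  funext η
  have hpi : (Real.pi : ℂ) ≠ 0 := by exact_mod_cast Real.pi_ne_zero
  have hj : (jap η : ℂ) ≠ 0 := by exact_mod_cast (jap_pos η).ne'
  have e : Complex.exp (Complex.I * (ρ * (n + η * y) : ℝ)) = Complex.exp (Complex.I * n * ρ) *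
      Complex.exp (Complex.I * (ρ * y * η : ℝ)) := by
    rw [← Complex.exp_add]
    congr 1
    push_cast
    ring
  rw [e, ampK, hχ₁]
  simp only [one_mul]
  push_cast
  field_simp
  ring

/-- The substitution s = 1+(ρ−1)t moves the variable endpoint into a smooth integrand on fixed
intervals, for every ρ > 0, including ρ ≤ 1. -/
theorem contDiffOn_duhamelK (hχ₁ : ContDiff ℝ ∞ χ₁) (hb : 0 < b)
    (hβ : ∀ ξ, b < |ξ| → fourierHat β ξ = 0) :
    ContDiffOn ℝ ∞ (fun q : ℝ × ℝ => duhamelK n β χ₁ q.1 q.2) (Ioi 0 ×ˢ univ) := by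
  set S : Set (((ℝ × ℝ) × ℝ) × ℝ) := ((Ioi 0 ×ˢ univ) ×ˢ univ) ×ˢ univ with hS
  have hO : IsOpen (Ioi (0 : ℝ) ×ˢ (univ : Set ℝ)) := isOpen_Ioi.prod isOpen_univ
  have hs : ContDiff ℝ ∞ fun x : ((ℝ × ℝ) × ℝ) × ℝ => 1 + (x.1.1.1 - 1) * x.1.2 := by fun_prop
  have hd : ContDiffOn ℝ ∞ (fun x : ((ℝ × ℝ) × ℝ) × ℝ => (1 + (x.1.1.1 - 1) * x.1.2) / x.1.1.1) S :=
    hs.contDiffOn.div (by fun_prop) fun x hx => (show (0 : ℝ) < x.1.1.1 from hx.1.1.1).ne'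
  have hp : ContDiffOn ℝ ∞ (fun x : ((ℝ × ℝ) × ℝ) × ℝ =>
      unitPhase ((1 + (x.1.1.1 - 1) * x.1.2) / x.1.1.1, x.2)) S :=
    contDiff_unitPhase.comp_contDiffOn (hd.prodMk contDiffOn_snd)
  have hr : ContDiffOn ℝ ∞ (fun x : ((ℝ × ℝ) × ℝ) × ℝ => Real.sin (x.1.1.1 *
      unitPhase ((1 + (x.1.1.1 - 1) * x.1.2) / x.1.1.1, x.2)) / jap x.2) S := by
    refine ContDiffOn.div (Real.contDiff_sin.comp_contDiffOn (ContDiffOn.mul (by fun_prop) hp))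
      (contDiff_jap.comp contDiff_snd).contDiffOn fun x _ => (jap_pos _).ne'
  have hc : ContDiffOn ℝ ∞ (fun x : ((ℝ × ℝ) × ℝ) × ℝ =>
      χ₁ ((1 + (x.1.1.1 - 1) * x.1.2) / x.1.1.1)) S := hχ₁.comp_contDiffOn hd
  have hofR : ∀ {f : ((ℝ × ℝ) × ℝ) × ℝ → ℝ}, ContDiffOn ℝ ∞ f S →
      ContDiffOn ℝ ∞ (fun x => (f x : ℂ)) S := fun hf => Complex.ofRealCLM.contDiff.comp_contDiffOn hf
  have hexp : ∀ {f : ((ℝ × ℝ) × ℝ) × ℝ → ℝ}, ContDiffOn ℝ ∞ f S →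
      ContDiffOn ℝ ∞ (fun x => Complex.exp (Complex.I * (f x : ℂ))) S := fun hf =>
    (contDiffOn_const.mul (hofR hf)).cexp
  have hk : ContDiffOn ℝ ∞ (fun x : ((ℝ × ℝ) × ℝ) × ℝ =>
      kerK n β χ₁ x.1.1.1 (1 + (x.1.1.1 - 1) * x.1.2) x.1.1.2 x.2) S := by
    refine ContDiffOn.mul (ContDiffOn.mul (hexp (by fun_prop)) (contDiffOn_const.mul
      (ContDiffOn.mul (ContDiffOn.mul (hofR hr) (hexp (by fun_prop))) ?_))) (hofR hc)
    exact ((contDiff_fourierHat β).comp contDiff_snd).contDiffOn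
  have h1 := contDiffOn_intervalIntegral_param (hO.prod isOpen_univ) hk
    (show -(b + 1) < b + 1 by linarith)
  have h2 := contDiffOn_intervalIntegral_param hO h1 (zero_lt_one (α := ℝ))
  have h3 : ContDiffOn ℝ ∞ (fun q : ℝ × ℝ => ((q.1 - 1 : ℝ) : ℂ)) (Ioi 0 ×ˢ univ) :=
    (contDiff_ofReal_comp (by fun_prop)).contDiffOn
  refine (h3.mul h2).congr fun q hq => ?_
  have := intervalIntegral.smul_integral_comp_add_mul (a := 0) (b := 1)
    (fun s => ∫ η in (-(b + 1))..(b + 1), kerK n β χ₁ q.1 s q.2 η) (q.1 - 1) 1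
  rw [mul_zero, mul_one, add_zero, add_sub_cancel, Complex.real_smul] at this
  rw [duhamelK_eq hb hβ hq.1, ← this]

end Kernel

/-! ### Littlewood–Paley multipliers and the weighted norm. -/

section Multiplier

/-- The `L¹` norm of the Fourier transform of a real symbol. -/
def symbolNorm (m : ℝ → ℝ) : ℝ := ∫ x, ‖fourierHat (fun ξ => (m ξ : ℂ)) x‖

theorem symbolNorm_nonneg (m : ℝ → ℝ) : 0 ≤ symbolNorm m := integral_nonneg fun _ => norm_nonneg _

theorem integrable_fourierHat (f : 𝓢(ℝ, ℂ)) : Integrable (fourierHat f) := by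
  have h : fourierHat f = fun ξ => FourierTransform.fourier f (ξ / (2 * Real.pi)) := by
    funext ξ
    rw [fourierHat_eq_fourier, SchwartzMap.fourier_coe]
  rw [h]
  exact (FourierTransform.fourier f).integrable.comp_div (by positivity)

theorem integrable_fourierHat_symbol {m : ℝ → ℝ} (hm : ContDiff ℝ ∞ m) (hc : HasCompactSupport m) :
    Integrable (fourierHat fun ξ => (m ξ : ℂ)) :=
  integrable_fourierHat ((hc.comp_left (g := fun x : ℝ => (x : ℂ)) Complex.ofReal_zero).toSchwartzMap
    (contDiff_ofReal_comp hm))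

theorem fourierHat_dilate (m : ℝ → ℝ) {a : ℝ} (ha : 0 < a) (x : ℝ) :
    fourierHat (fun ξ => (m (ξ / a) : ℂ)) x = a * fourierHat (fun ξ => (m ξ : ℂ)) (a * x) := by
  have := fourierHat_comp_mul (fun ξ => (m ξ : ℂ)) (inv_pos.2 ha) x
  simp only [inv_mul_eq_div, Complex.ofReal_inv, inv_inv, div_inv_eq_mul] at this
  rw [this, mul_comm x a]

theorem integrable_fourierHat_dilate {m : ℝ → ℝ} (h : Integrable (fourierHat fun ξ => (m ξ : ℂ)))
    {a : ℝ} (ha : 0 < a) : Integrable (fourierHat fun ξ => (m (ξ / a) : ℂ)) := by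
  have e : (fourierHat fun ξ => (m (ξ / a) : ℂ)) = fun x =>
    (a : ℂ) * fourierHat (fun ξ => (m ξ : ℂ)) (a * x) := funext fun x => fourierHat_dilate m ha x
  rw [e]
  exact (h.comp_mul_left' ha.ne').const_mul _

/-- Scale invariance of the L¹ norm of the kernel; this makes all multiplier bounds uniform over
dyadic frequencies. -/
theorem symbolNorm_dilate (m : ℝ → ℝ) {a : ℝ} (ha : 0 < a) :
    symbolNorm (fun ξ => m (ξ / a)) = symbolNorm m := by
  have := Measure.integral_comp_mul_left (fun x : ℝ => ‖fourierHat (fun ξ => (m ξ : ℂ)) x‖) a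
  rw [abs_of_pos (inv_pos.2 ha)] at this
  simp only [symbolNorm, fourierHat_dilate m ha, norm_mul, Complex.norm_real, Real.norm_eq_abs,
    abs_of_pos ha, integral_const_mul, this, smul_eq_mul]
  field_simp

theorem fourierMul_eq_convolution {m : ℝ → ℝ} (hm : Continuous m) (hc : HasCompactSupport m)
    (v : 𝓢(ℝ, ℂ)) (y : ℝ) : fourierMul m v y = (1 / (2 * (Real.pi : ℂ))) *
      ∫ z, fourierHat (fun ξ => (m ξ : ℂ)) (z - y) * v z := by
  rw [fourierMul]
  congr 1
  have hmi : Integrable fun ξ => (m ξ : ℂ) :=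
    (hm.integrable_of_hasCompactSupport hc).ofReal
  have hint : Integrable (Function.uncurry fun ξ z : ℝ => (m ξ : ℂ) * v z *
      Complex.exp (((y - z) * ξ : ℝ) * Complex.I)) (volume.prod volume) := by
    refine (hmi.mul_prod v.integrable).mul_bdd (c := 1) (Continuous.aestronglyMeasurable ?_) ?_
    · fun_prop
    · exact Eventually.of_forall fun q => (Complex.norm_exp_ofReal_mul_I _).le
  calc ∫ ξ, (m ξ : ℂ) * Complex.exp (Complex.I * y * ξ) * fourierHat v ξ
      = ∫ ξ, ∫ z, (m ξ : ℂ) * v z * Complex.exp (((y - z) * ξ : ℝ) * Complex.I) := by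
        congr 1
        funext ξ
        rw [fourierHat, ← integral_const_mul]
        congr 1
        funext z
        rw [show (((y - z) * ξ : ℝ) * Complex.I : ℂ) = Complex.I * y * ξ + -(Complex.I * ξ * z) by
          push_cast; ring, Complex.exp_add]
        ring
    _ = ∫ z, ∫ ξ, (m ξ : ℂ) * v z * Complex.exp (((y - z) * ξ : ℝ) * Complex.I) :=
        integral_integral_swap hint
    _ = _ := by
        congr 1
        funext z
        rw [fourierHat, ← integral_mul_const]
        congr 1
        funext ξ
        rw [show (((y - z) * ξ : ℝ) * Complex.I : ℂ) = -(Complex.I * (z - y : ℝ) * ξ) by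
          push_cast; ring]
        ring

theorem norm_fourierMul_le {m : ℝ → ℝ} (hm : Continuous m) (hc : HasCompactSupport m)
    (hi : Integrable (fourierHat fun ξ => (m ξ : ℂ))) (v : 𝓢(ℝ, ℂ)) {V : ℝ}
    (hv : ∀ z, ‖v z‖ ≤ V) (y : ℝ) : ‖fourierMul m v y‖ ≤ symbolNorm m * V := by
  have hV : 0 ≤ V := (norm_nonneg _).trans (hv 0)
  have h1 : ‖∫ z, fourierHat (fun ξ => (m ξ : ℂ)) (z - y) * v z‖ ≤ symbolNorm m * V := by
    refine (norm_integral_le_of_norm_le ((hi.comp_sub_right y).norm.mul_const V)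
      (Eventually.of_forall fun z => ?_)).trans_eq ?_
    · rw [norm_mul]
      exact mul_le_mul_of_nonneg_left (hv z) (norm_nonneg _)
    · rw [integral_mul_const, symbolNorm,
        integral_sub_right_eq_self (fun z => ‖fourierHat (fun ξ => (m ξ : ℂ)) z‖) y]
  rw [fourierMul_eq_convolution hm hc, norm_mul]
  refine (mul_le_of_le_one_left (norm_nonneg _) ?_).trans h1
  rw [norm_div, norm_mul, norm_one, Complex.norm_real, Real.norm_eq_abs, abs_of_pos Real.pi_pos,
    Complex.norm_ofNat, div_le_one (by positivity)]
  linarith [Real.pi_gt_three]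

theorem norm_fourierMul_dilate_le {m : ℝ → ℝ} (hm : ContDiff ℝ ∞ m) (hc : HasCompactSupport m)
    (v : 𝓢(ℝ, ℂ)) {V : ℝ} (hv : ∀ z, ‖v z‖ ≤ V) {a : ℝ} (ha : 0 < a) (y : ℝ) :
    ‖fourierMul (fun ξ => m (ξ / a)) v y‖ ≤ symbolNorm m * V := by
  rw [← symbolNorm_dilate m ha]
  refine norm_fourierMul_le (hm.continuous.comp (continuous_id.div_const a)) ?_
    (integrable_fourierHat_dilate (integrable_fourierHat_symbol hm hc) ha) v hv y
  have := hc.comp_homeomorph (Homeomorph.mulRight₀ a⁻¹ (inv_pos.2 ha).ne')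
  simpa [Function.comp_def, div_eq_mul_inv] using this

theorem fourierHat_deriv (v : 𝓢(ℝ, ℂ)) (ξ : ℝ) :
    fourierHat (SchwartzMap.derivCLM ℂ ℂ v) ξ = Complex.I * ξ * fourierHat v ξ := by
  have hd : ⇑(SchwartzMap.derivCLM ℂ ℂ v) = deriv v := rfl
  have := congrFun (Real.fourier_deriv v.integrable v.differentiable
    (SchwartzMap.derivCLM ℂ ℂ v).integrable) (ξ / (2 * Real.pi))
  rw [fourierHat_eq_fourier, hd, this, fourierHat_eq_fourier, smul_eq_mul]
  have hpi : (Real.pi : ℂ) ≠ 0 := by exact_mod_cast Real.pi_ne_zero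
  push_cast
  field_simp

/-- The symbol `p₀(ξ)/ξ`. -/
def LittlewoodPaley.q₀ (p : LittlewoodPaley) (ξ : ℝ) : ℝ := p.p₀ ξ / ξ

variable (p : LittlewoodPaley)

theorem LittlewoodPaley.contDiff_q₀ : ContDiff ℝ ∞ p.q₀ := by
  refine contDiff_iff_contDiffAt.2 fun ξ => ?_
  rcases eq_or_ne ξ 0 with rfl | h
  · refine (contDiffAt_const (c := (0 : ℝ))).congr_of_eventuallyEq ?_
    filter_upwards [p.p₀_annular] with x hx
    simp [q₀, hx]
  · exact p.p₀_smooth.contDiffAt.div contDiffAt_id h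

theorem LittlewoodPaley.hasCompactSupport_q₀ : HasCompactSupport p.q₀ :=
  p.p₀_compact.mul_right

theorem LittlewoodPaley.p₀_eq (ξ : ℝ) : p.p₀ ξ = p.q₀ ξ * ξ := by
  rcases eq_or_ne ξ 0 with rfl | h
  · rw [p.p₀_annular.self_of_nhds, mul_zero]
  · rw [q₀, div_mul_cancel₀ _ h]

/-- Writing p₀(ξ) = q₀(ξ)ξ trades the frequency factor for a derivative of v and gains 2^{-j}; q₀ is
smooth because p₀ vanishes near 0. -/
theorem LittlewoodPaley.norm_proj_le (v : 𝓢(ℝ, ℂ)) {V : ℝ} (hv : ∀ z, ‖deriv v z‖ ≤ V) {j : ℕ}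
    (hj : j ≠ 0) (y : ℝ) : ‖p.proj j v y‖ ≤ symbolNorm p.q₀ * V / 2 ^ j := by
  have h2 : (0 : ℝ) < 2 ^ j := by positivity
  have e : p.proj j v y = (Complex.I * (2 ^ j : ℝ))⁻¹ *
      fourierMul (fun ξ => p.q₀ (ξ / 2 ^ j)) (SchwartzMap.derivCLM ℂ ℂ v) y := by
    rw [proj, fourierMul, fourierMul, mul_left_comm, ← integral_const_mul (Complex.I * _)⁻¹]
    congr 2
    funext ξ
    rw [fourierHat_deriv, lpSymbol, if_neg hj, p.p₀_eq]
    have : (2 : ℂ) ^ j ≠ 0 := pow_ne_zero _ two_ne_zero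
    push_cast
    field_simp
  rw [e, norm_mul, norm_inv, norm_mul, Complex.norm_I, one_mul, Complex.norm_real,
    Real.norm_of_nonneg h2.le, div_eq_inv_mul]
  exact mul_le_mul_of_nonneg_left (norm_fourierMul_dilate_le p.contDiff_q₀ p.hasCompactSupport_q₀
    _ hv h2 y) (by positivity)

/-- Compare the partition of unity at ξ and at ξ/2: the tail at ξ from index 2 on is the tail at ξ/2
from index 1 on. Consequently partial sums telescope to a single dilate of `pLow`, and P_{≤ρ} is
bounded on L^∞ uniformly in ρ. -/
theorem LittlewoodPaley.pLow_add (ξ : ℝ) : p.pLow ξ + p.p₀ (ξ / 2) = p.pLow (ξ / 2) := by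
  have h1 := (hasSum_nat_add_iff' 2).2 (p.partition ξ)
  have h2 := (hasSum_nat_add_iff' 1).2 (p.partition (ξ / 2))
  have e : (fun n => lpSymbol p.pLow p.p₀ (n + 2) ξ) =
      fun n => lpSymbol p.pLow p.p₀ (n + 1) (ξ / 2) := by
    funext n
    simp only [lpSymbol, Nat.add_eq_zero_iff, OfNat.ofNat_ne_zero, one_ne_zero, and_false, if_false]
    congr 1
    rw [pow_succ 2 (n + 1)]
    field_simp
  rw [e] at h1
  have := h1.unique h2
  simp only [Finset.sum_range_succ, Finset.sum_range_zero, lpSymbol] at this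
  norm_num at this
  linarith

theorem LittlewoodPaley.sum_lpSymbol (J : ℕ) (ξ : ℝ) :
    ∑ j ∈ Finset.range (J + 1), lpSymbol p.pLow p.p₀ j ξ = p.pLow (ξ / 2 ^ J) := by
  induction J with
  | zero => simp [lpSymbol]
  | succ J ih =>
    rw [Finset.sum_range_succ, ih, lpSymbol, if_neg (Nat.succ_ne_zero J), pow_succ, ← div_div,
      p.pLow_add]

theorem lpSymbol_zero (f g : ℝ → ℝ) : lpSymbol f g 0 = f := funext fun _ => if_pos rfl

theorem lpSymbol_of_ne_zero (f g : ℝ → ℝ) {j : ℕ} (hj : j ≠ 0) :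
    lpSymbol f g j = fun ξ => g (ξ / 2 ^ j) := funext fun _ => if_neg hj

theorem LittlewoodPaley.continuous_lpSymbol (j : ℕ) : Continuous (lpSymbol p.pLow p.p₀ j) := by
  have h1 := p.pLow_smooth.continuous
  have h2 := p.p₀_smooth.continuous
  rcases eq_or_ne j 0 with rfl | h
  · rwa [lpSymbol_zero]
  · rw [lpSymbol_of_ne_zero _ _ h]
    fun_prop

theorem LittlewoodPaley.hasCompactSupport_lpSymbol (j : ℕ) :
    HasCompactSupport (lpSymbol p.pLow p.p₀ j) := by
  rcases eq_or_ne j 0 with rfl | h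
  · rw [lpSymbol_zero]
    exact p.pLow_compact
  · have := p.p₀_compact.comp_homeomorph (Homeomorph.mulRight₀ ((2 : ℝ) ^ j)⁻¹ (by positivity))
    simpa [Function.comp_def, div_eq_mul_inv, lpSymbol_of_ne_zero _ _ h] using this

theorem fourierMul_sum {ι : Type*} (s : Finset ι) {m : ι → ℝ → ℝ} (hm : ∀ i, Continuous (m i))
    (hc : ∀ i, HasCompactSupport (m i)) (v : 𝓢(ℝ, ℂ)) (y : ℝ) :
    ∑ i ∈ s, fourierMul (m i) v y = fourierMul (fun ξ => ∑ i ∈ s, m i ξ) v y := by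
  simp only [fourierMul]
  rw [← Finset.mul_sum, ← integral_finsetSum]
  · congr 2
    funext ξ
    rw [Complex.ofReal_sum, Finset.sum_mul, Finset.sum_mul]
  · intro i _
    have h1 := hm i
    have h2 := (contDiff_fourierHat v).continuous
    refine Continuous.integrable_of_hasCompactSupport (by fun_prop) ?_
    exact (((hc i).comp_left (g := fun x : ℝ => (x : ℂ)) Complex.ofReal_zero).mul_right).mul_right

theorem LittlewoodPaley.exists_projLe_eq {ρ : ℝ} (hρ : 1 ≤ ρ) (v : 𝓢(ℝ, ℂ)) :
    ∃ J : ℕ, p.projLe ρ v = fourierMul (fun ξ => p.pLow (ξ / 2 ^ J)) v := by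
  have h1 : ⌊ρ⌋₊ ≠ 0 := (Nat.floor_pos.2 hρ).ne'
  refine ⟨Nat.log 2 ⌊ρ⌋₊, funext fun y => ?_⟩
  have e : (Finset.range (⌊ρ⌋₊ + 1)).filter (fun j : ℕ => (2 : ℝ) ^ j ≤ ρ) =
      Finset.range (Nat.log 2 ⌊ρ⌋₊ + 1) := by
    ext j
    have h2 : (2 : ℝ) ^ j ≤ ρ ↔ j ≤ Nat.log 2 ⌊ρ⌋₊ := by
      rw [Nat.le_log_iff_pow_le one_lt_two h1, Nat.le_floor_iff (by linarith)]
      push_cast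
      rfl
    have h3 := Nat.log_le_self 2 ⌊ρ⌋₊
    rw [Finset.mem_filter, h2, Finset.mem_range, Finset.mem_range]
    omega
  rw [projLe, e]
  simp only [proj]
  rw [fourierMul_sum _ p.continuous_lpSymbol p.hasCompactSupport_lpSymbol]
  simp only [p.sum_lpSymbol]

theorem log_div_le {x : ℝ} (hx : 0 < x) : Real.log x / x ≤ 2 * (√x)⁻¹ := by
  have h := Real.sqrt_pos.2 hx
  have h1 : Real.log x = 2 * Real.log √x := by rw [Real.log_sqrt hx.le]; ring
  have h2 := Real.log_le_sub_one_of_pos h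
  rw [div_le_iff₀ hx]
  calc Real.log x ≤ 2 * √x := by linarith
    _ = 2 * (√x)⁻¹ * (√x * √x) := by field_simp
    _ = _ := by rw [Real.mul_self_sqrt hx.le]

/-- A geometric bound for the logarithmically weighted dyadic sum, uniform in the base scale. -/
theorem tsum_dyadic_le {ρ : ℝ} (hρ : 0 < ρ) (f : ℕ → ℝ≥0∞) {B : ℝ} (hB : 0 ≤ B)
    (hf : ∀ j, ρ ≤ 2 ^ j → f j ≤ ENNReal.ofReal (Real.log (2 ^ j / ρ) * (B / (2 ^ j / ρ)))) :
    ∑' j : {j : ℕ // ρ ≤ (2 : ℝ) ^ j}, f j ≤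
      ENNReal.ofReal (B * ∑' i : ℕ, 2 * ((√2)⁻¹) ^ i) := by
  classical
  have hex : ∃ j : ℕ, ρ ≤ (2 : ℝ) ^ j := by
    obtain ⟨j, hj⟩ := pow_unbounded_of_one_lt ρ (one_lt_two (α := ℝ))
    exact ⟨j, hj.le⟩
  -- The first dyadic scale above ρ. The ratio 2^j/ρ is at least 2^{j−J}, and ln x / x ≤ 2/√x leaves
  -- a geometric series of ratio 1/√2.
  set J := Nat.find hex
  have hJ : ρ ≤ 2 ^ J := Nat.find_spec hex
  have hs2 : (√2)⁻¹ < (1 : ℝ) := inv_lt_one_of_one_lt₀ (by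
    rw [Real.lt_sqrt (by norm_num)]; norm_num)
  have hsum : Summable fun i : ℕ => B * (2 * ((√2)⁻¹ : ℝ) ^ i) :=
    ((summable_geometric_of_lt_one (by positivity) hs2).mul_left 2).mul_left B
  have hinj : Function.Injective fun j : {j : ℕ // ρ ≤ (2 : ℝ) ^ j} => (j : ℕ) - J := by
    intro i j h
    have h1 : J ≤ i := Nat.find_min' hex i.2
    have h2 : J ≤ j := Nat.find_min' hex j.2
    exact Subtype.ext (by simp only at h; omega)
  calc ∑' j : {j : ℕ // ρ ≤ (2 : ℝ) ^ j}, f j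
      ≤ ∑' j : {j : ℕ // ρ ≤ (2 : ℝ) ^ j}, ENNReal.ofReal (B * (2 * ((√2)⁻¹) ^ ((j : ℕ) - J))) := by
        refine ENNReal.tsum_le_tsum fun j => (hf j j.2).trans (ENNReal.ofReal_le_ofReal ?_)
        have h1 : J ≤ j := Nat.find_min' hex j.2
        have hx : 0 < (2 : ℝ) ^ (j : ℕ) / ρ := by positivity
        have h2 : (2 : ℝ) ^ ((j : ℕ) - J) ≤ 2 ^ (j : ℕ) / ρ := by
          rw [le_div_iff₀ hρ]
          calc (2 : ℝ) ^ ((j : ℕ) - J) * ρ ≤ 2 ^ ((j : ℕ) - J) * 2 ^ J := by gcongr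
            _ = 2 ^ (j : ℕ) := by rw [← pow_add, Nat.sub_add_cancel h1]
        have h3 : (√2) ^ ((j : ℕ) - J) ≤ √(2 ^ (j : ℕ) / ρ) := by
          refine Real.le_sqrt_of_sq_le ?_
          rw [← pow_mul, mul_comm, pow_mul, Real.sq_sqrt (by norm_num)]
          exact h2
        calc Real.log (2 ^ (j : ℕ) / ρ) * (B / (2 ^ (j : ℕ) / ρ))
            = B * (Real.log (2 ^ (j : ℕ) / ρ) / (2 ^ (j : ℕ) / ρ)) := by ring
          _ ≤ B * (2 * (√(2 ^ (j : ℕ) / ρ))⁻¹) := mul_le_mul_of_nonneg_left (log_div_le hx) hB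
          _ ≤ B * (2 * ((√2)⁻¹) ^ ((j : ℕ) - J)) := by
            rw [inv_pow]
            gcongr
    _ ≤ ∑' i : ℕ, ENNReal.ofReal (B * (2 * ((√2)⁻¹) ^ i)) :=
        ENNReal.tsum_comp_le_tsum_of_injective hinj
          fun i => ENNReal.ofReal (B * (2 * ((√2)⁻¹) ^ i))
    _ = _ := by
        rw [← ENNReal.ofReal_tsum_of_nonneg (fun i => by positivity) hsum, tsum_mul_left]

theorem LittlewoodPaley.exists_bNorm_le (V : ℝ) : ∃ C : ℝ≥0, ∀ ρ : ℝ, 1 ≤ ρ → ∀ v : ℝ → ℂ,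
    ContDiff ℝ ∞ v → HasCompactSupport v → (∀ y, ‖v y‖ ≤ V) → (∀ y, ‖deriv v y‖ ≤ ρ * V) →
      p.bNorm ρ v ≤ C := by
  refine ⟨(symbolNorm p.pLow * V).toNNReal +
    (symbolNorm p.q₀ * V * ∑' i : ℕ, 2 * ((√2)⁻¹) ^ i).toNNReal, fun ρ hρ v hv hvc h0 h1 => ?_⟩
  have hV : 0 ≤ V := (norm_nonneg _).trans (h0 0)
  have hρ0 : 0 < ρ := by linarith
  set w : 𝓢(ℝ, ℂ) := hvc.toSchwartzMap hv with hw
  have hwv : v = ⇑w := rfl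
  rw [hwv] at h0 h1 ⊢
  rw [ENNReal.coe_add]
  refine add_le_add ?_ ?_
  · obtain ⟨J, hJ⟩ := p.exists_projLe_eq hρ w
    rw [eLpNorm_exponent_top, hJ]
    exact eLpNormEssSup_le_of_ae_bound (Eventually.of_forall fun y =>
      norm_fourierMul_dilate_le p.pLow_smooth p.pLow_compact w h0 (by positivity) y)
  · refine tsum_dyadic_le hρ0 (fun j => ENNReal.ofReal (Real.log ((2 : ℝ) ^ j / ρ)) *
      eLpNorm (p.proj j w) ∞ volume) (mul_nonneg (symbolNorm_nonneg _) hV) fun j hj => ?_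
    -- The low-frequency block has no gain from a derivative, but it enters the sum only when ρ = 1,
    -- where its weight ln 1 is zero.
    rcases eq_or_ne j 0 with rfl | hj0
    · have : ρ = 1 := le_antisymm (by simpa using hj) hρ
      simp [this]
    · have hlog : 0 ≤ Real.log ((2 : ℝ) ^ j / ρ) :=
        Real.log_nonneg ((one_le_div hρ0).2 hj)
      rw [ENNReal.ofReal_mul hlog]
      refine mul_le_mul_right ?_ _
      rw [eLpNorm_exponent_top]
      refine eLpNormEssSup_le_of_ae_bound (Eventually.of_forall fun y => ?_)
      refine (p.norm_proj_le w h1 hj0 y).trans_eq ?_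
      field_simp

end Multiplier

/-! ### Smoothness and supports under iterated derivatives; passage to all ρ ≥ 1. -/

section Assembly

/-- Smoothness on the half plane `ρ > 0`. -/
def SmoothOnHalfPlane (F : ℝ → ℝ → ℂ) : Prop :=
  ContDiffOn ℝ ∞ (fun q : ℝ × ℝ => F q.1 q.2) (Ioi 0 ×ˢ univ)

theorem isOpen_halfPlane : IsOpen (Ioi (0 : ℝ) ×ˢ (univ : Set ℝ)) := isOpen_Ioi.prod isOpen_univ

namespace SmoothOnHalfPlane

variable {F G : ℝ → ℝ → ℂ}

theorem hasFDerivAt (hF : SmoothOnHalfPlane F) {ρ : ℝ} (hρ : 0 < ρ) (y : ℝ) :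
    HasFDerivAt (fun q : ℝ × ℝ => F q.1 q.2) (fderiv ℝ (fun q : ℝ × ℝ => F q.1 q.2) (ρ, y)) (ρ, y) :=
  ((hF.contDiffAt (isOpen_halfPlane.mem_nhds (mk_mem_prod (mem_Ioi.2 hρ) (mem_univ y)))).differentiableAt
    (by simp)).hasFDerivAt

theorem contDiffOn_fderiv (hF : SmoothOnHalfPlane F) (v : ℝ × ℝ) :
    ContDiffOn ℝ ∞ (fun q => fderiv ℝ (fun q : ℝ × ℝ => F q.1 q.2) q v) (Ioi 0 ×ˢ univ) :=
  (hF.fderiv_of_isOpen isOpen_halfPlane (by simp)).clm_apply contDiffOn_const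

theorem dRho (hF : SmoothOnHalfPlane F) : SmoothOnHalfPlane (dRho F) :=
  (hF.contDiffOn_fderiv (1, 0)).congr fun q hq =>
    (HasFDerivAt.comp_hasDerivAt (f := fun r => (r, q.2)) q.1 (hF.hasFDerivAt hq.1 q.2)
      ((hasDerivAt_id q.1).prodMk (hasDerivAt_const q.1 q.2))).deriv

theorem deriv_snd (hF : SmoothOnHalfPlane F) : SmoothOnHalfPlane fun ρ y => deriv (fun z => F ρ z) y :=
  (hF.contDiffOn_fderiv (0, 1)).congr fun q hq =>
    (HasFDerivAt.comp_hasDerivAt (f := fun z => (q.1, z)) q.2 (hF.hasFDerivAt hq.1 q.2)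
      ((hasDerivAt_const q.2 q.1).prodMk (hasDerivAt_id q.2))).deriv

theorem dY (hF : SmoothOnHalfPlane F) : SmoothOnHalfPlane (dY F) := by
  have h : ContDiffOn ℝ ∞ (fun q : ℝ × ℝ => 1 / (Complex.I * q.1)) (Ioi 0 ×ˢ univ) := by
    simp only [one_div]
    refine ContDiffOn.inv (contDiffOn_const.mul
      (contDiff_ofReal_comp contDiff_fst).contDiffOn) fun q hq => ?_
    have : (0 : ℝ) < q.1 := hq.1
    exact mul_ne_zero Complex.I_ne_zero (by exact_mod_cast this.ne')
  exact h.mul hF.deriv_snd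

theorem cutoff (hF : SmoothOnHalfPlane F) {χ : ℝ → ℝ} (hχ : ContDiff ℝ ∞ χ) :
    SmoothOnHalfPlane (cutoff χ F) :=
  ((contDiff_ofReal_comp (hχ.comp contDiff_snd)).contDiffOn).mul hF

theorem iterate (hF : SmoothOnHalfPlane F) (k l : ℕ) :
    SmoothOnHalfPlane (HypKG.dRho^[k] (HypKG.dY^[l] F)) := by
  induction k with
  | zero =>
    induction l with
    | zero => exact hF
    | succ l ih => rw [Function.iterate_succ_apply']; exact ih.dY
  | succ k ih => rw [Function.iterate_succ_apply']; exact ih.dRho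

theorem contDiff_snd (hF : SmoothOnHalfPlane F) {ρ : ℝ} (hρ : 0 < ρ) : ContDiff ℝ ∞ (F ρ) := by
  have h : ContDiffOn ℝ ∞ (fun y : ℝ => F ρ y) univ :=
    ContDiffOn.comp (g := fun q : ℝ × ℝ => F q.1 q.2) (f := fun y : ℝ => (ρ, y)) hF
      (by fun_prop) fun y _ => ⟨hρ, mem_univ _⟩
  exact contDiffOn_univ.1 h

end SmoothOnHalfPlane

theorem boxPlusOne_eq_dRho_dY (F : ℝ → ℝ → ℂ) (ρ y : ℝ) :
    boxPlusOne F ρ y = dRho (dRho F) ρ y + dY (dY F) ρ y + F ρ y := by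
  have h : deriv (fun z => dY F ρ z) y =
      1 / (Complex.I * ρ) * deriv (deriv fun z => F ρ z) y := deriv_const_mul_field _
  have e : 1 / (Complex.I * ρ) * (1 / (Complex.I * ρ)) = -(1 / (ρ : ℂ) ^ 2) := by
    rw [div_mul_div_comm, mul_mul_mul_comm, Complex.I_mul_I, neg_one_mul, one_mul, sq, div_neg]
  rw [boxPlusOne, dY, h, ← mul_assoc, e]
  change deriv (deriv fun r => F r y) ρ - _ + _ = deriv (deriv fun r => F r y) ρ + _ + _
  ring

theorem SmoothOnHalfPlane.boxPlusOne {F : ℝ → ℝ → ℂ} (hF : SmoothOnHalfPlane F) :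
    SmoothOnHalfPlane (boxPlusOne F) :=
  ((hF.dRho.dRho.add hF.dY.dY).add hF).congr fun q _ => boxPlusOne_eq_dRho_dY F q.1 q.2

theorem smoothOnHalfPlane_errorK {n : ℕ} {β : 𝓢(ℝ, ℂ)} {χ₁ : ℝ → ℝ}
    (h : SmoothOnHalfPlane (duhamelK n β χ₁)) : SmoothOnHalfPlane (errorK n β χ₁) := by
  refine ContDiffOn.sub h.boxPlusOne (ContDiff.contDiffOn (ContDiff.mul ?_ ?_))
  · exact (contDiff_const.mul (contDiff_ofReal_comp contDiff_fst)).cexp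
  · exact β.smooth'.comp (contDiff_fst.mul contDiff_snd)

/-- Functions vanishing for `|y| > Y`. -/
def VanishesOutside (Y : ℝ) (F : ℝ → ℝ → ℂ) : Prop := ∀ ρ y, Y < |y| → F ρ y = 0

namespace VanishesOutside

variable {F : ℝ → ℝ → ℂ} {Y : ℝ}

theorem dRho (hF : VanishesOutside Y F) : VanishesOutside Y (dRho F) := fun ρ y hy => by
  simp [HypKG.dRho, hF _ _ hy]

theorem deriv_snd (hF : VanishesOutside Y F) :
    VanishesOutside Y fun ρ y => deriv (fun z => F ρ z) y := fun ρ y hy => by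
  have h : (fun z => F ρ z) =ᶠ[𝓝 y] fun _ => 0 := by
    filter_upwards [(isOpen_lt continuous_const continuous_abs).mem_nhds hy] with z hz
    exact hF ρ z hz
  simp [h.deriv_eq]

theorem dY (hF : VanishesOutside Y F) : VanishesOutside Y (dY F) := fun ρ y hy => by
  exact mul_eq_zero_of_right _ (hF.deriv_snd ρ y hy)

theorem iterate (hF : VanishesOutside Y F) (k l : ℕ) :
    VanishesOutside Y (HypKG.dRho^[k] (HypKG.dY^[l] F)) := by
  induction k with
  | zero =>
    induction l with
    | zero => exact hF
    | succ l ih => rw [Function.iterate_succ_apply']; exact ih.dY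
  | succ k ih => rw [Function.iterate_succ_apply']; exact ih.dRho

theorem hasCompactSupport (hF : VanishesOutside Y F) (ρ : ℝ) : HasCompactSupport (F ρ) := by
  refine HasCompactSupport.intro (isCompact_Icc (a := -Y) (b := Y)) fun y hy => hF ρ y ?_
  by_contra h
  exact hy (abs_le.1 (not_lt.1 h))

end VanishesOutside

theorem exists_vanishesOutside_cutoff {χ : ℝ → ℝ} (hχ : HasCompactSupport χ) :
    ∃ Y : ℝ, 0 < Y ∧ ∀ F, VanishesOutside Y (cutoff χ F) := by
  obtain ⟨Y, hY0, hY⟩ := hχ.isBounded.exists_pos_norm_le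
  refine ⟨Y, hY0, fun F ρ y hy => ?_⟩
  have : χ y = 0 := by
    by_contra h
    exact absurd (hY y (subset_tsupport χ h)) (not_le.2 hy)
  simp [cutoff, this]

/-- Oscillatory estimates cover ρ > R; on [1, R] × [−Y, Y] continuity and compactness suffice, with
R^m compensating for the weight ρ^{-m}. -/
theorem OscClass.exists_bound {n b s₁ c R Y : ℝ} {m : ℕ} {F : ℝ → ℝ → ℂ} (hn : n = 1 ∨ n = 3)
    (hs : 0 < s₁) (hc : 0 < c) (hb : 0 < b) (hR : 1 ≤ R) (hY : 0 < Y)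
    (hF : OscClass n b s₁ c R m F) (hS : SmoothOnHalfPlane F) (hV : VanishesOutside Y F) :
    ∃ C, 0 ≤ C ∧ ∀ ρ, 1 ≤ ρ → ∀ y, ‖F ρ y‖ ≤ (ρ⁻¹) ^ m * C := by
  obtain ⟨C, hC0, hC⟩ := hF.norm_le hn hs hc hb hR hY
  obtain ⟨D, hD⟩ := (isCompact_Icc.prod isCompact_Icc : IsCompact (Icc 1 R ×ˢ Icc (-Y) Y)
    ).exists_bound_of_continuousOn (hS.continuousOn.mono fun q hq =>
      ⟨show (0 : ℝ) < q.1 from zero_lt_one.trans_le hq.1.1, mem_univ _⟩)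
  refine ⟨C + R ^ m * |D|, by positivity, fun ρ hρ y => ?_⟩
  have hρ0 : 0 < ρ := by linarith
  have hD0 : 0 ≤ R ^ m * |D| := by positivity
  by_cases hy : |y| ≤ Y
  · rcases lt_or_ge R ρ with h | h
    · exact (hC ρ y h hy).trans (mul_le_mul_of_nonneg_left (by linarith) (by positivity))
    · have h1 : 1 ≤ (ρ⁻¹) ^ m * R ^ m := by
        rw [← mul_pow]
        refine one_le_pow₀ ?_
        rwa [inv_mul_eq_div, one_le_div hρ0]
      calc ‖F ρ y‖ ≤ |D| := (hD (ρ, y) ⟨⟨hρ, h⟩, abs_le.1 hy⟩).trans (le_abs_self _)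
        _ ≤ (ρ⁻¹) ^ m * R ^ m * |D| := le_mul_of_one_le_left (abs_nonneg _) h1
        _ = (ρ⁻¹) ^ m * (R ^ m * |D|) := mul_assoc _ _ _
        _ ≤ _ := mul_le_mul_of_nonneg_left (by linarith) (by positivity)
  · rw [hV ρ y (not_le.1 hy), norm_zero]
    positivity

theorem norm_deriv_snd_le_of_dY {F : ℝ → ℝ → ℂ} {ρ y V : ℝ} (hρ : 0 < ρ) (h : ‖dY F ρ y‖ ≤ V) :
    ‖deriv (F ρ) y‖ ≤ ρ * V := by
  have h1 : ‖dY F ρ y‖ = ρ⁻¹ * ‖deriv (F ρ) y‖ := by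
    rw [dY, norm_mul, norm_div, norm_mul, norm_one, Complex.norm_I, one_mul, Complex.norm_real,
      Real.norm_of_nonneg hρ.le, one_div]
  rw [h1, inv_mul_le_iff₀ hρ] at h
  exact h

theorem exists_bNorm_le_of_bound (p : LittlewoodPaley) {Y V W : ℝ} {F : ℝ → ℝ → ℂ}
    (hS : SmoothOnHalfPlane F) (hV : VanishesOutside Y F)
    (h0 : ∀ ρ, 1 ≤ ρ → ∀ y, ‖F ρ y‖ ≤ V) (h1 : ∀ ρ, 1 ≤ ρ → ∀ y, ‖dY F ρ y‖ ≤ W) :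
    ∃ C : ℝ≥0, ∀ ρ, 1 ≤ ρ → p.bNorm ρ (F ρ) ≤ C := by
  obtain ⟨C, hC⟩ := p.exists_bNorm_le (max V W)
  refine ⟨C, fun ρ hρ => ?_⟩
  have hρ0 : 0 < ρ := by linarith
  exact hC ρ hρ (F ρ) (hS.contDiff_snd hρ0) (hV.hasCompactSupport ρ)
    (fun y => (h0 ρ hρ y).trans (le_max_left _ _))
    fun y => norm_deriv_snd_le_of_dY hρ0 ((h1 ρ hρ y).trans (le_max_right _ _))

end Assembly

end HypKG

end

theorem mainTheorem7
    (β : 𝓢(ℝ, ℂ))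
    (hβ : ∃ c C : ℝ, 0 < c ∧ c < C ∧
      ∀ ξ : ℝ, |ξ| < c ∨ C < |ξ| → HypKG.fourierHat β ξ = 0)
    (χ₁ : ℝ → ℝ) (hχ₁ : ContDiff ℝ ∞ χ₁) (hχ₁_supp : HasCompactSupport χ₁)
    (hχ₁_one : ∀ ζ : ℝ, 1 / 2 < |ζ| → |ζ| < 2 → χ₁ ζ = 1)
    (hχ₁_zero : ∀ᶠ ζ in 𝓝 (0 : ℝ), χ₁ ζ = 0)
    (χ : ℝ → ℝ) (hχ : ContDiff ℝ ∞ χ) (hχ_supp : HasCompactSupport χ)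
    (n : ℕ) (hn : n = 1 ∨ n = 3) :
    ContDiffOn ℝ ∞ (fun q : ℝ × ℝ => HypKG.duhamelK n β χ₁ q.1 q.2) (Ioi 0 ×ˢ univ) ∧
    (∀ k l : ℕ, ∃ C : ℝ, ∀ ρ : ℝ, 1 ≤ ρ → ∀ y : ℝ,
      ‖HypKG.dRho^[k] (HypKG.dY^[l] (HypKG.cutoff χ (HypKG.duhamelK n β χ₁))) ρ y‖ ≤ C ∧
      ‖HypKG.dRho^[k] (HypKG.dY^[l] (HypKG.cutoff χ (HypKG.errorK n β χ₁))) ρ y‖ ≤ ρ⁻¹ * C) ∧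
    (∀ p : HypKG.LittlewoodPaley, ∃ C : ℝ≥0, ∀ ρ : ℝ, 1 ≤ ρ →
      p.bNorm ρ (HypKG.cutoff χ (HypKG.duhamelK n β χ₁) ρ) +
        p.bNorm ρ (HypKG.dY (HypKG.cutoff χ (HypKG.duhamelK n β χ₁)) ρ) +
        p.bNorm ρ (HypKG.dRho (HypKG.cutoff χ (HypKG.duhamelK n β χ₁)) ρ) ≤ (C : ℝ≥0∞)) := by
  open HypKG in
  obtain ⟨c, b, hc, hcb, hβ⟩ := hβ
  have hb : 0 < b := hc.trans hcb
  obtain ⟨s₁, hs0, hs⟩ := Metric.eventually_nhds_iff.1 hχ₁_zero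
  have hs' : ∀ ζ, |ζ| < s₁ → χ₁ ζ = 0 := fun ζ hζ => hs (by simpa using hζ)
  have hone : χ₁ 1 = 1 := hχ₁_one 1 (by norm_num) (by norm_num)
  have hβb : ∀ ξ, b < |ξ| → fourierHat β ξ = 0 := fun ξ hξ => hβ ξ (Or.inr hξ)
  have hnr : (n : ℝ) = 1 ∨ (n : ℝ) = 3 := by exact_mod_cast hn
  have hR : 1 ≤ max 1 s₁⁻¹ := le_max_left _ _
  have hA : Amp s₁ c b (ampK β χ₁) := amp_ampK hχ₁ hs' hβ
  have hKd : ∀ ρ, max 1 s₁⁻¹ < ρ → ∀ y, duhamelK n β χ₁ ρ y = oscDiff n b (ampK β χ₁) ρ y :=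
    fun ρ hρ y => duhamelK_eq_oscDiff hχ₁ hs0 hs' hb hβb hρ y
  have hKS : SmoothOnHalfPlane (duhamelK n β χ₁) := contDiffOn_duhamelK hχ₁ hb hβb
  have hK : OscClass n b s₁ c (max 1 s₁⁻¹) 0 (cutoff χ (duhamelK n β χ₁)) :=
    (OscClass.congr _ _ (OscClass.oscDiff hA 1 0 le_rfl)
      fun ρ hρ y => by rw [hKd ρ hρ y]; simp).cutoff hχ
  have hE : OscClass n b s₁ c (max 1 s₁⁻¹) 1 (cutoff χ (errorK n β χ₁)) :=
    (oscClass_boxPlusOne_sub (zero_le_one.trans hR) hA hKd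
      fun ρ _ y => bdryInt_ampK hone hb hβb ρ y).cutoff hχ
  obtain ⟨Y, hY0, hY⟩ := exists_vanishesOutside_cutoff hχ_supp
  have hKS' := hKS.cutoff hχ
  have hES := (smoothOnHalfPlane_errorK hKS).cutoff hχ
  have hbound : ∀ F, OscClass n b s₁ c (max 1 s₁⁻¹) 0 F → SmoothOnHalfPlane F →
      VanishesOutside Y F → ∃ C, ∀ ρ, 1 ≤ ρ → ∀ y, ‖F ρ y‖ ≤ C := fun F h1 h2 h3 => by
    obtain ⟨C, -, hC⟩ := h1.exists_bound hnr hs0 hc hb hR hY0 h2 h3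
    exact ⟨C, fun ρ hρ y => by simpa using hC ρ hρ y⟩
  refine ⟨hKS, fun k l => ?_, fun p => ?_⟩
  · obtain ⟨C, hC⟩ := hbound _ (hK.iterate hR k l) (hKS'.iterate k l) ((hY _).iterate k l)
    obtain ⟨D, -, hD⟩ := (hE.iterate hR k l).exists_bound hnr hs0 hc hb hR hY0
      (hES.iterate k l) ((hY _).iterate k l)
    refine ⟨max C D, fun ρ hρ y => ⟨(hC ρ hρ y).trans (le_max_left _ _), ?_⟩⟩
    have hρ0 : 0 ≤ ρ⁻¹ := inv_nonneg.2 (zero_le_one.trans hρ)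
    refine (hD ρ hρ y).trans ?_
    rw [pow_one]
    exact mul_le_mul_of_nonneg_left (le_max_right _ _) hρ0
  -- The norm requires a bound for one more D_y, which is available because the class is stable
  -- under it; hence the same argument serves χK_n and both of its first derivatives.
  · have key : ∀ F, OscClass n b s₁ c (max 1 s₁⁻¹) 0 F → SmoothOnHalfPlane F →
        VanishesOutside Y F → ∃ C : ℝ≥0, ∀ ρ, 1 ≤ ρ → p.bNorm ρ (F ρ) ≤ C := fun F h1 h2 h3 => by
      obtain ⟨V, hV⟩ := hbound F h1 h2 h3
      obtain ⟨W, hW⟩ := hbound _ (h1.dY hR) h2.dY h3.dY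
      exact exists_bNorm_le_of_bound p h2 h3 hV hW
    obtain ⟨C₁, h₁⟩ := key _ hK hKS' (hY _)
    obtain ⟨C₂, h₂⟩ := key _ (hK.dY hR) hKS'.dY (hY _).dY
    obtain ⟨C₃, h₃⟩ := key _ (hK.dRho hR) hKS'.dRho (hY _).dRho
    refine ⟨C₁ + C₂ + C₃, fun ρ hρ => ?_⟩
    rw [ENNReal.coe_add, ENNReal.coe_add]
    exact add_le_add (add_le_add (h₁ ρ hρ) (h₂ ρ hρ)) (h₃ ρ hρ)
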